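/- **Setting.** Let $\mathcal S$ (messages), $\mathcal I$ (encoders), $\mathcal J$ (decoders) be finite sets, let $\mathcal A\subset\mathcal S\times\mathcal I$ be an access structure ($(s,i)\in\mathcal A$: encoder $i$ has access to message $s$), and let $\mathcal D(j)\subset\mathcal S$ be the set of messages to be reproduced by decoder $j$. Put $\mathcal I(s)=\{i:(s,i)\in\mathcal A\}$, $\mathcal S(i)=\{s:(s,i)\in\mathcal A\}$, and for $\mathcal I'\subset\mathcal I$ put $\mathcal S(\mathcal I')=\{s:\mathcal I(s)=\mathcal I'\}$; let $\mathfrak I=\{\mathcal I':\mathcal S(\mathcal I')\ne\emptyset\}$ and $\mathring{\mathcal S}(\mathcal I')=\bigcup_{\mathcal I''\in\mathfrak I,\ \mathcal I''\supsetneq\mathcal I'}\mathcal S(\mathcal I'')$. Enumerate $\mathfrak I=\{\mathcal I_1,\dots,\mathcal I_{|\mathfrak I|}\}$ so that $\mathcal I_k\subsetneq\mathcal I_{k'}$ implies $k'<k$. For a family $v=\{v_s\}_{s\in\mathcal S}$ and $\mathcal T\subset\mathcal S$ write $v_{\mathcal T}=\{v_s\}_{s\in\mathcal T}$. For every block length $n$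 let $Z^n_{\mathcal S}=\{Z^n_s\}_{s\in\mathcal S}$ have countable (finite or infinite) alphabets $\mathcal Z^n_s$ and a joint law with $$\mu_{Z^n_{\mathcal S}}(z_{\mathcal S})=\prod_{\mathcal I'\in\mathfrak I}\mu_{Z^n_{\mathcal S(\mathcal I')}|Z^n_{\mathring{\mathcal S}(\mathcal I')}}(z_{\mathcal S(\mathcal I')}|z_{\mathring{\mathcal S}(\mathcal I')});$$ given $Z^n_{\mathcal S}=z_{\mathcal S}$ let the channel inputs $X^n_i\in\mathcal X_i^n$ ($\mathcal X_i$ finite, $i\in\mathcal I$) be independent with laws $\mu_{X^n_i|Z^n_{\mathcal S(i)}}(\cdot|z_{\mathcal S(i)})$; and given also $X^n_{\mathcal I}$ let the channel outputs $Y^n_{\mathcal J}=\{Y^n_j\}_{j\in\mathcal J}$, with values in arbitrary measurable spaces, have the law $\mu_{Y^n_{\mathcal J}|X^n_{\mathcal I}}$ of an arbitrary channel. No consistency, stationarity or ergodicity in $n$ is assumed. Let $$\overline H(\mathbf U|\mathbf V)=\inf\Bigl\{\theta:\lim_{n\to\infty}\mathrm P\Bigl(\tfrac1n\log_2\tfrac1{\mu_{U_n|V_n}(U_n|V_n)}>\theta\Bigr)=0\Bigr\},\qquad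 \underline H(\mathbf U|\mathbf V)=\sup\Bigl\{\theta:\lim_{n\to\infty}\mathrm P\Bigl(\tfrac1n\log_2\tfrac1{\mu_{U_n|V_n}(U_n|V_n)}<\theta\Bigr)=0\Bigr\},$$ with values in the extended real line. **The code.** Let $\mathcal C^{(n)}_s$ and $\mathcal M^{(n)}_s$ be non-empty finite sets with $\frac1n\log_2|\mathcal C^{(n)}_s|\to r_s$ and $\frac1n\log_2|\mathcal M^{(n)}_s|\to R_s$, and let functions $f_s:\mathcal Z^n_s\to\mathcal C^{(n)}_s$, $g_s:\mathcal Z^n_s\to\mathcal M^{(n)}_s$ and elements $c_s\in\mathcal C^{(n)}_s$ be given. The messages $M_s$ are independent and uniform on $\mathcal M^{(n)}_s$. *Encoders:* for $k=1,\dots,|\mathfrak I|$ in this order, and given the previously generated $z_{\mathring{\mathcal S}(\mathcal I_k)}$, a constrained-random-number generator draws $z_{\mathcal S(\mathcal I_k)}$ from the law $\mu_{Z^n_{\mathcal S(\mathcal I_k)}|Z^n_{\mathring{\mathcal S}(\mathcal I_k)}}(\cdot|z_{\mathring{\mathcal S}(\mathcal I_k)})$ conditioned on the event that $f_s(z_s)=c_s$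 and $g_s(z_s)=M_s$ for all $s\in\mathcal S(\mathcal I_k)$; its output is shared by all encoders in $\mathcal I_k$, and an error is declared if this event has probability $0$. Encoder $i$, which takes part in the steps with $i\in\mathcal I_k$ and so knows $z_{\mathcal S(i)}$, sends a random $x_i$ with law $\mu_{X^n_i|Z^n_{\mathcal S(i)}}(\cdot|z_{\mathcal S(i)})$. *Decoders:* on the channel output $y_j$, decoder $j$ draws $\hat z_{\mathcal D(j)}$ from the law $\mu_{Z^n_{\mathcal D(j)}|Y^n_j}(\cdot|y_j)$ conditioned on the event that $f_s(\hat z_s)=c_s$ for all $s\in\mathcal D(j)$ (if this event has probability $0$, this counts as a decoding failure), and puts out $\hat M_{j,s}=g_s(\hat z_s)$ for $s\in\mathcal D(j)$. Let $\mathrm{Error}(f_{\mathcal S},g_{\mathcal S},c_{\mathcal S})$ be the probability that an encoder declares an error, or that some decoder $j$ fails or has $\hat M_{j,s}\ne M_s$ for some $s\in\mathcal D(j)$. **Hash property.** An ensemble $(\mathcal F,p)$ is a set $\mathcal F$ of functions on a set $\mathcal Z$ with a probability law $p$ on it; $\mathrm{Im}\,\mathcal F$ is the union of the ranges of the $f\in\mathcal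 F$. A sequence of ensembles $(\mathcal F_n,p_n)$ on sets $\mathcal Z_n$ has the hash property if there are $\alpha_n\to1$ and $\beta_n\to0$ such that, for all $n$ and all $z\in\mathcal Z_n$, $\sum_{z'}p_n(\{f:f(z)=f(z')\})\le\beta_n$, where the sum is over the $z'\neq z$ with $p_n(\{f:f(z)=f(z')\})>\alpha_n/|\mathrm{Im}\,\mathcal F_n|$. **Theorem.** Suppose that $R_s\ge0$ for all $s\in\mathcal S$, that $$\sum_{s\in\mathcal S'}(R_s+r_s)<\underline H(\mathbf Z_{\mathcal S'}|\mathbf Z_{\mathring{\mathcal S}(\mathcal I')})\quad\text{for all }\mathcal I'\in\mathfrak I,\ \emptyset\ne\mathcal S'\subset\mathcal S(\mathcal I'),$$ and that $$\sum_{s\in\mathcal D'}r_s>\overline H(\mathbf Z_{\mathcal D'}|\mathbf Y_j,\mathbf Z_{\mathcal D(j)\setminus\mathcal D'})\quad\text{for all }j\in\mathcal J,\ \emptyset\ne\mathcal D'\subset\mathcal D(j).$$ Then for every $\delta>0$ and all sufficiently large $n$ there are functions $f_{\mathcal S},g_{\mathcal S}$ and a vector $c_{\mathcal S}$ with $\mathrm{Error}(f_{\mathcal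 S},g_{\mathcal S},c_{\mathcal S})\le\delta$. Moreover, for any sequences of ensembles $\mathcal F_s$ and $\mathcal G_s$ of functions on $\mathcal Z^n_s$, $s\in\mathcal S$, with $\mathrm{Im}\,\mathcal F_s=\mathcal C^{(n)}_s$ and $\mathrm{Im}\,\mathcal G_s=\mathcal M^{(n)}_s$ that have the hash property (for example, ensembles of sparse matrices with the hash property), for every $\delta>0$ and all sufficiently large $n$ such functions can be chosen with $f_s\in\mathcal F_s$ and $g_s\in\mathcal G_s$ for all $s\in\mathcal S$. -/

import Mathlib

open MeasureTheory ProbabilityTheory Filter Topology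
open scoped ENNReal NNReal

noncomputable section

namespace RelaylessNetwork

/-! ### Message access structures -/

section Access

variable {S I : Type*} [Fintype S] [Fintype I] [DecidableEq S] [DecidableEq I]

/-- The set `I(s)` of the encoders that have access to message `s`. -/
def encodersOf (A : Finset (S × I)) (s : S) : Finset I :=
  Finset.univ.filter fun i => (s, i) ∈ A

/-- The set `S(i)` of the messages to which encoder `i` has access. -/
def messagesOf (A : Finset (S × I)) (i : I) : Finset S :=
  Finset.univ.filter fun s => (s, i) ∈ A

/-- The set `S(I')` of the messages `s` with `I(s) = I'`. -/
def privateMessages (A : Finset (S × I)) (I' : Finset I) : Finset S :=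
  Finset.univ.filter fun s => encodersOf A s = I'

/-- The family `𝔍` of the sets `I'` of encoders with `S(I') ≠ ∅`. -/
def accessFamily (A : Finset (S × I)) : Finset (Finset I) :=
  Finset.univ.filter fun I' => (privateMessages A I').Nonempty

/-- The union `S°(I')` of the sets `S(I'')` over the `I'' ∈ 𝔍` that strictly contain `I'`. -/
def publicMessages (A : Finset (S × I)) (I' : Finset I) : Finset S :=
  ((accessFamily A).filter fun I'' => I' ⊂ I'').biUnion (privateMessages A)

/-- `L` enumerates `𝔍` without repetition, and every set comes after its strict supersets
in `𝔍`. -/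
def IsReverseLinearExtension (A : Finset (S × I)) (L : List (Finset I)) : Prop :=
  L.Nodup ∧ (∀ I', I' ∈ L ↔ I' ∈ accessFamily A) ∧ L.Pairwise fun I₁ I₂ => ¬ I₁ ⊂ I₂

end Access

/-! ### Limits in probability and spectral entropy rates -/

section Spectrum

/-- Limit superior in probability, with values in the extended real line. -/
def pLimsup {Ω : ℕ → Type*} [∀ n, MeasurableSpace (Ω n)] (P : ∀ n, Measure (Ω n))
    (U : ∀ n, Ω n → ℝ) : EReal :=
  sInf {θ : EReal | Tendsto (fun n => P n {ω | θ < (U n ω : EReal)}) atTop (𝓝 0)}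

/-- Limit inferior in probability, with values in the extended real line. -/
def pLiminf {Ω : ℕ → Type*} [∀ n, MeasurableSpace (Ω n)] (P : ∀ n, Measure (Ω n))
    (U : ∀ n, Ω n → ℝ) : EReal :=
  sSup {θ : EReal | Tendsto (fun n => P n {ω | (U n ω : EReal) < θ}) atTop (𝓝 0)}

variable {Ω α β : ℕ → Type*} [∀ n, MeasurableSpace (Ω n)]
  [∀ n, MeasurableSpace (α n)] [∀ n, StandardBorelSpace (α n)] [∀ n, Nonempty (α n)]
  [∀ n, MeasurableSpace (β n)]

/-- The normalized conditional information `(1/n) log₂ (1 / μ_{U|V}(U|V))` of a discrete random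
variable `U n` given `V n`. -/
def condInformation (P : ∀ n, Measure (Ω n)) [∀ n, IsFiniteMeasure (P n)]
    (U : ∀ n, Ω n → α n) (V : ∀ n, Ω n → β n) (n : ℕ) (ω : Ω n) : ℝ :=
  (1 / (n : ℝ)) * Real.logb 2 (1 / (condDistrib (U n) (V n) (P n) (V n ω)).real {U n ω})

/-- The spectral conditional sup-entropy rate of `U` given `V`. -/
def spectralSup (P : ∀ n, Measure (Ω n)) [∀ n, IsFiniteMeasure (P n)]
    (U : ∀ n, Ω n → α n) (V : ∀ n, Ω n → β n) : EReal :=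
  pLimsup P (condInformation P U V)

/-- The spectral conditional inf-entropy rate of `U` given `V`. -/
def spectralInf (P : ∀ n, Measure (Ω n)) [∀ n, IsFiniteMeasure (P n)]
    (U : ∀ n, Ω n → α n) (V : ∀ n, Ω n → β n) : EReal :=
  pLiminf P (condInformation P U V)

end Spectrum

/-! ### The joint law of sources, channel inputs and channel outputs at one block length -/

section Law

variable {S I J : Type*} [Fintype S] [Fintype I] [DecidableEq S] [DecidableEq I]
  {Z : S → Type*} {X : I → Type*} {Y : J → Type*}
  [∀ s, MeasurableSpace (Z s)] [∀ i, MeasurableSpace (X i)] [∀ j, MeasurableSpace (Y j)]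

/-- The conditional probability `μ_{Z_T | Z_T'}(w | z')`; it is `0` if `z'` has probability `0`. -/
def condWeight (μ : Measure (∀ s, Z s)) (T T' : Finset S) (z' : ∀ s : T', Z s)
    (w : ∀ s : T, Z s) : ℝ≥0∞ :=
  μ {z | T.restrict z = w ∧ T'.restrict z = z'} / μ {z | T'.restrict z = z'}

/-- The law `μ` of the discrete source `Z_S` is the product over `I' ∈ 𝔍` of the conditional laws of
`Z_{S(I')}` given `Z_{S°(I')}`. -/
def IsConsistent (A : Finset (S × I)) (μ : Measure (∀ s, Z s)) : Prop :=
  ∀ z : ∀ s, Z s, μ {z} = ∏ I' ∈ accessFamily A,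
    condWeight μ (privateMessages A I') (publicMessages A I')
      ((publicMessages A I').restrict z) ((privateMessages A I').restrict z)

variable [∀ s, Countable (Z s)] [∀ s, MeasurableSingletonClass (Z s)]

/-- The channel from `Z_S` to `X_I`: given `z`, the `X_i` are independent, and `X_i` has the law
`W i` given `z_{S(i)}`. -/
def inputKernel (A : Finset (S × I)) (W : ∀ i, Kernel (∀ s : messagesOf A i, Z s) (X i)) :
    Kernel (∀ s, Z s) (∀ i, X i) :=
  Kernel.ofFunOfCountable fun z => Measure.pi fun i => W i ((messagesOf A i).restrict z)

instance (A : Finset (S × I)) (W : ∀ i, Kernel (∀ s : messagesOf A i, Z s) (X i))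
    [∀ i, IsMarkovKernel (W i)] : IsMarkovKernel (inputKernel A W) :=
  ⟨fun z => inferInstanceAs
    (IsProbabilityMeasure (Measure.pi fun i => W i ((messagesOf A i).restrict z)))⟩

/-- The joint law of `(Z_S, X_I, Y_J)`. -/
def jointLaw (A : Finset (S × I)) (μ : Measure (∀ s, Z s))
    (W : ∀ i, Kernel (∀ s : messagesOf A i, Z s) (X i)) (V : Kernel (∀ i, X i) (∀ j, Y j)) :
    Measure ((∀ s, Z s) × (∀ i, X i) × (∀ j, Y j)) :=
  μ ⊗ₘ (inputKernel A W ⊗ₖ Kernel.prodMkLeft (∀ s, Z s) V)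

instance (A : Finset (S × I)) (μ : Measure (∀ s, Z s)) [IsProbabilityMeasure μ]
    (W : ∀ i, Kernel (∀ s : messagesOf A i, Z s) (X i)) [∀ i, IsMarkovKernel (W i)]
    (V : Kernel (∀ i, X i) (∀ j, Y j)) [IsMarkovKernel V] :
    IsProbabilityMeasure (jointLaw A μ W V) := by
  unfold jointLaw; infer_instance

end Law

/-! ### The code at one block length -/

section Code

/-- Constrained-random-number generator: a random element of `E`, with probabilities proportional
to the weights `w`. If `E` has weight `0`, it declares an error, `none`. -/
def constrainedGenerator {α : Type*} (w : α → ℝ≥0∞) (E : Set α) : PMF (Option α) :=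
  open Classical in
  if h : tsum (E.indicator w) ≠ 0 ∧ tsum (E.indicator w) ≠ ∞ then
    (PMF.normalize (E.indicator w) h.1 h.2).map some
  else PMF.pure none

variable {S I J : Type*} [Fintype S] [Fintype I] [DecidableEq S] [DecidableEq I]
  {Z C M : S → Type*} {X : I → Type*} {Y : J → Type*}

/-- The vectors `z_T` with `f_s(z_s) = c_s` for all `s ∈ T`. -/
def fiber (T : Finset S) (f : ∀ s, Z s → C s) (c : ∀ s : T, C s) : Set (∀ s : T, Z s) :=
  {z | ∀ s : T, f s (z s) = c s}

/-- The vector that agrees with `w` on `T` and with `z` outside `T`. -/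
def overwrite (T : Finset S) (z : ∀ s, Z s) (w : ∀ s : T, Z s) : ∀ s, Z s :=
  fun s => if h : s ∈ T then w ⟨s, h⟩ else z s

variable [∀ s, MeasurableSpace (Z s)]

/-- One encoding step: given the part `z_{S°(I')}` that was generated earlier and the messages
`m_{S(I')}`, generate `z_{S(I')}` according to `μ_{Z_{S(I')} | Z_{S°(I')}}(· | z_{S°(I')})`, subject
to `f_s(z_s) = c_s` and `g_s(z_s) = m_s` for all `s ∈ S(I')`. -/
def encoderGenerator (A : Finset (S × I)) (μ : Measure (∀ s, Z s)) (f : ∀ s, Z s → C s)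
    (g : ∀ s, Z s → M s) (I' : Finset I) (z' : ∀ s : publicMessages A I', Z s)
    (c : ∀ s : privateMessages A I', C s) (m : ∀ s : privateMessages A I', M s) :
    PMF (Option (∀ s : privateMessages A I', Z s)) :=
  constrainedGenerator (condWeight μ (privateMessages A I') (publicMessages A I') z')
    (fiber (privateMessages A I') f c ∩ fiber (privateMessages A I') g m)

/-- The encoding steps along a list of sets of encoders. The output of the step of `I'` is shared by
all encoders in `I'`, so a single vector `z` records all outputs: encoder `i` takes part in the
steps of the `I' ∋ i` only and knows just the part `z_{S(i)}`. The run ends with `none` as soon as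
a step declares an error. -/
def encoderRun (A : Finset (S × I)) (μ : Measure (∀ s, Z s)) (f : ∀ s, Z s → C s)
    (g : ∀ s, Z s → M s) (c : ∀ s, C s) (m : ∀ s, M s) :
    List (Finset I) → (∀ s, Z s) → PMF (Option (∀ s, Z s))
  | [], z => PMF.pure (some z)
  | I' :: L, z =>
    (encoderGenerator A μ f g I' ((publicMessages A I').restrict z)
      ((privateMessages A I').restrict c) ((privateMessages A I').restrict m)).bind fun o =>
        match o with
        | none => PMF.pure none
        | some w => encoderRun A μ f g c m L (overwrite (privateMessages A I') z w)

/-- The output of a decoder for the messages in `D`, with a posteriori law `κ` of `Z_D`, on the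
channel output `y`: generate `ẑ_D` according to `κ(· | y)`, subject to `f_s(ẑ_s) = c_s` for all
`s ∈ D`, and put out `g_s(ẑ_s)`, `s ∈ D`. -/
def decoderOutput {B : Type*} [MeasurableSpace B] (D : Finset S) (κ : Kernel B (∀ s : D, Z s))
    (f : ∀ s, Z s → C s) (g : ∀ s, Z s → M s) (c : ∀ s : D, C s) (y : B) :
    PMF (Option (∀ s : D, M s)) :=
  (constrainedGenerator (fun z => κ y {z}) (fiber D f c)).map
    (Option.map fun z s => g s (z s))

variable [Fintype J]
  [∀ s, Countable (Z s)] [∀ s, MeasurableSingletonClass (Z s)] [∀ s, Nonempty (Z s)]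
  [∀ i, MeasurableSpace (X i)] [∀ j, MeasurableSpace (Y j)]
  [∀ s, Fintype (M s)]

/-- The a posteriori law `μ_{Z_{D(j)} | Y_j}`. -/
def posterior (A : Finset (S × I)) (D : J → Finset S) (μ : Measure (∀ s, Z s))
    [IsProbabilityMeasure μ] (W : ∀ i, Kernel (∀ s : messagesOf A i, Z s) (X i))
    [∀ i, IsMarkovKernel (W i)] (V : Kernel (∀ i, X i) (∀ j, Y j)) [IsMarkovKernel V] (j : J) :
    Kernel (Y j) (∀ s : D j, Z s) :=
  condDistrib (fun ω : (∀ s, Z s) × (∀ i, X i) × (∀ j, Y j) => (D j).restrict ω.1)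
    (fun ω => ω.2.2 j) (jointLaw A μ W V)

/-- The probability that, on the channel outputs `y`, some decoder `j` does not put out `m_s` for
all `s ∈ D(j)`. The decoders use independent randomness. -/
def mismatchProb (A : Finset (S × I)) (D : J → Finset S) (μ : Measure (∀ s, Z s))
    [IsProbabilityMeasure μ] (W : ∀ i, Kernel (∀ s : messagesOf A i, Z s) (X i))
    [∀ i, IsMarkovKernel (W i)] (V : Kernel (∀ i, X i) (∀ j, Y j)) [IsMarkovKernel V]
    (f : ∀ s, Z s → C s) (g : ∀ s, Z s → M s) (c : ∀ s, C s) (m : ∀ s, M s) (y : ∀ j, Y j) :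
    ℝ≥0∞ :=
  open Classical in
  ∑' d : ∀ j, Option (∀ s : D j, M s),
    if ∃ j, d j ≠ some ((D j).restrict m) then
      ∏ j, decoderOutput (D j) (posterior A D μ W V j) f g ((D j).restrict c) (y j) (d j)
    else 0

/-- The total error probability of the code, for independent and uniform messages: the probability
that an encoder declares an error or that some decoder `j` does not reproduce all the messages in
`D(j)`. The starting vector of the encoding run is irrelevant, as every coordinate is generated
before it is used. -/
def errorProb (A : Finset (S × I)) (L : List (Finset I)) (D : J → Finset S)
    (μ : Measure (∀ s, Z s)) [IsProbabilityMeasure μ]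
    (W : ∀ i, Kernel (∀ s : messagesOf A i, Z s) (X i)) [∀ i, IsMarkovKernel (W i)]
    (V : Kernel (∀ i, X i) (∀ j, Y j)) [IsMarkovKernel V]
    (f : ∀ s, Z s → C s) (g : ∀ s, Z s → M s) (c : ∀ s, C s) : ℝ≥0∞ :=
  ∑ m : ∀ s, M s, (∏ s, (Fintype.card (M s) : ℝ≥0∞)⁻¹) *
    ∑' o : Option (∀ s, Z s),
      encoderRun A μ f g c m L (fun _ => Classical.arbitrary _) o *
        match o with
        | none => 1
        | some z => ∫⁻ x, ∫⁻ y, mismatchProb A D μ W V f g c m y ∂(V x) ∂(inputKernel A W z)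

end Code

/-! ### Hash property -/

section Hash

/-- An ensemble of functions: a set of functions with a probability law on it. -/
structure Ensemble (α γ : Type*) [MeasurableSpace γ] where
  /-- The functions of the ensemble. -/
  funs : Set (α → γ)
  /-- The law of the random function. -/
  law : Measure (α → γ)
  isProbabilityMeasure : IsProbabilityMeasure law
  ae_mem : ∀ᵐ f ∂law, f ∈ funs

/-- The union of the ranges of the functions of the ensemble. -/
def Ensemble.im {α γ : Type*} [MeasurableSpace γ] (E : Ensemble α γ) : Set γ :=
  ⋃ f ∈ E.funs, Set.range f

/-- The `(a, b)`-hash property of one ensemble. -/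
def Ensemble.IsHash {α γ : Type*} [MeasurableSpace γ] (E : Ensemble α γ) (a b : ℝ≥0) : Prop :=
  open Classical in
  ∀ z : α, (∑' z' : α,
    if z' ≠ z ∧ (a : ℝ≥0∞) / (E.im.ncard : ℝ≥0∞) < E.law {f | f z = f z'} then
      E.law {f | f z = f z'}
    else 0) ≤ (b : ℝ≥0∞)

/-- The hash property of a sequence of ensembles: the `(a n, b n)`-hash property for some `a → 1`
and `b → 0`. -/
def HasHashProperty {α γ : ℕ → Type*} [∀ n, MeasurableSpace (γ n)]
    (E : ∀ n, Ensemble (α n) (γ n)) : Prop :=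
  ∃ a b : ℕ → ℝ≥0, Tendsto a atTop (𝓝 1) ∧ Tendsto b atTop (𝓝 0) ∧ ∀ n, (E n).IsHash (a n) (b n)

end Hash

end RelaylessNetwork

end

noncomputable section

namespace RelaylessNetwork

set_option linter.unusedSectionVars false

/-! ### Sums over finite products of discrete sets -/

section DiscreteSums

/-! Draw the functions `f_s`, `g_s` from the ensembles and the vector `c` uniformly. The prescribed
values `(c, m)` are then uniform. If the source vector `z` has these values, the code produces it
together with them with at least the source probability of `z` times one factor per encoding step,
namely the uniform probability of the step's values divided by their conditional source probability.
`stepDensity` truncates this factor at `1`, so `μ {z}` times the product of the truncated factors is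
a common lower bound for the code and for an ideal experiment: `z` drawn from `μ`, `c = f(z)`, `m =
g(z)`. Hence the average error of the code is at most the error in the ideal experiment plus the
expected deficits `1 - stepDensity` of the steps (`measure_mul_prod_stepDensity_le`,
`sum_encoderRun_mul_le`).

Deficits. A deficit measures how far the law of the random value `(f(z), g(z))` is from uniform. A
second-moment estimate bounds it through the probability that two typical vectors share their values
(`tsum_deficit_le`). By the hash property a pair of letters collides about as rarely as under
uniform random functions, apart from a set of exceptional letters of bounded total collision
probability. Typicality bounds the conditional probability of every subvector on `O` by `2 ^ (-n
θ)`, with `θ` above the sum of `R_s + r_s` over `O`. So in the sum over the sets `O` of exceptional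
coordinates only `O = ∅` survives, with limit `1`, which is the value for uniformity
(`tsum_weight_mul_collision_le`, `tendsto_collisionSum`).

Decoders. In the ideal experiment the true vector and the sample of the decoder are exchangeable
given the channel output and the values of `f`. An error thus requires one of them to be atypical,
or two distinct typical vectors with equal values (`tsum_posterior_error_le`). At most `2 ^ (n ν)`
typical vectors agree with a given one outside `O`, with `ν` below the sum of `r_s` over `O`, so
such collisions are improbable (`tsum_posteriorTypical_le`, `lintegral_collisionBound_le`).

All these bounds are averages, so one choice of functions in the ensembles, followed by one `c`,
meets their sum (`exists_code_le`). Random binning supplies ensembles with the hash property when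
none are given. -/

theorem tsum_pi_prod_le {ι : Type*} [Fintype ι] {Z : ι → Type*} (φ : ∀ i, Z i → ℝ≥0∞) :
    ∑' u : ∀ i, Z i, ∏ i, φ i (u i) ≤ ∏ i, ∑' x, φ i x := by
  classical
  rw [ENNReal.tsum_eq_iSup_sum]
  refine iSup_le fun F => ?_
  calc ∑ u ∈ F, ∏ i, φ i (u i)
      ≤ ∑ u ∈ Fintype.piFinset fun i => F.image fun u => u i, ∏ i, φ i (u i) :=
        Finset.sum_le_sum_of_subset fun u hu =>
          Fintype.mem_piFinset.2 fun i => Finset.mem_image_of_mem _ hu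
    _ = ∏ i, ∑ x ∈ F.image fun u => u i, φ i x := (Finset.prod_univ_sum _ _).symm
    _ ≤ ∏ i, ∑' x, φ i x := Finset.prod_le_prod' fun i _ => ENNReal.sum_le_tsum _

theorem tsum_fiberwise {α β : Type*} (π : α → β) (F : α → ℝ≥0∞) :
    ∑' b, ∑' a, (π ⁻¹' {b}).indicator F a = ∑' a, F a := by
  classical
  rw [ENNReal.tsum_comm]
  refine tsum_congr fun a => ?_
  rw [tsum_eq_single (π a)]
  · simp
  · intro b hb
    exact Set.indicator_of_notMem (fun h => hb h.symm) _

/-- A weighted sum of products of collision probabilities. The weights of the vectors in `T` that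
agree with a given vector of `T` on `O` add up to at most `B O`. -/
theorem tsum_weight_mul_collision_le {ι : Type*} [Fintype ι] [DecidableEq ι] {Z : ι → Type*}
    (q : (∀ i, Z i) → ℝ≥0∞) (T : Set (∀ i, Z i)) (p : ∀ i, Z i → ℝ≥0∞) (E : ∀ i, Set (Z i))
    (a b : ι → ℝ≥0∞) (B : Finset ι → ℝ≥0∞)
    (ha : ∀ i, ∀ x ∉ E i, p i x ≤ a i) (hb : ∀ i, ∑' x, (E i).indicator (p i) x ≤ b i)
    (hB : ∀ O, ∀ w ∈ T, ∑' w', {w' : ∀ i, Z i | ∀ i ∈ O, w' i = w i}.indicator q w' ≤ B O) :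
    ∑' w, T.indicator q w * ∏ i, p i (w i) ≤
      ∑ O : Finset ι, (∏ i ∈ Oᶜ, a i) * ((∏ i ∈ O, b i) * B O) := by
  classical
  calc ∑' w, T.indicator q w * ∏ i, p i (w i)
      ≤ ∑' w, ∑ O : Finset ι, (∏ i ∈ Oᶜ, a i) *
          (T.indicator q w * ∏ i ∈ O, (E i).indicator (p i) (w i)) := by
        refine ENNReal.tsum_le_tsum fun w => ?_
        -- A single summand suffices: `O` is the exact set of coordinates at which `w` is
        -- exceptional.
        refine le_trans ?_ (Finset.single_le_sum (fun O _ => zero_le)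
          (Finset.mem_univ (Finset.univ.filter fun i => w i ∈ E i)))
        rw [mul_left_comm]
        gcongr
        rw [← Finset.prod_compl_mul_prod (Finset.univ.filter fun i => w i ∈ E i)]
        refine mul_le_mul' (Finset.prod_le_prod' fun i hi => ha i _ (by simpa using hi))
          (Finset.prod_le_prod' fun i hi => ?_)
        rw [Set.indicator_of_mem (by simpa using hi)]
    _ = ∑ O : Finset ι, (∏ i ∈ Oᶜ, a i) *
          ∑' w, (T.indicator q w * ∏ i ∈ O, (E i).indicator (p i) (w i)) := by
        rw [Summable.tsum_finsetSum fun _ _ => ENNReal.summable]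
        simp_rw [ENNReal.tsum_mul_left]
    _ ≤ _ := by
        refine Finset.sum_le_sum fun O _ => ?_
        gcongr
        -- The remaining product depends only on the coordinates in `O`. Grouping by their values
        -- leaves, for each value, a weight that `B O` controls.
        rw [← tsum_fiberwise (fun w : ∀ i, Z i => O.restrict w)]
        calc ∑' u : ∀ i : O, Z i, ∑' w, ((fun w : ∀ i, Z i => O.restrict w) ⁻¹' {u}).indicator
              (fun w => T.indicator q w * ∏ i ∈ O, (E i).indicator (p i) (w i)) w
            ≤ ∑' u : ∀ i : O, Z i, (∏ i : O, (E i).indicator (p i) (u i)) * B O := by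
              refine ENNReal.tsum_le_tsum fun u => ?_
              have h1 : ∀ w, ((fun w : ∀ i, Z i => O.restrict w) ⁻¹' {u}).indicator
                  (fun w => T.indicator q w * ∏ i ∈ O, (E i).indicator (p i) (w i)) w =
                  (∏ i : O, (E i).indicator (p i) (u i)) *
                    ((fun w : ∀ i, Z i => O.restrict w) ⁻¹' {u}).indicator (T.indicator q) w := by
                intro w
                by_cases hw : O.restrict w = u
                · have hw' : w ∈ (fun w : ∀ i, Z i => O.restrict w) ⁻¹' {u} := hw
                  rw [Set.indicator_of_mem hw', Set.indicator_of_mem hw', mul_comm, ← hw,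
                    ← Finset.prod_coe_sort O]
                  rfl
                · rw [Set.indicator_of_notMem (by simpa using hw),
                    Set.indicator_of_notMem (by simpa using hw), mul_zero]
              simp_rw [h1, ENNReal.tsum_mul_left]
              gcongr
              -- `hB` needs a reference vector in `T`; values on `O` that no vector of `T` takes
              -- contribute nothing.
              by_cases hex : ∃ w ∈ T, O.restrict w = u
              · obtain ⟨w, hwT, hw⟩ := hex
                refine le_trans (ENNReal.tsum_le_tsum fun w' => ?_) (hB O w hwT)
                by_cases h : O.restrict w' = u
                · rw [Set.indicator_of_mem (by simpa using h), Set.indicator_of_mem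
                    (s := {w' : ∀ i, Z i | ∀ i ∈ O, w' i = w i})]
                  · exact Set.indicator_le_self _ _ _
                  · intro i hi
                    exact congrFun (h.trans hw.symm) ⟨i, hi⟩
                · rw [Set.indicator_of_notMem (by simpa using h)]
                  exact zero_le
              · push Not at hex
                rw [ENNReal.tsum_eq_zero.2]
                · exact zero_le
                · intro w
                  by_cases h : O.restrict w = u
                  · rw [Set.indicator_of_mem (by simpa using h), Set.indicator_of_notMem]
                    exact fun hw => hex w hw h
                  · rw [Set.indicator_of_notMem (by simpa using h)]
          _ ≤ (∏ i ∈ O, b i) * B O := by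
              rw [ENNReal.tsum_mul_right]
              gcongr
              refine (tsum_pi_prod_le fun (i : O) x => (E i).indicator (p i) x).trans ?_
              rw [← Finset.prod_coe_sort O]
              exact Finset.prod_le_prod' fun i _ => hb i

/-- A sum of products of collision probabilities of the vectors in `T` with a given vector `z`. -/
theorem tsum_collision_le {ι : Type*} [Fintype ι] [DecidableEq ι] {Z : ι → Type*}
    (z : ∀ i, Z i) (T : Set (∀ i, Z i)) (p : ∀ i, Z i → ℝ≥0∞) (E : ∀ i, Set (Z i))
    (a : ι → ℝ≥0∞) (N : Finset ι → ℝ≥0∞)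
    (hp : ∀ i x, p i x ≤ 1) (ha : ∀ i, ∀ x ∉ E i, x ≠ z i → p i x ≤ a i)
    (hN : ∀ O : Finset ι, O.Nonempty →
      ∑' w, {w | w ∈ T ∧ ∀ i ∉ O, w i = z i}.indicator (fun _ => (1 : ℝ≥0∞)) w ≤ N O) :
    ∑' w, {w | w ∈ T ∧ w ≠ z ∧ ∀ i, w i ∉ E i}.indicator (fun w => ∏ i, p i (w i)) w ≤
      ∑ O ∈ Finset.univ.filter fun O : Finset ι => O.Nonempty, N O * ∏ i ∈ O, a i := by
  classical
  calc ∑' w, {w | w ∈ T ∧ w ≠ z ∧ ∀ i, w i ∉ E i}.indicator (fun w => ∏ i, p i (w i)) w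
      ≤ ∑' w, ∑ O ∈ Finset.univ.filter fun O : Finset ι => O.Nonempty,
          {w | w ∈ T ∧ ∀ i ∉ O, w i = z i}.indicator (fun _ => (1 : ℝ≥0∞)) w * ∏ i ∈ O, a i := by
        refine ENNReal.tsum_le_tsum fun w => ?_
        by_cases hw : w ∈ T ∧ w ≠ z ∧ ∀ i, w i ∉ E i
        · rw [Set.indicator_of_mem (s := {w | w ∈ T ∧ w ≠ z ∧ ∀ i, w i ∉ E i}) hw]
          -- Here `O` is the set of coordinates at which `w` differs from `z`; the factors outside
          -- it are at most `1`.
          refine le_trans ?_ (Finset.single_le_sum (fun O _ => zero_le)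
            (a := Finset.univ.filter fun i => w i ≠ z i) ?_)
          · rw [Set.indicator_of_mem, one_mul]
            · rw [← Finset.prod_compl_mul_prod (Finset.univ.filter fun i => w i ≠ z i)]
              refine (mul_le_mul' (Finset.prod_le_one' fun i _ => hp i _) le_rfl).trans ?_
              rw [one_mul]
              exact Finset.prod_le_prod' fun i hi => ha i _ (hw.2.2 i) (by simpa using hi)
            · exact ⟨hw.1, fun i hi => by simpa using hi⟩
          · obtain ⟨i, hi⟩ := Function.ne_iff.1 hw.2.1
            simpa using ⟨i, by simpa using hi⟩
        · rw [Set.indicator_of_notMem (s := {w | w ∈ T ∧ w ≠ z ∧ ∀ i, w i ∉ E i}) hw]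
          exact zero_le
    _ ≤ _ := by
        rw [Summable.tsum_finsetSum fun _ _ => ENNReal.summable]
        refine Finset.sum_le_sum fun O hO => ?_
        rw [ENNReal.tsum_mul_right]
        gcongr
        exact hN O (by simpa using hO)

end DiscreteSums

/-! ### Uniformity of random fibers -/

section Fibers

variable {α Γ : Type*}

/-- The weight of the fiber of `φ` through `x`. -/
def fiberWeight (q : α → ℝ≥0∞) (φ : α → Γ) (x : α) : ℝ≥0∞ :=
  ∑' x', {x' | φ x' = φ x}.indicator q x'

theorem le_fiberWeight (q : α → ℝ≥0∞) (φ : α → Γ) (x : α) : q x ≤ fiberWeight q φ x := by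
  refine le_trans ?_ (ENNReal.le_tsum x)
  rw [Set.indicator_of_mem]
  exact rfl

theorem fiberWeight_le (q : α → ℝ≥0∞) (φ : α → Γ) (x : α) : fiberWeight q φ x ≤ ∑' x, q x :=
  ENNReal.tsum_le_tsum fun _ => Set.indicator_le_self _ _ _

theorem fiberWeight_congr (q : α → ℝ≥0∞) {φ : α → Γ} {x y : α} (h : φ x = φ y) :
    fiberWeight q φ x = fiberWeight q φ y := by
  simp only [fiberWeight, h]

/-- The posterior sampler that knows `φ x` draws an element other than `x` with small probability
if few elements of `T` share their value of `φ` with another one. -/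
theorem tsum_posterior_error_le (q : α → ℝ≥0∞) (hq : ∑' x, q x = 1) (φ : α → Γ) (T : Set α)
    (b : α → ℝ≥0∞) (hb : ∀ x ∈ T, (∃ x' ∈ T, x' ≠ x ∧ φ x' = φ x) → 1 ≤ b x) :
    ∑' x, q x * (1 - q x / fiberWeight q φ x) ≤
      2 * ∑' x, Tᶜ.indicator q x + ∑' x, q x * b x := by
  classical
  -- `k x` is the law of the posterior sample when the truth is `x`. It is reversible with respect
  -- to `q` (`hsym`), which makes truth and sample exchangeable.
  set k : α → α → ℝ≥0∞ := fun x x' => if φ x' = φ x then q x' / fiberWeight q φ x else 0 with hk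
  have hfin : ∀ x, fiberWeight q φ x ≠ ∞ := fun x =>
    ((fiberWeight_le q φ x).trans_lt (by rw [hq]; exact ENNReal.one_lt_top)).ne
  have hksum : ∀ x, ∑' x', k x x' = fiberWeight q φ x / fiberWeight q φ x := by
    intro x
    rw [ENNReal.div_eq_inv_mul, fiberWeight, ← ENNReal.tsum_mul_left]
    refine tsum_congr fun x' => ?_
    simp only [hk, Set.indicator_apply, Set.mem_ofPred_eq]
    split_ifs
    · rw [ENNReal.div_eq_inv_mul]; rfl
    · simp
  have hk1 : ∀ x, ∑' x', k x x' ≤ 1 := fun x => (hksum x).trans_le ENNReal.div_self_le_one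
  have hsym : ∀ x x', q x * k x x' = q x' * k x' x := by
    intro x x'
    simp only [hk]
    by_cases h : φ x' = φ x
    · rw [if_pos h, if_pos h.symm, fiberWeight_congr q h, ENNReal.div_eq_inv_mul,
        ENNReal.div_eq_inv_mul]
      ring
    · rw [if_neg h, if_neg fun h' => h h'.symm, mul_zero, mul_zero]
  have hself : ∀ x, k x x = q x / fiberWeight q φ x := fun x => if_pos rfl
  have hsingle : ∀ x, ∑' x', ({x} : Set α).indicator (k x) x' = k x x := fun x => by
    rw [tsum_eq_single x fun y hy => by simp [hy]]
    simp
  have h1 : ∀ x, q x * (1 - q x / fiberWeight q φ x) ≤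
      q x * ∑' x', ({x}ᶜ : Set α).indicator (k x) x' := by
    intro x
    by_cases h0 : q x = 0
    · simp [h0]
    gcongr
    rw [tsub_le_iff_left, ← hself]
    have hx : fiberWeight q φ x ≠ 0 := fun h => h0 (le_zero_iff.1 (h ▸ le_fiberWeight q φ x))
    rw [← ENNReal.div_self hx (hfin x), ← hksum, ← hsingle x, ← ENNReal.tsum_add]
    simp_rw [Set.indicator_self_add_compl_apply]
    exact le_rfl
  calc ∑' x, q x * (1 - q x / fiberWeight q φ x)
      ≤ ∑' x, ∑' x', q x * ({x}ᶜ : Set α).indicator (k x) x' := by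
        simp_rw [ENNReal.tsum_mul_left]
        exact ENNReal.tsum_le_tsum h1
    _ ≤ ∑' x, ∑' x', (Tᶜ.indicator q x * k x x' + Tᶜ.indicator q x' * k x' x
          + q x * b x * k x x') := by
        refine ENNReal.tsum_le_tsum fun x => ENNReal.tsum_le_tsum fun x' => ?_
        -- One summand for each source of error: the truth lies outside `T`, the sample lies outside
        -- `T` (equally likely, by reversibility), or both lie in `T` and collide, where `b x ≥ 1`.
        by_cases hx : x ∈ T
        swap
        · rw [Set.indicator_of_mem (s := Tᶜ) (show x ∈ Tᶜ from hx), add_assoc]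
          exact le_add_right (mul_le_mul' le_rfl (Set.indicator_le_self _ _ _))
        by_cases hx' : x' ∈ T
        swap
        · rw [Set.indicator_of_mem (s := Tᶜ) (a := x') hx', add_right_comm, ← hsym]
          exact le_add_left (mul_le_mul' le_rfl (Set.indicator_le_self _ _ _))
        refine le_add_left ?_
        by_cases hne : x' = x
        · simp [hne]
        by_cases hφ : φ x' = φ x
        · rw [mul_assoc, Set.indicator_of_mem (show x' ∈ ({x}ᶜ : Set α) from hne)]
          gcongr
          exact le_mul_of_one_le_left (zero_le) (hb x hx ⟨x', hx', hne, hφ⟩)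
        · have : k x x' = 0 := if_neg hφ
          rw [Set.indicator_of_mem (show x' ∈ ({x}ᶜ : Set α) from hne), this, mul_zero]
          exact zero_le
    _ ≤ _ := by
        simp_rw [ENNReal.tsum_add, two_mul]
        have hT : ∑' x, ∑' x', Tᶜ.indicator q x * k x x' ≤ ∑' x, Tᶜ.indicator q x := by
          refine ENNReal.tsum_le_tsum fun x => ?_
          rw [ENNReal.tsum_mul_left]
          exact mul_le_of_le_one_right (zero_le) (hk1 x)
        refine add_le_add (add_le_add hT ?_) ?_
        · rw [ENNReal.tsum_comm]
          exact hT
        · refine ENNReal.tsum_le_tsum fun x => ?_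
          rw [ENNReal.tsum_mul_left]
          exact mul_le_of_le_one_right (zero_le) (hk1 x)

end Fibers

/-! ### Second-moment estimate of the deficit. -/

section Uniformity

variable {α Γ : Type*}

/-- The difference of the two sides is `(N t - 1 - 2 η) ^ 2 / N` when `t ≥ N⁻¹` and `((N t - 1) ^ 2
+ 4 η ^ 2) / N` otherwise. The free parameter `η` replaces the Cauchy–Schwarz inequality and its
square root, and the term `2 t` stands on the left because `ℝ≥0∞` has no negative terms. -/
theorem excess_le_square (η t N : ℝ≥0∞) (hη : η ≠ ∞) (ht : t ≠ ∞) (hN : N ≠ ∞) (hN0 : N ≠ 0) :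
    4 * η * (t - N⁻¹) + 2 * t ≤ 4 * η ^ 2 * N⁻¹ + N * (t * t) + N⁻¹ := by
  lift η to ℝ≥0 using hη
  lift t to ℝ≥0 using ht
  lift N to ℝ≥0 using hN
  have hN0' : N ≠ 0 := by simpa using hN0
  have hNpos : (0 : ℝ) < N := by positivity
  rw [← ENNReal.coe_inv hN0', ← ENNReal.coe_sub]
  norm_cast
  rw [← NNReal.coe_le_coe]
  have key : ∀ x : ℝ, x = 0 ∨ x = (t : ℝ) - (N : ℝ)⁻¹ →
      4 * (η : ℝ) * x + 2 * t ≤ 4 * (η : ℝ) ^ 2 * (N : ℝ)⁻¹ + N * (t * t) + (N : ℝ)⁻¹ := by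
    rintro x (rfl | rfl)
    · have h : 4 * (η : ℝ) ^ 2 * (N : ℝ)⁻¹ + N * (t * t) + (N : ℝ)⁻¹ - 2 * t =
          ((N * t - 1) ^ 2 + 4 * (η : ℝ) ^ 2) / N := by
        field_simp; ring
      have : 0 ≤ ((N * t - 1) ^ 2 + 4 * (η : ℝ) ^ 2) / N := by positivity
      linarith
    · have h : 4 * (η : ℝ) ^ 2 * (N : ℝ)⁻¹ + N * (t * t) + (N : ℝ)⁻¹ - 2 * t
          - 4 * (η : ℝ) * (t - (N : ℝ)⁻¹) = (N * t - 1 - 2 * η) ^ 2 / N := by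
        field_simp; ring
      have : 0 ≤ (N * t - 1 - 2 * η : ℝ) ^ 2 / N := by positivity
      linarith
  push_cast
  refine key _ ?_
  rcases le_total t N⁻¹ with h | h
  · left; rw [tsub_eq_zero_of_le h]; rfl
  · right; rw [NNReal.coe_sub h]; simp

theorem mul_one_sub_min_div_le {s u : ℝ≥0∞} (hs : s ≠ ∞) : s * (1 - min 1 (u / s)) ≤ s - u := by
  by_cases h0 : s = 0
  · simp [h0]
  rw [ENNReal.mul_sub fun _ _ => hs, mul_one, mul_min, mul_one, ENNReal.mul_div_cancel h0 hs]
  rcases le_total s u with h | h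
  · simp [h]
  · simp [h]

/-- A random element of weights `q` is nearly a random element of uniform value of `φ` if few pairs
of elements of `T` have the same value. -/
theorem tsum_deficit_le [Fintype Γ] [Nonempty Γ] (q : α → ℝ≥0∞) (hq : ∑' x, q x = 1) (φ : α → Γ)
    (T : Set α) (η : ℝ≥0∞) (hη : η ≠ ∞) :
    4 * η * ∑' x, q x * (1 - min 1 ((Fintype.card Γ : ℝ≥0∞)⁻¹ / fiberWeight q φ x)) + 2 ≤
      4 * η ^ 2 + 1 +
        (Fintype.card Γ : ℝ≥0∞) * ∑' x, T.indicator q x * ∑' x', {x' | φ x' = φ x}.indicator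
          (T.indicator q) x' + (2 + 4 * η) * ∑' x, Tᶜ.indicator q x := by
  classical
  set N : ℝ≥0∞ := (Fintype.card Γ : ℝ≥0∞) with hN
  have hNtop : N ≠ ∞ := ENNReal.natCast_ne_top _
  have hN0 : N ≠ 0 := by simp [hN]
  have hsumu : ∑ _a : Γ, N⁻¹ = 1 := by
    rw [Finset.sum_const, Finset.card_univ, nsmul_eq_mul, ENNReal.mul_inv_cancel hN0 hNtop]
  -- The weight `s a` of a fiber is split into its part `t a` in `T`, to which the second moment
  -- applies, and its part `v a` outside `T`, which enters only linearly.
  set s : Γ → ℝ≥0∞ := fun a => ∑' x, (φ ⁻¹' {a}).indicator q x with hs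
  set t : Γ → ℝ≥0∞ := fun a => ∑' x, (φ ⁻¹' {a}).indicator (T.indicator q) x with ht
  set v : Γ → ℝ≥0∞ := fun a => ∑' x, (φ ⁻¹' {a}).indicator (Tᶜ.indicator q) x with hv
  have hstv : ∀ a, s a = t a + v a := by
    intro a
    simp only [hs, ht, hv]
    rw [← ENNReal.tsum_add]
    refine tsum_congr fun x => ?_
    by_cases hx : x ∈ φ ⁻¹' {a}
    · simp only [Set.indicator_of_mem hx, Set.indicator_self_add_compl_apply]
    · simp only [Set.indicator_of_notMem hx, add_zero]
  have hs1 : ∀ a, s a ≤ 1 := fun a =>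
    (ENNReal.tsum_le_tsum fun x => Set.indicator_le_self _ _ _).trans_eq hq
  have ht1 : ∀ a, t a ≠ ∞ := fun a =>
    ((le_self_add.trans_eq (hstv a).symm).trans (hs1 a)).trans_lt ENNReal.one_lt_top |>.ne
  have hfib : ∀ F : α → ℝ≥0∞, ∑ a, ∑' x, (φ ⁻¹' {a}).indicator F x = ∑' x, F x := fun F => by
    rw [← tsum_fiberwise φ F, tsum_fintype]
  have hsum : ∑ a, t a + ∑ a, v a = 1 := by
    rw [← Finset.sum_add_distrib, ← hq, ← hfib q]
    exact Finset.sum_congr rfl fun a _ => (hstv a).symm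
  have hvsum : ∑ a, v a = ∑' x, Tᶜ.indicator q x := hfib _
  have hA : ∑' x, q x * (1 - min 1 (N⁻¹ / fiberWeight q φ x)) ≤ ∑ a, (t a - N⁻¹) + ∑ a, v a := by
    rw [← hfib, ← Finset.sum_add_distrib]
    refine Finset.sum_le_sum fun a _ => ?_
    calc ∑' x, (φ ⁻¹' {a}).indicator
          (fun x => q x * (1 - min 1 (N⁻¹ / fiberWeight q φ x))) x
        = s a * (1 - min 1 (N⁻¹ / s a)) := by
          rw [← ENNReal.tsum_mul_right]
          refine tsum_congr fun x => ?_
          by_cases hx : φ x = a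
          · rw [Set.indicator_of_mem (show x ∈ φ ⁻¹' {a} from hx),
              Set.indicator_of_mem (show x ∈ φ ⁻¹' {a} from hx), ← hx]
            rfl
          · rw [Set.indicator_of_notMem (show x ∉ φ ⁻¹' {a} from hx),
              Set.indicator_of_notMem (show x ∉ φ ⁻¹' {a} from hx), zero_mul]
      _ ≤ s a - N⁻¹ := mul_one_sub_min_div_le ((hs1 a).trans_lt ENNReal.one_lt_top).ne
      _ ≤ (t a - N⁻¹) + v a := by
          rw [hstv, tsub_le_iff_left, ← add_assoc]
          gcongr
          exact le_add_tsub
  have hsq : ∑ a, t a * t a = ∑' x, T.indicator q x * ∑' x', {x' | φ x' = φ x}.indicator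
      (T.indicator q) x' := by
    rw [← hfib]
    refine Finset.sum_congr rfl fun a _ => ?_
    simp only [ht]
    rw [← ENNReal.tsum_mul_right]
    refine tsum_congr fun x => ?_
    by_cases hx : φ x = a
    · rw [Set.indicator_of_mem (show x ∈ φ ⁻¹' {a} from hx),
        Set.indicator_of_mem (show x ∈ φ ⁻¹' {a} from hx), ← hx]
      rfl
    · rw [Set.indicator_of_notMem (show x ∉ φ ⁻¹' {a} from hx),
        Set.indicator_of_notMem (show x ∉ φ ⁻¹' {a} from hx), zero_mul]
  -- The summand `2` equals `2 * (∑ t + ∑ v)`. Its `t` part completes the square for each value `a`;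
  -- its `v` part explains the `2` in the factor `2 + 4 * η`.
  calc 4 * η * ∑' x, q x * (1 - min 1 (N⁻¹ / fiberWeight q φ x)) + 2
      ≤ 4 * η * (∑ a, (t a - N⁻¹) + ∑ a, v a) + 2 * (∑ a, t a + ∑ a, v a) := by
        rw [hsum, mul_one]
        gcongr
    _ = ∑ a, (4 * η * (t a - N⁻¹) + 2 * t a) + (2 + 4 * η) * ∑ a, v a := by
        rw [Finset.sum_add_distrib, ← Finset.mul_sum, ← Finset.mul_sum]
        ring
    _ ≤ ∑ a, (4 * η ^ 2 * N⁻¹ + N * (t a * t a) + N⁻¹) + (2 + 4 * η) * ∑ a, v a := by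
        exact add_le_add (Finset.sum_le_sum fun a _ =>
          excess_le_square _ _ _ hη (ht1 a) hNtop hN0) le_rfl
    _ = _ := by
        rw [Finset.sum_add_distrib, Finset.sum_add_distrib, ← Finset.mul_sum, ← Finset.mul_sum,
          hsumu, hsq, hvsum]
        ring

end Uniformity

/-! ### Conditional weights of a discrete source -/

section CondWeight

variable {S : Type*} [Fintype S] [DecidableEq S] {Z : S → Type*} [∀ s, MeasurableSpace (Z s)]
  [∀ s, Countable (Z s)] [∀ s, MeasurableSingletonClass (Z s)]

theorem measure_eq_tsum_indicator {α : Type*} [MeasurableSpace α] [Countable α]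
    [MeasurableSingletonClass α] (μ : Measure α) (B : Set α) :
    μ B = ∑' z, B.indicator (fun z => μ {z}) z :=
  (Measure.tsum_indicator_apply_singleton μ B (Set.to_countable B).measurableSet).symm

theorem tsum_measure_singleton {α : Type*} [MeasurableSpace α] [Countable α]
    [MeasurableSingletonClass α] (μ : Measure α) [IsProbabilityMeasure μ] :
    ∑' z, μ {z} = 1 := by
  rw [← measure_univ (μ := μ), measure_eq_tsum_indicator μ Set.univ]
  simp

theorem tsum_indicator_condWeight (μ : Measure (∀ s, Z s)) (T T' : Finset S)
    (z' : ∀ s : T', Z s) (B : Set (∀ s : T, Z s)) :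
    ∑' w, B.indicator (condWeight μ T T' z') w =
      μ {z | T.restrict z ∈ B ∧ T'.restrict z = z'} / μ {z | T'.restrict z = z'} := by
  classical
  rw [measure_eq_tsum_indicator μ {z | T.restrict z ∈ B ∧ T'.restrict z = z'},
    ← tsum_fiberwise (T.restrict (π := Z)), ENNReal.div_eq_inv_mul, ← ENNReal.tsum_mul_left]
  refine tsum_congr fun w => ?_
  by_cases hw : w ∈ B
  · rw [Set.indicator_of_mem hw, condWeight, ENNReal.div_eq_inv_mul]
    congr 1
    rw [measure_eq_tsum_indicator]
    refine tsum_congr fun z => ?_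
    simp only [Set.indicator_apply, Set.mem_ofPred_eq, Set.mem_preimage, Set.mem_singleton_iff]
    by_cases h : T.restrict z = w
    · simp [h, hw]
    · simp [h]
  · rw [Set.indicator_of_notMem hw, ENNReal.tsum_eq_zero.2, mul_zero]
    intro z
    by_cases h : T.restrict z = w
    · rw [Set.indicator_of_mem (show z ∈ T.restrict ⁻¹' {w} from h), Set.indicator_of_notMem]
      rintro ⟨h1, -⟩
      exact hw (h ▸ h1)
    · exact Set.indicator_of_notMem (show z ∉ T.restrict ⁻¹' {w} from h) _

theorem tsum_condWeight (μ : Measure (∀ s, Z s)) (T T' : Finset S) (z' : ∀ s : T', Z s) :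
    ∑' w, condWeight μ T T' z' w = μ {z | T'.restrict z = z'} / μ {z | T'.restrict z = z'} := by
  simpa using tsum_indicator_condWeight μ T T' z' Set.univ

theorem tsum_condWeight_le_one (μ : Measure (∀ s, Z s)) (T T' : Finset S) (z' : ∀ s : T', Z s) :
    ∑' w, condWeight μ T T' z' w ≤ 1 :=
  (tsum_condWeight μ T T' z').trans_le ENNReal.div_self_le_one

theorem measure_restrict_eq_ne_zero (μ : Measure (∀ s, Z s)) (T : Finset S) {z : ∀ s, Z s}
    (hz : μ {z} ≠ 0) : μ {x | T.restrict x = T.restrict z} ≠ 0 := fun h =>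
  hz (measure_mono_null (fun x (hx : x = z) => by simp [hx]) h)

theorem tsum_condWeight_eq_one (μ : Measure (∀ s, Z s)) [IsProbabilityMeasure μ] (T T' : Finset S)
    {z : ∀ s, Z s} (hz : μ {z} ≠ 0) : ∑' w, condWeight μ T T' (T'.restrict z) w = 1 := by
  rw [tsum_condWeight]
  exact ENNReal.div_self (measure_restrict_eq_ne_zero μ T' hz) (measure_ne_top _ _)

/-- Once the vectors are grouped by their values on `T'`, this is the product rule for conditional
weights. It averages estimates made at a fixed conditioning value over the source. -/
theorem tsum_condWeight_disintegrate (μ : Measure (∀ s, Z s)) [IsProbabilityMeasure μ]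
    (T T' : Finset S) (φ : (∀ s : T', Z s) → (∀ s : T, Z s) → ℝ≥0∞) :
    ∑' z, μ {z} * ∑' w, condWeight μ T T' (T'.restrict z) w * φ (T'.restrict z) w =
      ∑' z, μ {z} * φ (T'.restrict z) (T.restrict z) := by
  classical
  rw [← tsum_fiberwise (T'.restrict (π := Z)),
    ← tsum_fiberwise (T'.restrict (π := Z)) fun z => μ {z} * φ (T'.restrict z) (T.restrict z)]
  refine tsum_congr fun a => ?_
  rw [← tsum_fiberwise (T.restrict (π := Z)) ((T'.restrict ⁻¹' {a}).indicator
    fun z => μ {z} * φ (T'.restrict z) (T.restrict z))]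
  have h1 : ∀ z : ∀ s, Z s, (T'.restrict ⁻¹' {a}).indicator (fun z => μ {z} *
      ∑' w, condWeight μ T T' (T'.restrict z) w * φ (T'.restrict z) w) z =
      {z | T'.restrict z = a}.indicator (fun z => μ {z}) z *
        ∑' w, condWeight μ T T' a w * φ a w := by
    intro z
    by_cases h : T'.restrict z = a
    · rw [Set.indicator_of_mem (show z ∈ T'.restrict ⁻¹' {a} from h),
        Set.indicator_of_mem (show z ∈ {z | T'.restrict z = a} from h), h]
    · rw [Set.indicator_of_notMem (show z ∉ T'.restrict ⁻¹' {a} from h),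
        Set.indicator_of_notMem (show z ∉ {z | T'.restrict z = a} from h), zero_mul]
  simp_rw [h1]
  rw [ENNReal.tsum_mul_right, ← measure_eq_tsum_indicator, ← ENNReal.tsum_mul_left]
  refine tsum_congr fun w => ?_
  have h2 : ∀ z : ∀ s, Z s, (T.restrict ⁻¹' {w}).indicator ((T'.restrict ⁻¹' {a}).indicator
      fun z => μ {z} * φ (T'.restrict z) (T.restrict z)) z =
      {z | T.restrict z = w ∧ T'.restrict z = a}.indicator (fun z => μ {z}) z * φ a w := by
    intro z
    simp only [Set.indicator_apply, Set.mem_ofPred_eq, Set.mem_preimage, Set.mem_singleton_iff]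
    by_cases h : T.restrict z = w <;> by_cases h' : T'.restrict z = a <;> simp [h, h']
  simp_rw [h2]
  rw [ENNReal.tsum_mul_right, ← measure_eq_tsum_indicator, ← mul_assoc, condWeight]
  congr 1
  -- For a conditioning value of probability `0` the joint weight vanishes as well, so the
  -- convention for `0 / 0` does no harm.
  by_cases h0 : μ {z | T'.restrict z = a} = 0
  · rw [h0, zero_mul]
    exact (measure_mono_null (fun z hz => hz.2) h0).symm
  · exact ENNReal.mul_div_cancel h0 (measure_ne_top _ _)

end CondWeight

/-! ### The encoders -/

section Encoder

theorem indicator_div_tsum_le_constrainedGenerator {α : Type*} (w : α → ℝ≥0∞) (E : Set α) (x : α)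
    (hw : tsum (E.indicator w) ≠ ∞) :
    E.indicator w x / tsum (E.indicator w) ≤ constrainedGenerator w E (some x) := by
  classical
  unfold constrainedGenerator
  by_cases h0 : tsum (E.indicator w) = 0
  · rw [ENNReal.tsum_eq_zero.1 h0 x, ENNReal.zero_div]
    exact zero_le
  · rw [dif_pos ⟨h0, hw⟩, PMF.map_apply]
    refine le_trans ?_ (ENNReal.le_tsum x)
    simp [PMF.normalize_apply, div_eq_mul_inv]

variable {S I J : Type*} [Fintype S] [Fintype I] [DecidableEq S] [DecidableEq I]
  {Z C M : S → Type*}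

/-- The values of the functions `f_s` and `g_s` on `T`. -/
def hashPair (T : Finset S) (f : ∀ s, Z s → C s) (g : ∀ s, Z s → M s) (w : ∀ s : T, Z s) :
    ∀ s : T, C s × M s :=
  fun s => (f s (w s), g s (w s))

variable [∀ s, Fintype (C s)] [∀ s, Fintype (M s)] [∀ s, Nonempty (C s)] [∀ s, Nonempty (M s)]

theorem card_hashPair_inv (T : Finset S) :
    (Fintype.card (∀ s : T, C s × M s) : ℝ≥0∞)⁻¹ =
      ∏ s ∈ T, (Fintype.card (C s) : ℝ≥0∞)⁻¹ * (Fintype.card (M s) : ℝ≥0∞)⁻¹ := by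
  rw [Fintype.card_pi, Nat.cast_prod, ENNReal.prod_inv_distrib, ← Finset.prod_coe_sort T]
  · refine Finset.prod_congr rfl fun s _ => ?_
    rw [Fintype.card_prod, Nat.cast_mul, ENNReal.mul_inv] <;> simp
  · intro s _ t _ _
    simp

variable [∀ s, MeasurableSpace (Z s)]

/-- The density, truncated at `1`, of the vector generated in the step of `I'` with respect to the
source, if the values of the functions `f_s` and `g_s` are prescribed at random. -/
def stepDensity (A : Finset (S × I)) (μ : Measure (∀ s, Z s)) (f : ∀ s, Z s → C s)
    (g : ∀ s, Z s → M s) (I' : Finset I) (z : ∀ s, Z s) : ℝ≥0∞ :=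
  min 1 ((Fintype.card (∀ s : privateMessages A I', C s × M s) : ℝ≥0∞)⁻¹ /
    fiberWeight (condWeight μ (privateMessages A I') (publicMessages A I')
      ((publicMessages A I').restrict z)) (hashPair (privateMessages A I') f g)
      ((privateMessages A I').restrict z))

variable [∀ s, Countable (Z s)] [∀ s, MeasurableSingletonClass (Z s)]

/-- With the values prescribed by `z` itself, the constraint set of the generator is exactly the
fiber of `hashPair` through `z`. -/
theorem condWeight_div_fiberWeight_le_encoderGenerator (A : Finset (S × I))
    (μ : Measure (∀ s, Z s)) (f : ∀ s, Z s → C s) (g : ∀ s, Z s → M s) (I' : Finset I)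
    (z : ∀ s, Z s) :
    condWeight μ (privateMessages A I') (publicMessages A I') ((publicMessages A I').restrict z)
        ((privateMessages A I').restrict z) /
      fiberWeight (condWeight μ (privateMessages A I') (publicMessages A I')
        ((publicMessages A I').restrict z)) (hashPair (privateMessages A I') f g)
        ((privateMessages A I').restrict z) ≤
    encoderGenerator A μ f g I' ((publicMessages A I').restrict z)
      ((privateMessages A I').restrict fun s => f s (z s))
      ((privateMessages A I').restrict fun s => g s (z s))
      (some ((privateMessages A I').restrict z)) := by
  have hE : fiber (privateMessages A I') f ((privateMessages A I').restrict fun s => f s (z s)) ∩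
      fiber (privateMessages A I') g ((privateMessages A I').restrict fun s => g s (z s)) =
      {w | hashPair (privateMessages A I') f g w =
        hashPair (privateMessages A I') f g ((privateMessages A I').restrict z)} := by
    ext w
    simp only [fiber, hashPair, Set.mem_inter_iff, Set.mem_ofPred_eq, funext_iff, Prod.mk.injEq,
      Finset.restrict, forall_and]
  unfold encoderGenerator
  refine le_trans ?_ (indicator_div_tsum_le_constrainedGenerator _ _ _ ?_)
  · rw [Set.indicator_of_mem, hE]
    · exact le_rfl
    · rw [hE]
      rfl
  · exact ((ENNReal.tsum_le_tsum fun w => Set.indicator_le_self _ _ _).trans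
      (tsum_condWeight_le_one μ _ _ _)).trans_lt ENNReal.one_lt_top |>.ne

theorem mem_privateMessages {A : Finset (S × I)} {I' : Finset I} {s : S} :
    s ∈ privateMessages A I' ↔ encodersOf A s = I' := by
  simp [privateMessages]

theorem mem_publicMessages {A : Finset (S × I)} {I' : Finset I} {s : S} :
    s ∈ publicMessages A I' ↔ I' ⊂ encodersOf A s := by
  simp only [publicMessages, Finset.mem_biUnion, Finset.mem_filter, mem_privateMessages]
  constructor
  · rintro ⟨a, ⟨-, h⟩, rfl⟩
    exact h
  · intro h
    refine ⟨_, ⟨?_, h⟩, rfl⟩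
    simp only [accessFamily, Finset.mem_filter, Finset.mem_univ, true_and]
    exact ⟨s, mem_privateMessages.2 rfl⟩

theorem encodersOf_mem_accessFamily (A : Finset (S × I)) (s : S) :
    encodersOf A s ∈ accessFamily A := by
  simp only [accessFamily, Finset.mem_filter, Finset.mem_univ, true_and]
  exact ⟨s, mem_privateMessages.2 rfl⟩

/-- Only the run in which every step produces the matching part of `z` is kept. The order of `L`
ensures that the public part of each step was written earlier, so the running vector already agrees
with `z` there; hence the invariant that `x` and `z` agree at all messages whose step is no longer
in `L`. -/
theorem prod_encoderGenerator_le_encoderRun (A : Finset (S × I)) (μ : Measure (∀ s, Z s))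
    (f : ∀ s, Z s → C s) (g : ∀ s, Z s → M s) (c : ∀ s, C s) (m : ∀ s, M s) (z : ∀ s, Z s)
    (L : List (Finset I)) (hnd : L.Nodup) (hL : L.Pairwise fun I₁ I₂ => ¬ I₁ ⊂ I₂)
    (x : ∀ s, Z s) (hx : ∀ s, encodersOf A s ∉ L → x s = z s) :
    (L.map fun I' => encoderGenerator A μ f g I' ((publicMessages A I').restrict z)
        ((privateMessages A I').restrict c) ((privateMessages A I').restrict m)
        (some ((privateMessages A I').restrict z))).prod ≤
      encoderRun A μ f g c m L x (some z) := by
  induction L generalizing x with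
  | nil =>
    have : x = z := funext fun s => hx s (by simp)
    simp [encoderRun, this]
  | cons I' L ih =>
    rw [List.map_cons, List.prod_cons, encoderRun, PMF.bind_apply]
    refine le_trans ?_ (ENNReal.le_tsum (some ((privateMessages A I').restrict z)))
    rw [List.nodup_cons] at hnd
    rw [List.pairwise_cons] at hL
    have hpub : (publicMessages A I').restrict x = (publicMessages A I').restrict z := by
      funext ⟨s, hs⟩
      refine hx s fun hmem => ?_
      have hs' := mem_publicMessages.1 hs
      rcases List.mem_cons.1 hmem with h | h
      · exact (h ▸ hs').ne rfl
      · exact hL.1 _ h hs'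
    rw [hpub]
    refine mul_le_mul' le_rfl (ih hnd.2 hL.2 _ fun s hs => ?_)
    by_cases h : s ∈ privateMessages A I'
    · simp [overwrite, h]
    · simp only [overwrite, h, dite_false]
      refine hx s fun hmem => ?_
      rcases List.mem_cons.1 hmem with h' | h'
      · exact h (mem_privateMessages.2 h')
      · exact hs h'

/-- The joint probability of the source vector and of its values of `f_s` and `g_s` in the code is
bounded from below by the probability in the source. -/
theorem measure_mul_prod_stepDensity_le (A : Finset (S × I)) (L : List (Finset I))
    (hL : IsReverseLinearExtension A L) (μ : Measure (∀ s, Z s)) (hμ : IsConsistent A μ)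
    (f : ∀ s, Z s → C s) (g : ∀ s, Z s → M s) (x z : ∀ s, Z s) :
    μ {z} * ∏ I' ∈ accessFamily A, stepDensity A μ f g I' z ≤
      (∏ s, (Fintype.card (C s) : ℝ≥0∞)⁻¹) * ((∏ s, (Fintype.card (M s) : ℝ≥0∞)⁻¹) *
        encoderRun A μ f g (fun s => f s (z s)) (fun s => g s (z s)) L x (some z)) := by
  -- The sets `S(I')` partition the messages, so the uniform weights of the steps multiply to the
  -- uniform weight of all prescribed values.
  have hprod : ∏ I' ∈ accessFamily A,
        (Fintype.card (∀ s : privateMessages A I', C s × M s) : ℝ≥0∞)⁻¹ =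
      (∏ s, (Fintype.card (C s) : ℝ≥0∞)⁻¹) * ∏ s, (Fintype.card (M s) : ℝ≥0∞)⁻¹ := by
    rw [← Finset.prod_mul_distrib, ← Finset.prod_fiberwise_of_maps_to
      (fun s _ => encodersOf_mem_accessFamily A s)]
    refine Finset.prod_congr rfl fun I' _ => ?_
    rw [card_hashPair_inv]
    rfl
  have hset : L.toFinset = accessFamily A := by
    ext I'
    rw [List.mem_toFinset, hL.2.1]
  rw [← mul_assoc, ← hprod, hμ z, ← Finset.prod_mul_distrib]
  refine le_trans ?_ (mul_le_mul' le_rfl (prod_encoderGenerator_le_encoderRun A μ f g _ _ z L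
    hL.1 hL.2.2 x fun s hs => absurd ((hL.2.1 _).2 (encodersOf_mem_accessFamily A s)) hs))
  rw [← List.prod_toFinset _ hL.1, hset, ← Finset.prod_mul_distrib]
  refine Finset.prod_le_prod' fun I' _ => ?_
  refine le_trans ?_ (mul_le_mul' le_rfl
    (condWeight_div_fiberWeight_le_encoderGenerator A μ f g I' z))
  rw [stepDensity]
  refine (mul_le_mul' le_rfl (min_le_right _ _)).trans_eq ?_
  simp only [div_eq_mul_inv]
  ring

/-- This is the change from the code to the ideal experiment: replacing a law by a minorant costs at
most the missing mass for every event. -/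
theorem tsum_mul_le_of_le {α : Type*} (P P' E : α → ℝ≥0∞) (hP : ∑' x, P x = 1)
    (hP' : ∀ x, P' x ≤ P x) (hE : ∀ x, E x ≤ 1) :
    ∑' x, P x * E x ≤ ∑' x, P' x * E x + (1 - ∑' x, P' x) := by
  have hfin : ∑' x, P' x ≠ ∞ := by
    refine ((ENNReal.tsum_le_tsum hP').trans_eq hP).trans_lt ENNReal.one_lt_top |>.ne
  have hsub : ∑' x, (P x - P' x) ≤ 1 - ∑' x, P' x := by
    refine ENNReal.le_sub_of_add_le_left hfin ?_
    rw [← ENNReal.tsum_add, ← hP]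
    exact ENNReal.tsum_le_tsum fun x => (add_tsub_cancel_of_le (hP' x)).le
  refine le_trans ?_ (add_le_add le_rfl hsub)
  rw [← ENNReal.tsum_add]
  refine ENNReal.tsum_le_tsum fun x => ?_
  calc P x * E x = (P' x + (P x - P' x)) * E x := by rw [add_tsub_cancel_of_le (hP' x)]
    _ = P' x * E x + (P x - P' x) * E x := add_mul _ _ _
    _ ≤ _ := by
      gcongr
      exact mul_le_of_le_one_right zero_le (hE x)

theorem one_sub_prod_le {ι : Type*} (s : Finset ι) (ρ : ι → ℝ≥0∞) (hρ : ∀ i, ρ i ≤ 1) :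
    1 - ∏ i ∈ s, ρ i ≤ ∑ i ∈ s, (1 - ρ i) := by
  classical
  induction s using Finset.induction_on with
  | empty => simp
  | insert i s hi ih =>
    rw [Finset.prod_insert hi, Finset.sum_insert hi, tsub_le_iff_right]
    rw [tsub_le_iff_right] at ih
    calc (1 : ℝ≥0∞) = 1 - ρ i + ρ i := (tsub_add_cancel_of_le (hρ i)).symm
      _ ≤ 1 - ρ i + ρ i * (∑ i ∈ s, (1 - ρ i) + ∏ i ∈ s, ρ i) := by
        gcongr
        exact le_mul_of_one_le_right zero_le ih
      _ ≤ 1 - ρ i + (∑ i ∈ s, (1 - ρ i) + ρ i * ∏ i ∈ s, ρ i) := by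
        rw [mul_add]
        gcongr
        exact mul_le_of_le_one_left zero_le (hρ i)
      _ = _ := (add_assoc _ _ _).symm

theorem card_pi_mul_prod_card_inv {X : S → Type*} [∀ s, Fintype (X s)] [∀ s, Nonempty (X s)] :
    (Fintype.card (∀ s, X s) : ℝ≥0∞) * ∏ s, (Fintype.card (X s) : ℝ≥0∞)⁻¹ = 1 := by
  rw [Fintype.card_pi, Nat.cast_prod, ← Finset.prod_mul_distrib]
  exact Finset.prod_eq_one fun s _ =>
    ENNReal.mul_inv_cancel (by simp) (ENNReal.natCast_ne_top _)

/-- The average over random prescribed values of the probability of an error event of the code is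
bounded by its probability for the source and the deficits of the encoding steps. -/
theorem sum_encoderRun_mul_le (A : Finset (S × I)) (L : List (Finset I))
    (hL : IsReverseLinearExtension A L) (μ : Measure (∀ s, Z s)) [IsProbabilityMeasure μ]
    (hμ : IsConsistent A μ) (f : ∀ s, Z s → C s) (g : ∀ s, Z s → M s) (x : ∀ s, Z s)
    (E : (∀ s, C s) → (∀ s, M s) → Option (∀ s, Z s) → ℝ≥0∞) (hE : ∀ c m o, E c m o ≤ 1) :
    ∑ c : ∀ s, C s, (∏ s, (Fintype.card (C s) : ℝ≥0∞)⁻¹) *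
        ∑ m : ∀ s, M s, (∏ s, (Fintype.card (M s) : ℝ≥0∞)⁻¹) *
          ∑' o, encoderRun A μ f g c m L x o * E c m o ≤
      ∑' z, μ {z} * E (fun s => f s (z s)) (fun s => g s (z s)) (some z) +
        ∑ I' ∈ accessFamily A, ∑' z, μ {z} * (1 - stepDensity A μ f g I' z) := by
  classical
  set u : ℝ≥0∞ := ∏ s, (Fintype.card (C s) : ℝ≥0∞)⁻¹ with hu
  set v : ℝ≥0∞ := ∏ s, (Fintype.card (M s) : ℝ≥0∞)⁻¹ with hv
  set ρ : (∀ s, Z s) → ℝ≥0∞ := fun z => ∏ I' ∈ accessFamily A, stepDensity A μ f g I' z with hρ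
  let P : (∀ s, C s) × (∀ s, M s) × Option (∀ s, Z s) → ℝ≥0∞ := fun t =>
    u * (v * encoderRun A μ f g t.1 t.2.1 L x t.2.2)
  let emb : (∀ s, Z s) → (∀ s, C s) × (∀ s, M s) × Option (∀ s, Z s) := fun z =>
    (fun s => f s (z s), fun s => g s (z s), some z)
  have hemb : Function.Injective emb := fun z z' h => by
    simpa [emb] using congrArg (fun t => t.2.2) h
  -- The minorant lives on the graph of `z ↦ (f(z), g(z), z)`; runs that end with an encoder error
  -- belong to the missing mass.
  let P' : (∀ s, C s) × (∀ s, M s) × Option (∀ s, Z s) → ℝ≥0∞ :=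
    Function.extend emb (fun z => μ {z} * ρ z) 0
  have hP : ∑' t, P t = 1 := by
    simp only [P]
    rw [ENNReal.tsum_prod']
    simp_rw [ENNReal.tsum_prod', ENNReal.tsum_mul_left, PMF.tsum_coe]
    simp only [tsum_fintype, Finset.sum_const, Finset.card_univ, nsmul_eq_mul, mul_one]
    calc _ = ((Fintype.card (∀ s, C s) : ℝ≥0∞) * u) * ((Fintype.card (∀ s, M s) : ℝ≥0∞) * v) := by
          ring
      _ = 1 := by rw [hu, hv, card_pi_mul_prod_card_inv, card_pi_mul_prod_card_inv, one_mul]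
  have hP' : ∀ t, P' t ≤ P t := by
    intro t
    by_cases ht : ∃ z, emb z = t
    · obtain ⟨z, rfl⟩ := ht
      simp only [P', hemb.extend_apply]
      exact measure_mul_prod_stepDensity_le A L hL μ hμ f g x z
    · simp only [P', Function.extend_apply' _ _ _ ht]
      exact zero_le
  have hsum : ∀ F : (∀ s, C s) × (∀ s, M s) × Option (∀ s, Z s) → ℝ≥0∞,
      ∑' t, P' t * F t = ∑' z, μ {z} * ρ z * F (emb z) := by
    intro F
    rw [← hemb.tsum_eq]
    · exact tsum_congr fun z => by simp only [P', hemb.extend_apply]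
    · intro t ht
      by_contra h
      exact ht (by simp only [P', Function.extend_apply' _ _ _ h, Pi.zero_apply, zero_mul])
  have hρ1 : ∀ z, ρ z ≤ 1 := fun z => Finset.prod_le_one' fun I' _ => min_le_left _ _
  calc _ = ∑' t, P t * E t.1 t.2.1 t.2.2 := by
        simp only [P]
        rw [ENNReal.tsum_prod', tsum_fintype]
        simp_rw [ENNReal.tsum_prod', tsum_fintype, mul_assoc, ENNReal.tsum_mul_left]
        refine Finset.sum_congr rfl fun c _ => ?_
        rw [Finset.mul_sum]
    _ ≤ ∑' t, P' t * E t.1 t.2.1 t.2.2 + (1 - ∑' t, P' t) :=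
        tsum_mul_le_of_le P P' _ hP hP' fun t => hE _ _ _
    _ ≤ ∑' z, μ {z} * E (fun s => f s (z s)) (fun s => g s (z s)) (some z) +
          ∑' z, μ {z} * (1 - ρ z) := by
        rw [hsum]
        gcongr with z
        · exact mul_le_of_le_one_right zero_le (hρ1 z)
        · have := hsum fun _ => 1
          simp_rw [mul_one] at this
          rw [this, tsub_le_iff_right, ← ENNReal.tsum_add]
          refine (tsum_measure_singleton μ).symm.trans_le ?_
          refine ENNReal.tsum_le_tsum fun z => ?_
          rw [← mul_add, tsub_add_cancel_of_le (hρ1 z), mul_one]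
    _ ≤ _ := by
        gcongr
        rw [← Summable.tsum_finsetSum fun _ _ => ENNReal.summable]
        refine ENNReal.tsum_le_tsum fun z => ?_
        rw [← Finset.mul_sum]
        gcongr
        exact one_sub_prod_le _ _ fun I' => min_le_left _ _

end Encoder

/-! ### Random functions -/

section RandomFunctions

theorem pi_setOf_forall_mem {S : Type*} [Fintype S] {Ω : S → Type*}
    [∀ s, MeasurableSpace (Ω s)] (ν : ∀ s, Measure (Ω s)) [∀ s, IsProbabilityMeasure (ν s)]
    (T : Finset S) (B : ∀ s : T, Set (Ω s)) :
    Measure.pi ν {h | ∀ s : T, h s ∈ B s} = ∏ s : T, ν s (B s) := by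
  classical
  have hset : {h : ∀ s, Ω s | ∀ s : T, h s ∈ B s} =
      Set.univ.pi fun s => if hs : s ∈ T then B ⟨s, hs⟩ else Set.univ := by
    ext h
    simp only [Set.mem_ofPred_eq, Set.mem_pi, Set.mem_univ, true_imp_iff]
    constructor
    · intro H s
      by_cases hs : s ∈ T
      · simpa [hs] using H ⟨s, hs⟩
      · simp [hs]
    · rintro H ⟨s, hs⟩
      simpa [hs] using H s
  rw [hset, Measure.pi_pi, ← Finset.prod_subset (Finset.subset_univ T), ← Finset.prod_coe_sort T]
  · exact Finset.prod_congr rfl fun s _ => by simp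
  · intro s _ hs
    simp [hs]

instance {α γ : Type*} [MeasurableSpace γ] (E : Ensemble α γ) : IsProbabilityMeasure E.law :=
  E.isProbabilityMeasure

/-- The elements that collide with `x` with probability exceeding `a / |Im F|`. -/
def Ensemble.bad {α γ : Type*} [MeasurableSpace γ] (E : Ensemble α γ) (a : ℝ≥0) (x : α) : Set α :=
  {x' | x' ≠ x ∧ (a : ℝ≥0∞) / (E.im.ncard : ℝ≥0∞) < E.law {f | f x = f x'}}

theorem Ensemble.IsHash.tsum_bad_le {α γ : Type*} [MeasurableSpace γ] {E : Ensemble α γ}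
    {a b : ℝ≥0} (h : E.IsHash a b) (x : α) :
    ∑' x', (E.bad a x).indicator (fun x' => E.law {f | f x = f x'}) x' ≤ b := by
  classical
  refine le_trans (ENNReal.tsum_le_tsum fun x' => ?_) (h x)
  simp only [Set.indicator_apply, Ensemble.bad, Set.mem_ofPred_eq]
  exact (ite_congr rfl (fun _ => rfl) fun _ => rfl).le

theorem Ensemble.collision_le {α γ : Type*} [MeasurableSpace γ] [Fintype γ] {E : Ensemble α γ}
    (him : E.im = Set.univ) {a : ℝ≥0} {x x' : α} (hne : x' ≠ x) (hx : x' ∉ E.bad a x) :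
    E.law {f | f x = f x'} ≤ a / (Fintype.card γ : ℝ≥0∞) := by
  have h := not_and.1 hx hne
  rw [not_lt, him, Set.ncard_univ, Nat.card_eq_fintype_card] at h
  exact h

variable {S : Type*} [Fintype S] [DecidableEq S] {Z C M : S → Type*}
  [∀ s, MeasurableSpace (C s)] [∀ s, MeasurableSpace (M s)]

/-- The law of independent random functions `f_s` and `g_s`. -/
def codeLaw (F : ∀ s, Ensemble (Z s) (C s)) (G : ∀ s, Ensemble (Z s) (M s)) :
    Measure (∀ s, (Z s → C s) × (Z s → M s)) :=
  Measure.pi fun s => (F s).law.prod (G s).law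

instance (F : ∀ s, Ensemble (Z s) (C s)) (G : ∀ s, Ensemble (Z s) (M s)) :
    IsProbabilityMeasure (codeLaw F G) := by
  unfold codeLaw; infer_instance

/-- The sets `funs` need not be measurable, so membership is carried along the projections as an
almost sure property. -/
theorem ae_mem_funs (F : ∀ s, Ensemble (Z s) (C s)) (G : ∀ s, Ensemble (Z s) (M s)) :
    ∀ᵐ h ∂codeLaw F G, ∀ s, (h s).1 ∈ (F s).funs ∧ (h s).2 ∈ (G s).funs := by
  rw [ae_all_iff]
  intro s
  have h1 : ∀ᵐ t ∂(F s).law.prod (G s).law, t.1 ∈ (F s).funs ∧ t.2 ∈ (G s).funs :=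
    (Measure.quasiMeasurePreserving_fst.ae (F s).ae_mem).and
      (Measure.quasiMeasurePreserving_snd.ae (G s).ae_mem)
  exact (Measure.quasiMeasurePreserving_eval
    (fun s => (F s).law.prod (G s).law) s).ae h1

/-- The probability that `x` and `x'` have the same values of `f_s` and `g_s`. -/
def pairCollision {α γ γ' : Type*} [MeasurableSpace γ] [MeasurableSpace γ'] (E : Ensemble α γ)
    (E' : Ensemble α γ') (x x' : α) : ℝ≥0∞ :=
  E.law {f | f x = f x'} * E'.law {f | f x = f x'}

theorem codeLaw_hashPair (F : ∀ s, Ensemble (Z s) (C s)) (G : ∀ s, Ensemble (Z s) (M s))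
    (T : Finset S) (w w' : ∀ s : T, Z s) :
    codeLaw F G {h | hashPair T (fun s => (h s).1) (fun s => (h s).2) w' =
      hashPair T (fun s => (h s).1) (fun s => (h s).2) w} =
      ∏ s : T, pairCollision (F s) (G s) (w s) (w' s) := by
  have hset : {h : ∀ s, (Z s → C s) × (Z s → M s) |
      hashPair T (fun s => (h s).1) (fun s => (h s).2) w' =
        hashPair T (fun s => (h s).1) (fun s => (h s).2) w} =
      {h | ∀ s : T, h s ∈ {f : Z s → C s | f (w s) = f (w' s)} ×ˢ
        {g : Z s → M s | g (w s) = g (w' s)}} := by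
    ext h
    simp only [hashPair, funext_iff, Prod.mk.injEq, Set.mem_ofPred_eq, Set.mem_prod]
    exact forall_congr' fun s => and_congr eq_comm eq_comm
  rw [hset, codeLaw, pi_setOf_forall_mem (fun s => (F s).law.prod (G s).law) T
    fun s => {f : Z s → C s | f (w s) = f (w' s)} ×ˢ {g : Z s → M s | g (w s) = g (w' s)}]
  exact Finset.prod_congr rfl fun s _ => Measure.prod_prod _ _

theorem codeLaw_fst (F : ∀ s, Ensemble (Z s) (C s)) (G : ∀ s, Ensemble (Z s) (M s))
    (T : Finset S) (w w' : ∀ s : T, Z s) :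
    codeLaw F G {h | ∀ s : T, (h s).1 (w s) = (h s).1 (w' s)} =
      ∏ s : T, (F s).law {f | f (w s) = f (w' s)} := by
  have hset : {h : ∀ s, (Z s → C s) × (Z s → M s) | ∀ s : T, (h s).1 (w s) = (h s).1 (w' s)} =
      {h | ∀ s : T, h s ∈ {f : Z s → C s | f (w s) = f (w' s)} ×ˢ (Set.univ : Set (Z s → M s))} := by
    ext h
    simp
  rw [hset, codeLaw, pi_setOf_forall_mem (fun s => (F s).law.prod (G s).law) T
    fun s => {f : Z s → C s | f (w s) = f (w' s)} ×ˢ (Set.univ : Set (Z s → M s))]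
  exact Finset.prod_congr rfl fun s _ => by rw [Measure.prod_prod, measure_univ, mul_one]

/-- A letter is regular for the pair `(f_s, g_s)` only if it is regular for both functions;
independence then multiplies the two bounds. -/
theorem pairCollision_le {α γ γ' : Type*} [MeasurableSpace γ] [MeasurableSpace γ'] [Fintype γ]
    [Fintype γ'] {E : Ensemble α γ} {E' : Ensemble α γ'} (hE : E.im = Set.univ)
    (hE' : E'.im = Set.univ) {a a' : ℝ≥0} {x x' : α}
    (hx : x' ∉ insert x (E.bad a x ∪ E'.bad a' x)) :
    pairCollision E E' x x' ≤ a / (Fintype.card γ : ℝ≥0∞) * (a' / (Fintype.card γ' : ℝ≥0∞)) := by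
  simp only [Set.mem_insert_iff, Set.mem_union, not_or] at hx
  exact mul_le_mul' (Ensemble.collision_le hE hx.1 hx.2.1) (Ensemble.collision_le hE' hx.1 hx.2.2)

/-- The `1` is the collision of `x` with itself. A letter exceptional for one of the two functions
is charged to that function, the other factor being at most `1`. -/
theorem tsum_pairCollision_le {α γ γ' : Type*} [MeasurableSpace γ] [MeasurableSpace γ']
    {E : Ensemble α γ} {E' : Ensemble α γ'} {a a' b b' : ℝ≥0} (hE : E.IsHash a b)
    (hE' : E'.IsHash a' b') (x : α) :
    ∑' x', (insert x (E.bad a x ∪ E'.bad a' x)).indicator (pairCollision E E' x) x' ≤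
      1 + (b + b') := by
  classical
  calc ∑' x', (insert x (E.bad a x ∪ E'.bad a' x)).indicator (pairCollision E E' x) x'
      ≤ ∑' x', (({x} : Set α).indicator 1 x' +
          ((E.bad a x).indicator (fun x' => E.law {f | f x = f x'}) x' +
            (E'.bad a' x).indicator (fun x' => E'.law {f | f x = f x'}) x')) := by
        refine ENNReal.tsum_le_tsum fun x' => Set.indicator_apply_le' (fun h => ?_)
          fun _ => zero_le
        rcases h with rfl | h | h
        · refine le_add_right ?_
          simp only [Set.indicator_of_mem (Set.mem_singleton x'), Pi.one_apply]
          exact mul_le_one' prob_le_one prob_le_one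
        · refine le_add_left (le_add_right ?_)
          rw [Set.indicator_of_mem h]
          exact mul_le_of_le_one_right zero_le prob_le_one
        · refine le_add_left (le_add_left ?_)
          rw [Set.indicator_of_mem h]
          exact mul_le_of_le_one_left zero_le prob_le_one
    _ ≤ _ := by
        rw [ENNReal.tsum_add, ENNReal.tsum_add]
        refine add_le_add (le_of_eq ?_) (add_le_add (hE.tsum_bad_le x) (hE'.tsum_bad_le x))
        rw [tsum_eq_single x fun y hy => by simp [hy]]
        simp

end RandomFunctions

/-! ### The expected deficit of an encoding step -/

section EncoderAverage

variable {S I : Type*} [Fintype S] [Fintype I] [DecidableEq S] [DecidableEq I]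
  {Z C M : S → Type*}
  [∀ s, MeasurableSpace (Z s)] [∀ s, Countable (Z s)] [∀ s, MeasurableSingletonClass (Z s)]
  [∀ s, Fintype (C s)] [∀ s, Nonempty (C s)] [∀ s, MeasurableSpace (C s)]
  [∀ s, MeasurableSingletonClass (C s)]
  [∀ s, Fintype (M s)] [∀ s, Nonempty (M s)] [∀ s, MeasurableSpace (M s)]
  [∀ s, MeasurableSingletonClass (M s)]

/-- The vectors `w` with `μ(w_O | z') ≤ B O` for all `O`. -/
def condTypical (μ : Measure (∀ s, Z s)) (T T' : Finset S) (B : Finset T → ℝ≥0∞)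
    (z' : ∀ s : T', Z s) : Set (∀ s : T, Z s) :=
  {w | ∀ O, ∑' w', {w' : ∀ s : T, Z s | ∀ i ∈ O, w' i = w i}.indicator
    (condWeight μ T T' z') w' ≤ B O}

/-- An upper bound on `4 η` times the expected deficit of a step, plus `2`. -/
def deficitBound (μ : Measure (∀ s, Z s)) (T T' : Finset S) (B : Finset T → ℝ≥0∞) (η : ℝ≥0∞)
    (h : ∀ s, (Z s → C s) × (Z s → M s)) : ℝ≥0∞ :=
  ∑' z, μ {z} * (4 * η ^ 2 + 1 +
    (Fintype.card (∀ s : T, C s × M s) : ℝ≥0∞) *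
      ∑' w, (condTypical μ T T' B (T'.restrict z)).indicator
        (condWeight μ T T' (T'.restrict z)) w *
      ∑' w', (condTypical μ T T' B (T'.restrict z)).indicator
        (condWeight μ T T' (T'.restrict z)) w' *
        {h : ∀ s, (Z s → C s) × (Z s → M s) | hashPair T (fun s => (h s).1) (fun s => (h s).2) w' =
          hashPair T (fun s => (h s).1) (fun s => (h s).2) w}.indicator (fun _ => 1) h +
    (2 + 4 * η) * ∑' w, (condTypical μ T T' B (T'.restrict z))ᶜ.indicator
      (condWeight μ T T' (T'.restrict z)) w)

theorem measurableSet_hashPair_eq (T : Finset S) (w w' : ∀ s : T, Z s) :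
    MeasurableSet {h : ∀ s, (Z s → C s) × (Z s → M s) |
      hashPair T (fun s => (h s).1) (fun s => (h s).2) w' =
        hashPair T (fun s => (h s).1) (fun s => (h s).2) w} := by
  simp only [hashPair, funext_iff, Prod.mk.injEq]
  refine measurableSet_setOfPred.2 ?_
  refine Measurable.forall fun s => ?_
  refine Measurable.and ?_ ?_
  · exact measurableSet_setOfPred.1 (measurableSet_eq_fun (by fun_prop) (by fun_prop))
  · exact measurableSet_setOfPred.1 (measurableSet_eq_fun (by fun_prop) (by fun_prop))

theorem measurable_deficitBound (μ : Measure (∀ s, Z s)) (T T' : Finset S)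
    (B : Finset T → ℝ≥0∞) (η : ℝ≥0∞) :
    Measurable (deficitBound (C := C) (M := M) μ T T' B η) := by
  refine Measurable.tsum fun z => Measurable.const_mul (Measurable.add_const
    (Measurable.const_add (Measurable.const_mul (Measurable.tsum fun w =>
      Measurable.const_mul (Measurable.tsum fun w' => Measurable.const_mul ?_ _) _) _) _)
        _) _
  exact measurable_const.indicator (measurableSet_hashPair_eq T w w')

/-- `tsum_deficit_le` is applied to the conditional law given the public messages and then averaged
over the source. In the resulting bound the functions enter only through indicators of collisions of
pairs, whose expectations the hash property controls. -/
theorem tsum_stepDensity_le_deficitBound (A : Finset (S × I)) (μ : Measure (∀ s, Z s))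
    [IsProbabilityMeasure μ] (I' : Finset I) (B : Finset (privateMessages A I') → ℝ≥0∞)
    (η : ℝ≥0∞) (hη : η ≠ ∞) (h : ∀ s, (Z s → C s) × (Z s → M s)) :
    4 * η * ∑' z, μ {z} *
        (1 - stepDensity A μ (fun s => (h s).1) (fun s => (h s).2) I' z) + 2 ≤
      deficitBound μ (privateMessages A I') (publicMessages A I') B η h := by
  classical
  have h2 : (2 : ℝ≥0∞) = ∑' z, μ {z} * 2 := by
    rw [ENNReal.tsum_mul_right, tsum_measure_singleton, one_mul]
  unfold stepDensity
  rw [← tsum_condWeight_disintegrate μ (privateMessages A I') (publicMessages A I')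
    fun a w => 1 - min 1 ((Fintype.card (∀ s : privateMessages A I', C s × M s) : ℝ≥0∞)⁻¹ /
      fiberWeight (condWeight μ (privateMessages A I') (publicMessages A I') a)
        (hashPair (privateMessages A I') (fun s => (h s).1) (fun s => (h s).2)) w)]
  nth_rewrite 1 [h2]
  rw [← ENNReal.tsum_mul_left, ← ENNReal.tsum_add]
  refine ENNReal.tsum_le_tsum fun z => ?_
  -- Vectors of probability `0` are set aside because their conditional weights need not sum to `1`.
  by_cases hz : μ {z} = 0
  · simp [hz]
  rw [mul_left_comm, ← mul_add]
  refine mul_le_mul' le_rfl ?_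
  refine (tsum_deficit_le (Γ := ∀ s : privateMessages A I', C s × M s) _ (tsum_condWeight_eq_one μ _ _ hz) _
    (condTypical μ (privateMessages A I') (publicMessages A I') B
      ((publicMessages A I').restrict z)) η hη).trans_eq ?_
  congr 4
  funext w
  congr 2
  funext w'
  simp only [Set.indicator_apply, Set.mem_ofPred_eq, mul_ite, mul_one, mul_zero]

/-- After exchanging expectation and sums only pair collision probabilities remain, so the
independence of the coordinates and the hash property of each ensemble suffice. -/
theorem lintegral_deficitBound_le (μ : Measure (∀ s, Z s)) [IsProbabilityMeasure μ]
    (T T' : Finset S) (B : Finset T → ℝ≥0∞) (η : ℝ≥0∞)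
    (F : ∀ s, Ensemble (Z s) (C s)) (G : ∀ s, Ensemble (Z s) (M s))
    (hF : ∀ s, (F s).im = Set.univ) (hG : ∀ s, (G s).im = Set.univ)
    (a b a' b' : S → ℝ≥0) (hFh : ∀ s, (F s).IsHash (a s) (b s))
    (hGh : ∀ s, (G s).IsHash (a' s) (b' s)) :
    ∫⁻ h, deficitBound μ T T' B η h ∂codeLaw F G ≤
      4 * η ^ 2 + 1 + (Fintype.card (∀ s : T, C s × M s) : ℝ≥0∞) *
        ∑ O : Finset T, (∏ s ∈ Oᶜ, ((a s : ℝ≥0∞) / (Fintype.card (C s) : ℝ≥0∞) *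
          (a' s / (Fintype.card (M s) : ℝ≥0∞)))) *
          ((∏ s ∈ O, (1 + ((b s : ℝ≥0∞) + b' s))) * B O) +
      (2 + 4 * η) * μ {z | T.restrict z ∉ condTypical μ T T' B (T'.restrict z)} := by
  classical
  have hcompl : ∑' z, μ {z} * ∑' w, (condTypical μ T T' B (T'.restrict z))ᶜ.indicator
      (condWeight μ T T' (T'.restrict z)) w =
      μ {z | T.restrict z ∉ condTypical μ T T' B (T'.restrict z)} := by
    rw [measure_eq_tsum_indicator μ {z | T.restrict z ∉ condTypical μ T T' B (T'.restrict z)}]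
    have := tsum_condWeight_disintegrate μ T T'
      fun a w => (condTypical μ T T' B a)ᶜ.indicator 1 w
    simp only [Set.indicator_apply, Pi.one_apply, mul_ite, mul_one, mul_zero] at this ⊢
    exact this
  have hmeas : ∀ w w' : ∀ s : T, Z s, Measurable
      ({h : ∀ s, (Z s → C s) × (Z s → M s) | hashPair T (fun s => (h s).1) (fun s => (h s).2) w' =
        hashPair T (fun s => (h s).1) (fun s => (h s).2) w}.indicator (fun _ => (1 : ℝ≥0∞))) :=
    fun w w' => measurable_const.indicator (measurableSet_hashPair_eq T w w')
  set K : ℝ≥0∞ := ∑ O : Finset T, (∏ s ∈ Oᶜ, ((a s : ℝ≥0∞) / (Fintype.card (C s) : ℝ≥0∞) *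
          (a' s / (Fintype.card (M s) : ℝ≥0∞)))) *
          ((∏ s ∈ O, (1 + ((b s : ℝ≥0∞) + b' s))) * B O) with hK
  unfold deficitBound
  rw [lintegral_tsum fun z => (Measurable.const_mul (Measurable.add_const
    (Measurable.const_add (Measurable.const_mul (Measurable.tsum fun w =>
      Measurable.const_mul (Measurable.tsum fun w' =>
        Measurable.const_mul (hmeas w w') _) _) _) _) _) _).aemeasurable]
  rw [← hcompl, ← ENNReal.tsum_mul_left]
  have h1 : 4 * η ^ 2 + 1 + (Fintype.card (∀ s : T, C s × M s) : ℝ≥0∞) * K = ∑' z, μ {z} *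
      (4 * η ^ 2 + 1 + (Fintype.card (∀ s : T, C s × M s) : ℝ≥0∞) * K) := by
    rw [ENNReal.tsum_mul_right, tsum_measure_singleton, one_mul]
  rw [h1, ← ENNReal.tsum_add]
  refine ENNReal.tsum_le_tsum fun z => ?_
  rw [lintegral_const_mul _ (Measurable.add_const
    (Measurable.const_add (Measurable.const_mul (Measurable.tsum fun w =>
      Measurable.const_mul (Measurable.tsum fun w' =>
        Measurable.const_mul (hmeas w w') _) _) _) _) _),
    lintegral_add_right _ measurable_const, lintegral_add_left measurable_const,
    lintegral_const_mul _ (Measurable.tsum fun w =>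
      Measurable.const_mul (Measurable.tsum fun w' =>
        Measurable.const_mul (hmeas w w') _) _)]
  simp only [lintegral_const, measure_univ, mul_one]
  rw [mul_left_comm (2 + 4 * η), ← mul_add]
  gcongr
  rw [lintegral_tsum fun w => (Measurable.const_mul (Measurable.tsum fun w' =>
        Measurable.const_mul (hmeas w w') _) _).aemeasurable]
  calc _ ≤ ∑' w, condWeight μ T T' (T'.restrict z) w * K := by
        refine ENNReal.tsum_le_tsum fun w => ?_
        rw [lintegral_const_mul _ (Measurable.tsum fun w' =>
          Measurable.const_mul (hmeas w w') _)]
        refine mul_le_mul' (Set.indicator_le_self _ _ _) ?_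
        rw [lintegral_tsum fun w' => (Measurable.const_mul (hmeas w w') _).aemeasurable]
        -- Relative to a fixed `w`, the exceptional letters of coordinate `s` are `w s` itself and
        -- the bad letters of either ensemble.
        refine le_trans (le_of_eq ?_) (tsum_weight_mul_collision_le
          (condWeight μ T T' (T'.restrict z)) (condTypical μ T T' B (T'.restrict z))
          (fun s x' => pairCollision (F s) (G s) (w s) x')
          (fun s => insert (w s) ((F s).bad (a s) (w s) ∪ (G s).bad (a' s) (w s))) _ _ B
          (fun s x' hx' => pairCollision_le (hF s) (hG s) hx')
          (fun s => tsum_pairCollision_le (hFh s) (hGh s) (w s)) fun O w hw => hw O)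
        refine tsum_congr fun w' => ?_
        rw [lintegral_const_mul _ (hmeas w w'),
          lintegral_indicator_const (measurableSet_hashPair_eq T w w'), one_mul,
          codeLaw_hashPair]
    _ ≤ K := by
        rw [ENNReal.tsum_mul_right]
        exact mul_le_of_le_one_left zero_le (tsum_condWeight_le_one μ T T' _)

end EncoderAverage

/-! ### The decoders -/

section Mismatch

/-- This is the union bound over `j`: once coordinate `j` is required to be wrong, the sums over the
other coordinates are at most `1`. -/
theorem tsum_exists_ne_mul_prod_le {J : Type*} [Fintype J] {α : J → Type*} (p : ∀ j, PMF (α j))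
    (x : ∀ j, α j) :
    ∑' d : ∀ j, α j, {d : ∀ j, α j | ∃ j, d j ≠ x j}.indicator (fun d => ∏ j, p j (d j)) d ≤
      ∑ j, (1 - p j (x j)) := by
  classical
  have hcompl : ∀ j, ∑' y, ({x j}ᶜ : Set (α j)).indicator (p j) y ≤ 1 - p j (x j) := by
    intro j
    refine ENNReal.le_sub_of_add_le_left (PMF.apply_ne_top _ _) ?_
    have h1 : p j (x j) = ∑' y, ({x j} : Set (α j)).indicator (p j) y := by
      rw [tsum_eq_single (x j) fun y hy => by simp [hy]]
      simp
    rw [h1, ← ENNReal.tsum_add]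
    simp_rw [Set.indicator_self_add_compl_apply]
    exact (PMF.tsum_coe _).le
  calc _ ≤ ∑' d : ∀ j, α j, ∑ j, ∏ k, (if k = j then ({x k}ᶜ : Set (α k)).indicator (p k)
        else p k) (d k) := by
        refine ENNReal.tsum_le_tsum fun d => Set.indicator_apply_le' ?_ fun _ => zero_le
        rintro ⟨j, hj⟩
        refine le_trans (le_of_eq ?_) (Finset.single_le_sum (fun _ _ => zero_le)
          (Finset.mem_univ j))
        refine Finset.prod_congr rfl fun k _ => ?_
        by_cases h : k = j
        · subst h
          rw [if_pos rfl, Set.indicator_of_mem (show d k ∈ ({x k}ᶜ : Set (α k)) from hj)]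
        · rw [if_neg h]
    _ ≤ _ := by
        rw [Summable.tsum_finsetSum fun _ _ => ENNReal.summable]
        refine Finset.sum_le_sum fun j _ => (tsum_pi_prod_le _).trans ?_
        rw [← Finset.mul_prod_erase _ _ (Finset.mem_univ j)]
        refine (mul_le_of_le_one_right zero_le (Finset.prod_le_one' fun k hk => ?_)).trans ?_
        · rw [if_neg (Finset.ne_of_mem_erase hk)]
          exact (PMF.tsum_coe _).le
        · rw [if_pos rfl]
          exact hcompl j

theorem le_pmf_map_apply {α β : Type*} (p : PMF α) (φ : α → β) (x : α) :
    p x ≤ p.map φ (φ x) := by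
  classical
  rw [PMF.map_apply]
  refine le_trans ?_ (ENNReal.le_tsum x)
  simp

variable {S I J : Type*} [Fintype S] [Fintype I] [Fintype J] [DecidableEq S] [DecidableEq I]
  {Z C M : S → Type*} {X : I → Type*} {Y : J → Type*}
  [∀ s, MeasurableSpace (Z s)] [∀ s, Countable (Z s)] [∀ s, MeasurableSingletonClass (Z s)]
  [∀ s, Nonempty (Z s)] [∀ i, MeasurableSpace (X i)] [∀ j, MeasurableSpace (Y j)]
  [∀ s, Fintype (M s)]

/-- The values of the functions `f_s` on `D`. -/
def hashVector (D : Finset S) (f : ∀ s, Z s → C s) (w : ∀ s : D, Z s) : ∀ s : D, C s :=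
  fun s => f s (w s)

/-- Drawing the true vector is enough for a correct output. Other vectors may yield the same
messages, hence only an inequality. -/
theorem posterior_ratio_le_decoderOutput {B : Type*} [MeasurableSpace B] (D : Finset S)
    (κ : Kernel B (∀ s : D, Z s)) [IsMarkovKernel κ] (f : ∀ s, Z s → C s) (g : ∀ s, Z s → M s)
    (z : ∀ s, Z s) (y : B) :
    κ y {D.restrict z} / fiberWeight (fun w => κ y {w}) (hashVector D f) (D.restrict z) ≤
      decoderOutput D κ f g (D.restrict fun s => f s (z s)) y
        (some (D.restrict fun s => g s (z s))) := by
  have hE : fiber D f (D.restrict fun s => f s (z s)) =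
      {w | hashVector D f w = hashVector D f (D.restrict z)} := by
    ext w
    simp only [fiber, hashVector, Set.mem_ofPred_eq, funext_iff, Finset.restrict]
  unfold decoderOutput
  refine le_trans ?_ (le_pmf_map_apply _ _ (some (D.restrict z)))
  refine le_trans ?_ (indicator_div_tsum_le_constrainedGenerator _ _ _ ?_)
  · rw [Set.indicator_of_mem, hE]
    · exact le_rfl
    · rw [hE]
      rfl
  · refine ((ENNReal.tsum_le_tsum fun w => Set.indicator_le_self _ _ _).trans_lt ?_).ne
    rw [tsum_measure_singleton]
    exact ENNReal.one_lt_top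

theorem mismatchProb_eq (A : Finset (S × I)) (D : J → Finset S) (μ : Measure (∀ s, Z s))
    [IsProbabilityMeasure μ] (W : ∀ i, Kernel (∀ s : messagesOf A i, Z s) (X i))
    [∀ i, IsMarkovKernel (W i)] (V : Kernel (∀ i, X i) (∀ j, Y j)) [IsMarkovKernel V]
    (f : ∀ s, Z s → C s) (g : ∀ s, Z s → M s) (c : ∀ s, C s) (m : ∀ s, M s) (y : ∀ j, Y j) :
    mismatchProb A D μ W V f g c m y =
      ∑' d : ∀ j, Option (∀ s : D j, M s), {d : ∀ j, Option (∀ s : D j, M s) |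
        ∃ j, d j ≠ some ((D j).restrict m)}.indicator (fun d => ∏ j, decoderOutput (D j)
          (posterior A D μ W V j) f g ((D j).restrict c) (y j) (d j)) d := by
  classical
  unfold mismatchProb
  refine tsum_congr fun d => ?_
  simp only [Set.indicator_apply, Set.mem_ofPred_eq]

theorem mismatchProb_le_one (A : Finset (S × I)) (D : J → Finset S) (μ : Measure (∀ s, Z s))
    [IsProbabilityMeasure μ] (W : ∀ i, Kernel (∀ s : messagesOf A i, Z s) (X i))
    [∀ i, IsMarkovKernel (W i)] (V : Kernel (∀ i, X i) (∀ j, Y j)) [IsMarkovKernel V]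
    (f : ∀ s, Z s → C s) (g : ∀ s, Z s → M s) (c : ∀ s, C s) (m : ∀ s, M s) (y : ∀ j, Y j) :
    mismatchProb A D μ W V f g c m y ≤ 1 := by
  rw [mismatchProb_eq]
  refine (ENNReal.tsum_le_tsum fun d => Set.indicator_le_self _ _ _).trans
    ((tsum_pi_prod_le fun j o => decoderOutput (D j) (posterior A D μ W V j) f g
      ((D j).restrict c) (y j) o).trans ?_)
  exact Finset.prod_le_one' fun j _ => (PMF.tsum_coe _).le

instance (A : Finset (S × I)) (D : J → Finset S) (μ : Measure (∀ s, Z s))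
    [IsProbabilityMeasure μ] (W : ∀ i, Kernel (∀ s : messagesOf A i, Z s) (X i))
    [∀ i, IsMarkovKernel (W i)] (V : Kernel (∀ i, X i) (∀ j, Y j)) [IsMarkovKernel V] (j : J) :
    IsMarkovKernel (posterior A D μ W V j) := by
  unfold posterior; infer_instance

/-- The probability that a sample of the posterior law, given `y` and the values of the functions
`f_s` on `w`, differs from `w`. -/
def samplingError {B : Type*} [MeasurableSpace B] (D : Finset S) (κ : Kernel B (∀ s : D, Z s))
    (f : ∀ s, Z s → C s) (y : B) (w : ∀ s : D, Z s) : ℝ≥0∞ :=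
  1 - κ y {w} / fiberWeight (fun w => κ y {w}) (hashVector D f) w

theorem mismatchProb_le (A : Finset (S × I)) (D : J → Finset S) (μ : Measure (∀ s, Z s))
    [IsProbabilityMeasure μ] (W : ∀ i, Kernel (∀ s : messagesOf A i, Z s) (X i))
    [∀ i, IsMarkovKernel (W i)] (V : Kernel (∀ i, X i) (∀ j, Y j)) [IsMarkovKernel V]
    (f : ∀ s, Z s → C s) (g : ∀ s, Z s → M s) (z : ∀ s, Z s) (y : ∀ j, Y j) :
    mismatchProb A D μ W V f g (fun s => f s (z s)) (fun s => g s (z s)) y ≤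
      ∑ j, samplingError (D j) (posterior A D μ W V j) f (y j) ((D j).restrict z) := by
  rw [mismatchProb_eq]
  refine (tsum_exists_ne_mul_prod_le (fun j => decoderOutput (D j) (posterior A D μ W V j) f g
      ((D j).restrict fun s => f s (z s)) (y j)) fun j => some ((D j).restrict fun s =>
        g s (z s))).trans ?_
  exact Finset.sum_le_sum fun j _ => tsub_le_tsub_left
    (posterior_ratio_le_decoderOutput (D j) _ f g z (y j)) _

theorem measurable_samplingError {B : Type*} [MeasurableSpace B] (D : Finset S)
    (κ : Kernel B (∀ s : D, Z s)) (f : ∀ s, Z s → C s) :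
    Measurable fun t : B × (∀ s : D, Z s) => samplingError D κ f t.1 t.2 := by
  classical
  refine measurable_from_prod_countable_left fun w => ?_
  unfold samplingError fiberWeight
  refine Measurable.const_sub (Measurable.div (Kernel.measurable_coe _ (measurableSet_singleton _))
    (Measurable.tsum fun w' => ?_)) _
  simp only [Set.indicator_apply]
  split_ifs
  · exact Kernel.measurable_coe _ (measurableSet_singleton _)
  · exact measurable_const

theorem lintegral_jointLaw (A : Finset (S × I)) (μ : Measure (∀ s, Z s))
    [IsProbabilityMeasure μ] (W : ∀ i, Kernel (∀ s : messagesOf A i, Z s) (X i))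
    [∀ i, IsMarkovKernel (W i)] (V : Kernel (∀ i, X i) (∀ j, Y j)) [IsMarkovKernel V]
    (φ : (∀ s, Z s) × (∀ i, X i) × (∀ j, Y j) → ℝ≥0∞) (hφ : Measurable φ) :
    ∫⁻ ω, φ ω ∂jointLaw A μ W V =
      ∑' z, μ {z} * ∫⁻ x, ∫⁻ y, φ (z, x, y) ∂V x ∂inputKernel A W z := by
  rw [jointLaw, Measure.lintegral_compProd hφ, lintegral_countable']
  refine tsum_congr fun z => ?_
  rw [mul_comm, Kernel.lintegral_compProd (f := fun b => φ (z, b)) _ _ _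
    (hφ.comp measurable_prodMk_left)]
  rfl

/-- Disintegration over the channel output turns the decoding error into a sum over a countable set
for each fixed `y`, the setting of `tsum_posterior_error_le`. -/
theorem lintegral_jointLaw_posterior (A : Finset (S × I)) (D : J → Finset S)
    (μ : Measure (∀ s, Z s))
    [IsProbabilityMeasure μ] (W : ∀ i, Kernel (∀ s : messagesOf A i, Z s) (X i))
    [∀ i, IsMarkovKernel (W i)] (V : Kernel (∀ i, X i) (∀ j, Y j)) [IsMarkovKernel V] (j : J)
    (φ : Y j × (∀ s : D j, Z s) → ℝ≥0∞) (hφ : Measurable φ) :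
    ∫⁻ ω, φ (ω.2.2 j, (D j).restrict ω.1) ∂jointLaw A μ W V =
      ∫⁻ y, ∑' w, posterior A D μ W V j y {w} * φ (y, w)
        ∂(jointLaw A μ W V).map fun ω => ω.2.2 j := by
  have hmeas : Measurable fun ω : (∀ s, Z s) × (∀ i, X i) × (∀ j, Y j) => (D j).restrict ω.1 :=
    (Finset.measurable_restrict _).comp measurable_fst
  have hmeas' : Measurable fun ω : (∀ s, Z s) × (∀ i, X i) × (∀ j, Y j) => ω.2.2 j :=
    (measurable_pi_apply j).comp (measurable_snd.comp measurable_snd)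
  rw [← lintegral_map (f := φ) (g := fun ω : (∀ s, Z s) × (∀ i, X i) × (∀ j, Y j) =>
    (ω.2.2 j, (D j).restrict ω.1)) hφ (hmeas'.prodMk hmeas),
    ← compProd_map_condDistrib hmeas.aemeasurable, Measure.lintegral_compProd hφ]
  refine lintegral_congr fun y => ?_
  rw [lintegral_countable']
  exact tsum_congr fun w => mul_comm _ _

end Mismatch

/-! ### Collisions of a source vector with typical vectors. -/

section Collision

variable {S : Type*} [Fintype S] [DecidableEq S] {Z C M : S → Type*} {B : Type*}
  [MeasurableSpace B]
  [∀ s, MeasurableSpace (Z s)] [∀ s, Countable (Z s)] [∀ s, MeasurableSingletonClass (Z s)]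
  [∀ s, Fintype (C s)] [∀ s, MeasurableSpace (C s)] [∀ s, MeasurableSingletonClass (C s)]
  [∀ s, MeasurableSpace (M s)]

/-- A bound on the indicator of the event that another vector in the section of `T` at `y` has the
same values of the functions `f_s` as `z`. -/
def collisionBound (F : ∀ s, Ensemble (Z s) (C s)) (D : Finset S) (a : S → ℝ≥0)
    (T : Set (B × (∀ s : D, Z s))) (h : ∀ s, (Z s → C s) × (Z s → M s)) (y : B)
    (z : ∀ s : D, Z s) : ℝ≥0∞ :=
  ∑ s : D, ∑' x, ((F s).bad (a s) (z s)).indicator (fun x =>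
      {h : ∀ s, (Z s → C s) × (Z s → M s) | (h s).1 (z s) = (h s).1 x}.indicator
        (fun _ => (1 : ℝ≥0∞)) h) x +
    ∑' w, {w | (y, w) ∈ T ∧ w ≠ z ∧ ∀ s : D, w s ∉ (F s).bad (a s) (z s)}.indicator (fun w =>
      {h : ∀ s, (Z s → C s) × (Z s → M s) | ∀ s : D, (h s).1 (z s) = (h s).1 (w s)}.indicator
        (fun _ => (1 : ℝ≥0∞)) h) w

/-- A colliding vector either has a bad coordinate, which the first sum counts at that coordinate
alone, or has none and is counted as a whole in the second sum. -/
theorem one_le_collisionBound (F : ∀ s, Ensemble (Z s) (C s)) (D : Finset S) (a : S → ℝ≥0)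
    (T : Set (B × (∀ s : D, Z s))) (h : ∀ s, (Z s → C s) × (Z s → M s)) (y : B)
    (z w : ∀ s : D, Z s) (hw : (y, w) ∈ T) (hne : w ≠ z)
    (heq : hashVector D (fun s => (h s).1) w = hashVector D (fun s => (h s).1) z) :
    1 ≤ collisionBound F D a T h y z := by
  classical
  have heq' : ∀ s : D, (h s).1 (z s) = (h s).1 (w s) := fun s => (congrFun heq s).symm
  unfold collisionBound
  by_cases hbad : ∃ s : D, w s ∈ (F s).bad (a s) (z s)
  · obtain ⟨s, hs⟩ := hbad
    refine le_add_right (le_trans (le_trans ?_ (ENNReal.le_tsum (w s)))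
      (Finset.single_le_sum (f := fun s : D => ∑' x, ((F s).bad (a s) (z s)).indicator (fun x =>
      {h : ∀ s, (Z s → C s) × (Z s → M s) | (h s).1 (z s) = (h s).1 x}.indicator
        (fun _ => (1 : ℝ≥0∞)) h) x) (fun _ _ => zero_le) (Finset.mem_univ s)))
    rw [Set.indicator_of_mem hs, Set.indicator_of_mem]
    exact heq' s
  · push Not at hbad
    refine le_add_left (le_trans ?_ (ENNReal.le_tsum w))
    rw [Set.indicator_of_mem, Set.indicator_of_mem]
    · exact heq'
    · exact ⟨hw, hne, hbad⟩

theorem measurableSet_collision (D : Finset S) (z w : ∀ s : D, Z s) :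
    MeasurableSet {h : ∀ s, (Z s → C s) × (Z s → M s) |
      ∀ s : D, (h s).1 (z s) = (h s).1 (w s)} := by
  refine measurableSet_setOfPred.2 (Measurable.forall fun s => ?_)
  exact measurableSet_setOfPred.1 (measurableSet_eq_fun (by fun_prop) (by fun_prop))

theorem measurableSet_collision_single (s : S) (x x' : Z s) :
    MeasurableSet {h : ∀ s, (Z s → C s) × (Z s → M s) | (h s).1 x = (h s).1 x'} :=
  measurableSet_eq_fun (by fun_prop) (by fun_prop)

theorem measurable_collisionBound_left (F : ∀ s, Ensemble (Z s) (C s)) (D : Finset S)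
    (a : S → ℝ≥0) (T : Set (B × (∀ s : D, Z s))) (hT : MeasurableSet T) (z : ∀ s : D, Z s) :
    Measurable fun t : (∀ s, (Z s → C s) × (Z s → M s)) × B =>
      collisionBound F D a T t.1 t.2 z := by
  classical
  unfold collisionBound
  refine Measurable.add (Finset.measurable_sum _ fun s _ => Measurable.tsum fun x => ?_)
    (Measurable.tsum fun w => ?_)
  · by_cases hx : x ∈ (F s).bad (a s) (z s)
    · simp only [Set.indicator_of_mem hx]
      exact (measurable_const.indicator (measurableSet_collision_single _ _ _)).comp
        measurable_fst
    · simp only [Set.indicator_of_notMem hx]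
      exact measurable_const
  · by_cases hw : w ≠ z ∧ ∀ s : D, w s ∉ (F s).bad (a s) (z s)
    · have h1 : (fun t : (∀ s, (Z s → C s) × (Z s → M s)) × B =>
          {w | (t.2, w) ∈ T ∧ w ≠ z ∧ ∀ s : D, w s ∉ (F s).bad (a s) (z s)}.indicator (fun w =>
          {h : ∀ s, (Z s → C s) × (Z s → M s) | ∀ s : D, (h s).1 (z s) = (h s).1 (w s)}.indicator
            (fun _ => (1 : ℝ≥0∞)) t.1) w) =
          ({h : ∀ s, (Z s → C s) × (Z s → M s) | ∀ s : D, (h s).1 (z s) = (h s).1 (w s)} ×ˢ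
            {y | (y, w) ∈ T}).indicator fun _ => (1 : ℝ≥0∞) := by
        funext t
        by_cases h2 : (t.2, w) ∈ T
        · rw [Set.indicator_of_mem (show w ∈ {w | (t.2, w) ∈ T ∧ w ≠ z ∧
            ∀ s : D, w s ∉ (F s).bad (a s) (z s)} from ⟨h2, hw⟩)]
          simp only [Set.indicator_apply, Set.mem_prod, Set.mem_ofPred_eq, h2, and_true]
        · rw [Set.indicator_of_notMem fun h => h2 h.1, Set.indicator_of_notMem fun h => h2 h.2]
      rw [h1]
      refine measurable_const.indicator ((measurableSet_collision D z w).prod ?_)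
      exact measurable_prodMk_right hT
    · have h1 : ∀ y : B, w ∉ {w | (y, w) ∈ T ∧ w ≠ z ∧
          ∀ s : D, w s ∉ (F s).bad (a s) (z s)} := fun y h => hw h.2
      simp only [Set.indicator_of_notMem (h1 _)]
      exact measurable_const

theorem measurable_collisionBound (F : ∀ s, Ensemble (Z s) (C s)) (D : Finset S) (a : S → ℝ≥0)
    (T : Set (B × (∀ s : D, Z s))) (hT : MeasurableSet T) :
    Measurable fun t : ((∀ s, (Z s → C s) × (Z s → M s)) × B) × (∀ s : D, Z s) =>
      collisionBound F D a T t.1.1 t.1.2 t.2 :=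
  measurable_from_prod_countable_left fun z => measurable_collisionBound_left F D a T hT z

/-- The bad coordinates cost `b s` each by the hash property. The vectors without bad coordinates
are sorted by the set `O` where they differ from `z`: there are at most `N O` of them, each
colliding with probability at most the product of `a s / |C s|` over `O`. -/
theorem lintegral_collisionBound_le (F : ∀ s, Ensemble (Z s) (C s))
    (G : ∀ s, Ensemble (Z s) (M s)) (hF : ∀ s, (F s).im = Set.univ) (D : Finset S)
    (a b : S → ℝ≥0) (hFh : ∀ s, (F s).IsHash (a s) (b s)) (T : Set (B × (∀ s : D, Z s)))
    (N : Finset D → ℝ≥0∞) (y : B) (z : ∀ s : D, Z s)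
    (hN : ∀ O : Finset D, O.Nonempty → ∑' w,
      {w | (y, w) ∈ T ∧ ∀ i ∉ O, w i = z i}.indicator (fun _ => (1 : ℝ≥0∞)) w ≤ N O) :
    ∫⁻ h, collisionBound F D a T h y z ∂codeLaw F G ≤
      ∑ s : D, (b s : ℝ≥0∞) + ∑ O ∈ Finset.univ.filter fun O : Finset D => O.Nonempty,
        N O * ∏ s ∈ O, ((a s : ℝ≥0∞) / (Fintype.card (C s) : ℝ≥0∞)) := by
  classical
  have hm1 : ∀ (s : D) (x : Z s), Measurable fun h : ∀ s, (Z s → C s) × (Z s → M s) =>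
      ((F s).bad (a s) (z s)).indicator (fun x =>
      {h : ∀ s, (Z s → C s) × (Z s → M s) | (h s).1 (z s) = (h s).1 x}.indicator
        (fun _ => (1 : ℝ≥0∞)) h) x := by
    intro s x
    by_cases hx : x ∈ (F s).bad (a s) (z s)
    · simp only [Set.indicator_of_mem hx]
      exact measurable_const.indicator (measurableSet_collision_single _ _ _)
    · simp only [Set.indicator_of_notMem hx]
      exact measurable_const
  have hm2 : ∀ w, Measurable fun h : ∀ s, (Z s → C s) × (Z s → M s) =>
      {w | (y, w) ∈ T ∧ w ≠ z ∧ ∀ s : D, w s ∉ (F s).bad (a s) (z s)}.indicator (fun w =>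
      {h : ∀ s, (Z s → C s) × (Z s → M s) | ∀ s : D, (h s).1 (z s) = (h s).1 (w s)}.indicator
        (fun _ => (1 : ℝ≥0∞)) h) w := by
    intro w
    by_cases hw : w ∈ {w | (y, w) ∈ T ∧ w ≠ z ∧ ∀ s : D, w s ∉ (F s).bad (a s) (z s)}
    · simp only [Set.indicator_of_mem hw]
      exact measurable_const.indicator (measurableSet_collision _ _ _)
    · simp only [Set.indicator_of_notMem hw]
      exact measurable_const
  unfold collisionBound
  rw [lintegral_add_right _ (Measurable.tsum hm2),
    lintegral_finsetSum _ fun s _ => Measurable.tsum (hm1 s)]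
  refine add_le_add (Finset.sum_le_sum fun s _ => ?_) ?_
  · rw [lintegral_tsum fun x => (hm1 s x).aemeasurable]
    refine le_trans (ENNReal.tsum_le_tsum fun x => ?_) ((hFh s).tsum_bad_le (z s))
    by_cases hx : x ∈ (F s).bad (a s) (z s)
    · simp only [Set.indicator_of_mem hx]
      rw [lintegral_indicator_const (measurableSet_collision_single _ _ _), one_mul]
      have hset : {h : ∀ s, (Z s → C s) × (Z s → M s) | (h s).1 (z s) = (h s).1 x} =
          Function.eval (s : S) ⁻¹' (Prod.fst ⁻¹' {f | f (z s) = f x}) := rfl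
      have hm : MeasurableSet {f : Z s → C s | f (z s) = f x} :=
        measurableSet_eq_fun (by fun_prop) (by fun_prop)
      rw [hset, codeLaw, (measurePreserving_eval (fun s => (F s).law.prod (G s).law)
        (s : S)).measure_preimage (hm.preimage measurable_fst).nullMeasurableSet,
        measurePreserving_fst.measure_preimage hm.nullMeasurableSet]
    · simp [Set.indicator_of_notMem hx]
  · rw [lintegral_tsum fun w => (hm2 w).aemeasurable]
    refine le_trans (le_of_eq (tsum_congr fun w => ?_)) (tsum_collision_le z {w | (y, w) ∈ T}
      (fun s x => (F s).law {f | f (z s) = f x}) (fun s => (F s).bad (a s) (z s))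
      (fun s => (a s : ℝ≥0∞) / (Fintype.card (C s) : ℝ≥0∞)) N (fun s x => prob_le_one)
      (fun s x hx hne => Ensemble.collision_le (hF s) hne hx) hN)
    by_cases hw : w ∈ {w | (y, w) ∈ T ∧ w ≠ z ∧ ∀ s : D, w s ∉ (F s).bad (a s) (z s)}
    · simp only [Set.indicator_of_mem hw]
      rw [Set.indicator_of_mem (s := {w | w ∈ {w | (y, w) ∈ T} ∧ w ≠ z ∧
          ∀ s : D, w s ∉ (F s).bad (a s) (z s)}) hw, lintegral_indicator_const (measurableSet_collision _ _ _),
        one_mul, codeLaw_fst]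
    · simp only [Set.indicator_of_notMem hw]
      rw [Set.indicator_of_notMem (s := {w | w ∈ {w | (y, w) ∈ T} ∧ w ≠ z ∧
          ∀ s : D, w s ∉ (F s).bad (a s) (z s)}) hw, lintegral_zero]

end Collision

/-! ### The random coding bound at one block length -/

section RandomCoding

variable {S I J : Type*} [Fintype S] [Fintype I] [Fintype J] [DecidableEq S] [DecidableEq I]
  {Z C M : S → Type*} {X : I → Type*} {Y : J → Type*}
  [∀ s, MeasurableSpace (Z s)] [∀ s, Countable (Z s)] [∀ s, MeasurableSingletonClass (Z s)]
  [∀ s, Nonempty (Z s)] [∀ i, MeasurableSpace (X i)] [∀ j, MeasurableSpace (Y j)]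
  [∀ s, Fintype (C s)] [∀ s, Nonempty (C s)] [∀ s, MeasurableSpace (C s)]
  [∀ s, MeasurableSingletonClass (C s)]
  [∀ s, Fintype (M s)] [∀ s, Nonempty (M s)] [∀ s, MeasurableSpace (M s)]
  [∀ s, MeasurableSingletonClass (M s)]

theorem measurable_comp_prodMk {H B Q Ω : Type*} [MeasurableSpace H] [MeasurableSpace B]
    [MeasurableSpace Q] [MeasurableSpace Ω] {φ : (H × B) × Q → ℝ≥0∞} (hφ : Measurable φ)
    {v : Ω → B × Q} (hv : Measurable v) :
    Measurable fun t : H × Ω => φ ((t.1, (v t.2).1), (v t.2).2) :=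
  hφ.comp ((measurable_fst.prodMk ((measurable_fst.comp hv).comp measurable_snd)).prodMk
    ((measurable_snd.comp hv).comp measurable_snd))

theorem measurable_comp_prodMk_left {H B Q : Type*} [MeasurableSpace H] [MeasurableSpace B]
    [MeasurableSpace Q] {φ : (H × B) × Q → ℝ≥0∞} (hφ : Measurable φ) (h : H) :
    Measurable fun t : B × Q => φ ((h, t.1), t.2) :=
  hφ.comp ((measurable_const.prodMk measurable_fst).prodMk measurable_snd)

/-- The output of channel `j` and the messages in `D`. -/
def decoderView (D : Finset S) (j : J) (ω : (∀ s, Z s) × (∀ i, X i) × (∀ j, Y j)) :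
    Y j × (∀ s : D, Z s) :=
  (ω.2.2 j, D.restrict ω.1)

theorem measurable_decoderView (D : Finset S) (j : J) :
    Measurable (decoderView (Z := Z) (X := X) (Y := Y) D j) :=
  ((measurable_pi_apply j).comp (measurable_snd.comp measurable_snd)).prodMk
    ((Finset.measurable_restrict _).comp measurable_fst)

/-- An upper bound on the error probability of decoder `j`. -/
def decodingBound (A : Finset (S × I)) (D : J → Finset S) (μ : Measure (∀ s, Z s))
    (W : ∀ i, Kernel (∀ s : messagesOf A i, Z s) (X i)) (V : Kernel (∀ i, X i) (∀ j, Y j))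
    (F : ∀ s, Ensemble (Z s) (C s)) (a : S → ℝ≥0) (j : J) (T : Set (Y j × (∀ s : D j, Z s)))
    (h : ∀ s, (Z s → C s) × (Z s → M s)) : ℝ≥0∞ :=
  2 * jointLaw A μ W V {ω | decoderView (D j) j ω ∉ T} +
    ∫⁻ ω, collisionBound F (D j) a T h (decoderView (D j) j ω).1 (decoderView (D j) j ω).2
      ∂jointLaw A μ W V

variable (A : Finset (S × I)) (D : J → Finset S) (μ : Measure (∀ s, Z s))
  [IsProbabilityMeasure μ] (W : ∀ i, Kernel (∀ s : messagesOf A i, Z s) (X i))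
  [∀ i, IsMarkovKernel (W i)] (V : Kernel (∀ i, X i) (∀ j, Y j)) [IsMarkovKernel V]
  (F : ∀ s, Ensemble (Z s) (C s)) (a : S → ℝ≥0)

theorem measurable_collisionBound_decoderView (j : J) (T : Set (Y j × (∀ s : D j, Z s)))
    (hT : MeasurableSet T) :
    Measurable fun t : (∀ s, (Z s → C s) × (Z s → M s)) × ((∀ s, Z s) × (∀ i, X i) × (∀ j, Y j)) =>
      collisionBound F (D j) a T t.1 (decoderView (D j) j t.2).1 (decoderView (D j) j t.2).2 := by
  exact measurable_comp_prodMk (φ := fun t : ((∀ s, (Z s → C s) × (Z s → M s)) × Y j) ×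
      (∀ s : D j, Z s) => collisionBound F (D j) a T t.1.1 t.1.2 t.2)
    (v := decoderView (Z := Z) (X := X) (Y := Y) (D j) j)
    (measurable_collisionBound F (D j) a T hT)
    (measurable_decoderView (Z := Z) (X := X) (Y := Y) (D j) j)

theorem measurable_decodingBound (j : J) (T : Set (Y j × (∀ s : D j, Z s)))
    (hT : MeasurableSet T) :
    Measurable (decodingBound (M := M) A D μ W V F a j T) :=
  Measurable.const_add (Measurable.lintegral_prod_right'
    (measurable_collisionBound_decoderView D F a j T hT)) _

theorem lintegral_samplingError_le_decodingBound (j : J) (T : Set (Y j × (∀ s : D j, Z s)))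
    (hT : MeasurableSet T) (h : ∀ s, (Z s → C s) × (Z s → M s)) :
    ∫⁻ ω, samplingError (D j) (posterior A D μ W V j) (fun s => (h s).1) (ω.2.2 j)
        ((D j).restrict ω.1) ∂jointLaw A μ W V ≤ decodingBound A D μ W V F a j T h := by
  classical
  have hcoll : Measurable fun t : Y j × (∀ s : D j, Z s) =>
      collisionBound F (D j) a T h t.1 t.2 := by
    exact measurable_comp_prodMk_left (φ := fun t : ((∀ s, (Z s → C s) × (Z s → M s)) × Y j) ×
      (∀ s : D j, Z s) => collisionBound F (D j) a T t.1.1 t.1.2 t.2)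
      (measurable_collisionBound F (D j) a T hT) h
  have hind : Measurable (Tᶜ.indicator fun _ => (2 : ℝ≥0∞)) :=
    measurable_const.indicator hT.compl
  have h1 : decodingBound A D μ W V F a j T h =
      ∫⁻ ω, (Tᶜ.indicator (fun _ => (2 : ℝ≥0∞)) (ω.2.2 j, (D j).restrict ω.1) +
        collisionBound F (D j) a T h (ω.2.2 j) ((D j).restrict ω.1)) ∂jointLaw A μ W V := by
    rw [lintegral_add_left (f := fun ω : (∀ s, Z s) × (∀ i, X i) × (∀ j, Y j) =>
      Tᶜ.indicator (fun _ => (2 : ℝ≥0∞)) (ω.2.2 j, (D j).restrict ω.1))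
      (hind.comp (measurable_decoderView (D j) j))]
    have h2 : (fun ω : (∀ s, Z s) × (∀ i, X i) × (∀ j, Y j) =>
        Tᶜ.indicator (fun _ => (2 : ℝ≥0∞)) (ω.2.2 j, (D j).restrict ω.1)) =
        {ω | decoderView (D j) j ω ∉ T}.indicator fun _ => 2 := rfl
    have hset : MeasurableSet {ω : (∀ s, Z s) × (∀ i, X i) × (∀ j, Y j) |
        decoderView (D j) j ω ∉ T} := measurable_decoderView (D j) j hT.compl
    rw [h2, lintegral_indicator_const hset]
    rfl
  rw [h1, lintegral_jointLaw_posterior A D μ W V j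
    (fun t => samplingError (D j) (posterior A D μ W V j) (fun s => (h s).1) t.1 t.2)
    (measurable_samplingError _ _ _),
    lintegral_jointLaw_posterior A D μ W V j
    (fun t => Tᶜ.indicator (fun _ => (2 : ℝ≥0∞)) t + collisionBound F (D j) a T h t.1 t.2)
    (hind.add hcoll)]
  refine lintegral_mono fun y => ?_
  refine (tsum_posterior_error_le (fun w => posterior A D μ W V j y {w})
    (tsum_measure_singleton _) (hashVector (D j) fun s => (h s).1) {w | (y, w) ∈ T}
    (fun z => collisionBound F (D j) a T h y z) ?_).trans_eq ?_
  · rintro z - ⟨w, hw, hne, heq⟩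
    exact one_le_collisionBound F (D j) a T h y z w hw hne heq
  · rw [← ENNReal.tsum_mul_left, ← ENNReal.tsum_add]
    refine tsum_congr fun w => ?_
    rw [mul_add]
    congr 1
    by_cases hw : (y, w) ∈ T
    · rw [Set.indicator_of_notMem (show w ∉ {w | (y, w) ∈ T}ᶜ from fun h => h hw),
        Set.indicator_of_notMem (show (y, w) ∉ Tᶜ from fun h => h hw), mul_zero, mul_zero]
    · rw [Set.indicator_of_mem (show w ∈ {w | (y, w) ∈ T}ᶜ from hw),
        Set.indicator_of_mem (show (y, w) ∈ Tᶜ from hw), mul_comm]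

theorem lintegral_decodingBound_le (G : ∀ s, Ensemble (Z s) (M s))
    (hF : ∀ s, (F s).im = Set.univ) (b : S → ℝ≥0) (hFh : ∀ s, (F s).IsHash (a s) (b s)) (j : J)
    (T : Set (Y j × (∀ s : D j, Z s))) (hT : MeasurableSet T) (N : Finset (D j) → ℝ≥0∞)
    (hN : ∀ y, ∀ z : ∀ s : D j, Z s, ∀ O : Finset (D j), O.Nonempty → ∑' w,
      {w | (y, w) ∈ T ∧ ∀ i ∉ O, w i = z i}.indicator (fun _ => (1 : ℝ≥0∞)) w ≤ N O) :
    ∫⁻ h, decodingBound A D μ W V F a j T h ∂codeLaw F G ≤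
      2 * jointLaw A μ W V {ω | decoderView (D j) j ω ∉ T} + (∑ s : D j, (b s : ℝ≥0∞) +
        ∑ O ∈ Finset.univ.filter fun O : Finset (D j) => O.Nonempty,
          N O * ∏ s ∈ O, ((a s : ℝ≥0∞) / (Fintype.card (C s) : ℝ≥0∞))) := by
  unfold decodingBound
  rw [lintegral_add_left measurable_const, lintegral_const, measure_univ, mul_one,
    lintegral_lintegral_swap (measurable_collisionBound_decoderView D F a j T hT).aemeasurable]
  refine add_le_add le_rfl ((lintegral_mono fun ω => lintegral_collisionBound_le F G hF (D j) a b
    hFh T N _ _ fun O hO => hN _ _ O hO).trans_eq ?_)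
  rw [lintegral_const, measure_univ, mul_one]

/-- For given functions `f_s` and `g_s`, some vector `c` has an error probability of at most the sum
of the deficits of the encoding steps and the error probabilities of the decoders. -/
theorem exists_errorProb_le (L : List (Finset I)) (hL : IsReverseLinearExtension A L)
    (hμ : IsConsistent A μ) (f : ∀ s, Z s → C s) (g : ∀ s, Z s → M s) :
    ∃ c, errorProb A L D μ W V f g c ≤
      ∑ j, ∫⁻ ω, samplingError (D j) (posterior A D μ W V j) f (ω.2.2 j)
        ((D j).restrict ω.1) ∂jointLaw A μ W V +
      ∑ I' ∈ accessFamily A, ∑' z, μ {z} * (1 - stepDensity A μ f g I' z) := by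
  classical
  set K : ℝ≥0∞ := ∑ j, ∫⁻ ω, samplingError (D j) (posterior A D μ W V j) f (ω.2.2 j)
        ((D j).restrict ω.1) ∂jointLaw A μ W V +
      ∑ I' ∈ accessFamily A, ∑' z, μ {z} * (1 - stepDensity A μ f g I' z) with hK
  let E : (∀ s, C s) → (∀ s, M s) → Option (∀ s, Z s) → ℝ≥0∞ := fun c m o =>
    o.elim 1 fun z => ∫⁻ x, ∫⁻ y, mismatchProb A D μ W V f g c m y ∂(V x) ∂(inputKernel A W z)
  have hE : ∀ c m o, E c m o ≤ 1 := by
    rintro c m (_ | z)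
    · exact le_rfl
    · calc E c m (some z) ≤ ∫⁻ x, ∫⁻ y, 1 ∂(V x) ∂(inputKernel A W z) :=
            lintegral_mono fun x => lintegral_mono fun y => mismatchProb_le_one A D μ W V f g c m y
        _ = 1 := by simp
  have herr : ∀ c, errorProb A L D μ W V f g c =
      ∑ m : ∀ s, M s, (∏ s, (Fintype.card (M s) : ℝ≥0∞)⁻¹) *
        ∑' o, encoderRun A μ f g c m L (fun _ => Classical.arbitrary _) o * E c m o := by
    intro c
    unfold errorProb
    refine Finset.sum_congr rfl fun m _ => ?_
    congr 1
    refine tsum_congr fun o => ?_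
    cases o <;> rfl
  have hmeas : ∀ j, Measurable fun ω : (∀ s, Z s) × (∀ i, X i) × (∀ j, Y j) =>
      samplingError (D j) (posterior A D μ W V j) f (ω.2.2 j) ((D j).restrict ω.1) := fun j =>
    (measurable_samplingError (D j) (posterior A D μ W V j) f).comp
      (measurable_decoderView (D j) j)
  have hsum : ∑ c : ∀ s, C s, (∏ s, (Fintype.card (C s) : ℝ≥0∞)⁻¹) *
      errorProb A L D μ W V f g c ≤ K := by
    simp_rw [herr]
    refine (sum_encoderRun_mul_le A L hL μ hμ f g _ E hE).trans ?_
    rw [hK, ← lintegral_finsetSum _ fun j _ => hmeas j,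
      lintegral_jointLaw A μ W V _ (Finset.measurable_sum _ fun j _ => hmeas j)]
    refine add_le_add (ENNReal.tsum_le_tsum fun z => mul_le_mul' le_rfl ?_) le_rfl
    exact lintegral_mono fun x => lintegral_mono fun y => mismatchProb_le A D μ W V f g z y
  -- The uniform average over `c` is at most `K`, so not every `c` can exceed `K`.
  by_contra! hcon
  have hu := card_pi_mul_prod_card_inv (X := C)
  set u : ℝ≥0∞ := ∏ s, (Fintype.card (C s) : ℝ≥0∞)⁻¹ with hu_def
  have hu0 : u ≠ 0 := fun h0 => by rw [h0, mul_zero] at hu; exact zero_ne_one hu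
  have hutop : u ≠ ∞ := ENNReal.prod_ne_top fun s _ => by simp
  have hlt : ∑ _c : ∀ s, C s, u * K < ∑ c : ∀ s, C s, u * errorProb A L D μ W V f g c :=
    ENNReal.sum_lt_sum_of_nonempty Finset.univ_nonempty fun c _ =>
      (ENNReal.mul_lt_mul_iff_right hu0 hutop).2 (hcon c)
  rw [Finset.sum_const, Finset.card_univ, nsmul_eq_mul, ← mul_assoc, hu, one_mul] at hlt
  exact absurd hsum (not_le.2 hlt)

/-- The random coding bound. -/
theorem exists_code_le (L : List (Finset I)) (hL : IsReverseLinearExtension A L)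
    (hμ : IsConsistent A μ) (G : ∀ s, Ensemble (Z s) (M s))
    (hF : ∀ s, (F s).im = Set.univ) (hG : ∀ s, (G s).im = Set.univ)
    (b a' b' : S → ℝ≥0) (hFh : ∀ s, (F s).IsHash (a s) (b s))
    (hGh : ∀ s, (G s).IsHash (a' s) (b' s)) (η : ℝ≥0∞) (hη : η ≠ ∞)
    (B : ∀ I', Finset (privateMessages A I') → ℝ≥0∞)
    (T : ∀ j, Set (Y j × (∀ s : D j, Z s))) (hT : ∀ j, MeasurableSet (T j))
    (N : ∀ j, Finset (D j) → ℝ≥0∞)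
    (hN : ∀ j y, ∀ z : ∀ s : D j, Z s, ∀ O : Finset (D j), O.Nonempty → ∑' w,
      {w | (y, w) ∈ T j ∧ ∀ i ∉ O, w i = z i}.indicator (fun _ => (1 : ℝ≥0∞)) w ≤ N j O) :
    ∃ (f : ∀ s, Z s → C s) (g : ∀ s, Z s → M s) (c : ∀ s, C s),
      (∀ s, f s ∈ (F s).funs) ∧ (∀ s, g s ∈ (G s).funs) ∧
      4 * η * errorProb A L D μ W V f g c + ∑ _I' ∈ accessFamily A, 2 ≤
        4 * η * ∑ j, (2 * jointLaw A μ W V {ω | decoderView (D j) j ω ∉ T j} +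
          (∑ s : D j, (b s : ℝ≥0∞) +
          ∑ O ∈ Finset.univ.filter fun O : Finset (D j) => O.Nonempty,
            N j O * ∏ s ∈ O, ((a s : ℝ≥0∞) / (Fintype.card (C s) : ℝ≥0∞)))) +
        ∑ I' ∈ accessFamily A, (4 * η ^ 2 + 1 +
          (Fintype.card (∀ s : privateMessages A I', C s × M s) : ℝ≥0∞) *
          ∑ O : Finset (privateMessages A I'),
            (∏ s ∈ Oᶜ, ((a s : ℝ≥0∞) / (Fintype.card (C s) : ℝ≥0∞) *
              (a' s / (Fintype.card (M s) : ℝ≥0∞)))) *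
            ((∏ s ∈ O, (1 + ((b s : ℝ≥0∞) + b' s))) * B I' O) +
          (2 + 4 * η) * μ {z | (privateMessages A I').restrict z ∉
            condTypical μ (privateMessages A I') (publicMessages A I') (B I')
              ((publicMessages A I').restrict z)}) := by
  classical
  have hm1 : ∀ j, Measurable (decodingBound (M := M) A D μ W V F a j (T j)) := fun j =>
    measurable_decodingBound A D μ W V F a j (T j) (hT j)
  have hm2 : ∀ I', Measurable (deficitBound (C := C) (M := M) μ (privateMessages A I')
      (publicMessages A I') (B I') η) := fun I' => measurable_deficitBound _ _ _ _ _
  have hmS1 : Measurable fun h : ∀ s, (Z s → C s) × (Z s → M s) =>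
      ∑ j, decodingBound A D μ W V F a j (T j) h := Finset.measurable_sum _ fun j _ => hm1 j
  have hmS2 : Measurable fun h : ∀ s, (Z s → C s) × (Z s → M s) =>
      ∑ I' ∈ accessFamily A, deficitBound μ (privateMessages A I') (publicMessages A I') (B I') η h :=
    Finset.measurable_sum _ fun I' _ => hm2 I'
  -- All decoders and all encoding steps are put into one sum, so that a single choice of functions
  -- serves them together; it is taken outside the null set of functions not in the ensembles.
  obtain ⟨h, hmem, hle⟩ := exists_notMem_null_le_lintegral (μ := codeLaw F G)
    (f := fun h => 4 * η * ∑ j, decodingBound A D μ W V F a j (T j) h +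
      ∑ I' ∈ accessFamily A,
        deficitBound μ (privateMessages A I') (publicMessages A I') (B I') η h)
    ((hmS1.const_mul _).add hmS2).aemeasurable (ae_mem_funs F G)
  have hmem' : ∀ s, (h s).1 ∈ (F s).funs ∧ (h s).2 ∈ (G s).funs := by
    by_contra hcon
    exact hmem hcon
  obtain ⟨c, hc⟩ := exists_errorProb_le A D μ W V L hL hμ (fun s => (h s).1) (fun s => (h s).2)
  refine ⟨_, _, c, fun s => (hmem' s).1, fun s => (hmem' s).2, ?_⟩
  calc _ ≤ 4 * η * (∑ j, decodingBound A D μ W V F a j (T j) h +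
        ∑ I' ∈ accessFamily A, ∑' z, μ {z} *
          (1 - stepDensity A μ (fun s => (h s).1) (fun s => (h s).2) I' z)) +
          ∑ _I' ∈ accessFamily A, 2 := by
        gcongr
        refine hc.trans (add_le_add (Finset.sum_le_sum fun j _ => ?_) le_rfl)
        exact lintegral_samplingError_le_decodingBound A D μ W V F a j (T j) (hT j) h
    _ = 4 * η * ∑ j, decodingBound A D μ W V F a j (T j) h +
        ∑ I' ∈ accessFamily A, (4 * η * ∑' z, μ {z} *
          (1 - stepDensity A μ (fun s => (h s).1) (fun s => (h s).2) I' z) + 2) := by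
        rw [mul_add, Finset.sum_add_distrib, Finset.mul_sum (accessFamily A), add_assoc]
    _ ≤ 4 * η * ∑ j, decodingBound A D μ W V F a j (T j) h +
        ∑ I' ∈ accessFamily A,
          deficitBound μ (privateMessages A I') (publicMessages A I') (B I') η h := by
        refine add_le_add le_rfl (Finset.sum_le_sum fun I' _ => ?_)
        exact tsum_stepDensity_le_deficitBound A μ I' (B I') η hη h
    _ ≤ _ := hle
    _ ≤ _ := by
        rw [lintegral_add_right _ hmS2, lintegral_const_mul _ hmS1,
          lintegral_finsetSum _ fun j _ => hm1 j, lintegral_finsetSum _ fun I' _ => hm2 I']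
        refine add_le_add (mul_le_mul' le_rfl (Finset.sum_le_sum fun j _ => ?_))
          (Finset.sum_le_sum fun I' _ => ?_)
        · exact lintegral_decodingBound_le A D μ W V F a G hF b hFh j (T j) (hT j) (N j) (hN j)
        · exact lintegral_deficitBound_le μ _ _ (B I') η F G hF hG a b a' b' hFh hGh

end RandomCoding

/-! ### Typical sets -/

section Typical

/-- Needed because `Real.logb 2 (1 / 0) = 0`: where the conditional probability vanishes, the formal
information density is `0` instead of infinite. -/
theorem measure_condDistrib_singleton_eq_zero {Ω α β : Type*} [MeasurableSpace Ω]
    [MeasurableSpace α] [Countable α] [MeasurableSingletonClass α] [Nonempty α]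
    [MeasurableSpace β] (P : Measure Ω) [IsFiniteMeasure P] (U : Ω → α)
    (V : Ω → β) (hU : Measurable U) (hV : Measurable V) :
    P {ω | condDistrib U V P (V ω) {U ω} = 0} = 0 := by
  have hm : MeasurableSet {t : β × α | condDistrib U V P t.1 {t.2} = 0} := by
    have : Measurable fun t : β × α => condDistrib U V P t.1 {t.2} :=
      measurable_from_prod_countable_left fun u =>
        Kernel.measurable_coe _ (measurableSet_singleton u)
    exact this (measurableSet_singleton 0)
  have h1 : P {ω | condDistrib U V P (V ω) {U ω} = 0} =
      P.map (fun ω => (V ω, U ω)) {t : β × α | condDistrib U V P t.1 {t.2} = 0} :=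
    (Measure.map_apply (hV.prodMk hU) hm).symm
  rw [h1, ← compProd_map_condDistrib hU.aemeasurable, Measure.compProd_apply hm]
  refine (lintegral_congr fun v => ?_).trans lintegral_zero
  rw [measure_eq_tsum_indicator, ENNReal.tsum_eq_zero]
  intro u
  by_cases hu : u ∈ Prod.mk v ⁻¹' {t : β × α | condDistrib U V P t.1 {t.2} = 0}
  · rw [Set.indicator_of_mem hu]
    exact hu
  · exact Set.indicator_of_notMem hu _

variable {S I J : Type*} [Fintype S] [Fintype I] [Fintype J] [DecidableEq S] [DecidableEq I]
  {Z : S → Type*} {X : I → Type*} {Y : J → Type*}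
  [∀ s, MeasurableSpace (Z s)] [∀ s, Countable (Z s)] [∀ s, MeasurableSingletonClass (Z s)]
  [∀ s, Nonempty (Z s)] [∀ i, MeasurableSpace (X i)] [∀ j, MeasurableSpace (Y j)]

/-- The subset of `S` that corresponds to a subset of `T ⊆ S`. -/
def liftFinset (T : Finset S) (O : Finset T) : Finset S := O.map (Function.Embedding.subtype _)

theorem liftFinset_subset (T : Finset S) (O : Finset T) : liftFinset T O ⊆ T := by
  intro s hs
  obtain ⟨t, -, rfl⟩ := Finset.mem_map.1 hs
  exact t.2

theorem coe_mem_liftFinset {T : Finset S} {O : Finset T} {t : T} :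
    (t : S) ∈ liftFinset T O ↔ t ∈ O := by
  simp [liftFinset]

theorem liftFinset_nonempty {T : Finset S} {O : Finset T} (hO : O.Nonempty) :
    (liftFinset T O).Nonempty :=
  Finset.map_nonempty.2 hO

variable (A : Finset (S × I)) (μ : Measure (∀ s, Z s)) [IsProbabilityMeasure μ]
  (W : ∀ i, Kernel (∀ s : messagesOf A i, Z s) (X i)) [∀ i, IsMarkovKernel (W i)]
  (V : Kernel (∀ i, X i) (∀ j, Y j)) [IsMarkovKernel V]

theorem jointLaw_fst_preimage (B : Set (∀ s, Z s)) :
    jointLaw A μ W V (Prod.fst ⁻¹' B) = μ B := by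
  have h : (jointLaw A μ W V).fst = μ := Measure.fst_compProd _ _
  have hB : MeasurableSet B := (Set.to_countable B).measurableSet
  rw [← Measure.fst_apply hB, h]

theorem condDistrib_restrict_apply (T T' : Finset S) (ω : (∀ s, Z s) × (∀ i, X i) × (∀ j, Y j))
    (h0 : μ {z | T'.restrict z = T'.restrict ω.1} ≠ 0) :
    condDistrib (fun ω : (∀ s, Z s) × (∀ i, X i) × (∀ j, Y j) => T.restrict ω.1)
      (fun ω => T'.restrict ω.1) (jointLaw A μ W V) (T'.restrict ω.1) {T.restrict ω.1} =
      μ {z | T.restrict z = T.restrict ω.1 ∧ T'.restrict z = T'.restrict ω.1} /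
        μ {z | T'.restrict z = T'.restrict ω.1} := by
  have hT : ∀ T : Finset S, Measurable fun ω : (∀ s, Z s) × (∀ i, X i) × (∀ j, Y j) =>
      T.restrict ω.1 := fun T => (Finset.measurable_restrict T).comp measurable_fst
  have h1 : (jointLaw A μ W V).map (fun ω => T'.restrict ω.1) {T'.restrict ω.1} =
      μ {z | T'.restrict z = T'.restrict ω.1} := by
    rw [Measure.map_apply (hT T') (measurableSet_singleton _), ← jointLaw_fst_preimage A μ W V]
    rfl
  have h2 : (jointLaw A μ W V).map (fun ω => (T'.restrict ω.1, T.restrict ω.1))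
      ({T'.restrict ω.1} ×ˢ {T.restrict ω.1}) =
      μ {z | T.restrict z = T.restrict ω.1 ∧ T'.restrict z = T'.restrict ω.1} := by
    rw [Measure.map_apply ((hT T').prodMk (hT T))
      ((measurableSet_singleton _).prod (measurableSet_singleton _)),
      ← jointLaw_fst_preimage A μ W V]
    congr 1
    ext ω'
    exact and_comm
  rw [condDistrib_apply_of_ne_zero (hT T) _ (by rw [h1]; exact h0), h1, h2,
    ENNReal.div_eq_inv_mul]

/-- The empty set is never violated, since conditional weights sum to at most `1 ≤ B ∅`. Every other
violation is an event in the spectrum of the subvector on `O`. -/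
theorem measure_condTypical_compl_le (T T' : Finset S) (B : Finset T → ℝ≥0∞) (hB : 1 ≤ B ∅) :
    μ {z | T.restrict z ∉ condTypical μ T T' B (T'.restrict z)} ≤
      ∑ O ∈ Finset.univ.filter fun O : Finset T => O.Nonempty,
        jointLaw A μ W V {ω | B O <
          condDistrib (fun ω : (∀ s, Z s) × (∀ i, X i) × (∀ j, Y j) =>
            (liftFinset T O).restrict ω.1) (fun ω => T'.restrict ω.1) (jointLaw A μ W V)
            (T'.restrict ω.1) {(liftFinset T O).restrict ω.1}} := by
  classical
  rw [← jointLaw_fst_preimage A μ W V]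
  refine le_trans (measure_mono fun ω hω => ?_) (measure_biUnion_finset_le _ _)
  simp only [Set.mem_preimage, condTypical, Set.mem_ofPred_eq, not_forall, not_le] at hω
  obtain ⟨O, hO⟩ := hω
  rw [tsum_indicator_condWeight] at hO
  have hset : {z : ∀ s, Z s | T.restrict z ∈ {w' : ∀ s : T, Z s | ∀ i ∈ O, w' i =
      T.restrict ω.1 i} ∧ T'.restrict z = T'.restrict ω.1} =
      {z | (liftFinset T O).restrict z = (liftFinset T O).restrict ω.1 ∧
        T'.restrict z = T'.restrict ω.1} := by
    ext z
    refine and_congr ⟨fun h => ?_, fun h i hi => ?_⟩ Iff.rfl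
    · funext ⟨s, hs⟩
      exact h ⟨s, liftFinset_subset T O hs⟩ (coe_mem_liftFinset.1 hs)
    · exact congrFun h ⟨i, coe_mem_liftFinset.2 hi⟩
  rw [hset] at hO
  -- A violation rules out a null condition: the quotient would be `0 / 0 = 0`, which exceeds
  -- nothing.
  have h0 : μ {z | T'.restrict z = T'.restrict ω.1} ≠ 0 := by
    intro h0
    have h1 : μ {z | (liftFinset T O).restrict z = (liftFinset T O).restrict ω.1 ∧
        T'.restrict z = T'.restrict ω.1} = 0 := measure_mono_null (fun z hz => hz.2) h0
    rw [h1, ENNReal.zero_div] at hO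
    exact not_lt_zero hO
  have hne : O.Nonempty := by
    rw [Finset.nonempty_iff_ne_empty]
    rintro rfl
    refine absurd (hO.trans_le ?_) (not_lt.2 hB)
    exact (ENNReal.div_le_div_right (measure_mono fun z hz => hz.2) _).trans
      ENNReal.div_self_le_one
  refine Set.mem_biUnion (show O ∈ (Finset.univ.filter fun O : Finset T => O.Nonempty) by
    simpa using hne) ?_
  rw [Set.mem_ofPred_eq, condDistrib_restrict_apply A μ W V (liftFinset T O) T' ω h0]
  exact hO

/-- The conditional law of the part `O` of the messages in `D`, given `Y_j` and the other messages in
`D`. -/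
def partialPosterior (D : Finset S) (j : J) (O : Finset D) :
    Kernel (Y j × (∀ s : (D \ liftFinset D O : Finset S), Z s)) (∀ s : liftFinset D O, Z s) :=
  condDistrib (fun ω : (∀ s, Z s) × (∀ i, X i) × (∀ j, Y j) => (liftFinset D O).restrict ω.1)
    (fun ω => (ω.2.2 j, (D \ liftFinset D O).restrict ω.1)) (jointLaw A μ W V)

instance (D : Finset S) (j : J) (O : Finset D) :
    IsMarkovKernel (partialPosterior A μ W V D j O) := by
  unfold partialPosterior; infer_instance

/-- The pairs `(y, w)` such that all parts of `w` have large conditional probabilities, given `y` and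
the rest of `w`. -/
def posteriorTypical (D : Finset S) (j : J) (N : Finset D → ℝ≥0∞) :
    Set (Y j × (∀ s : D, Z s)) :=
  {t | ∀ O : Finset D, O.Nonempty → (N O)⁻¹ ≤ partialPosterior A μ W V D j O
    (t.1, Finset.restrict₂ Finset.sdiff_subset t.2)
    {Finset.restrict₂ (liftFinset_subset D O) t.2}}

theorem measurableSet_posteriorTypical (D : Finset S) (j : J) (N : Finset D → ℝ≥0∞) :
    MeasurableSet (posteriorTypical A μ W V D j N) := by
  refine measurableSet_setOfPred.2 (Measurable.forall fun O => Measurable.forall fun _ => ?_)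
  have h1 : Measurable fun t : Y j × (∀ s : D, Z s) => partialPosterior A μ W V D j O
      (t.1, Finset.restrict₂ Finset.sdiff_subset t.2)
      {Finset.restrict₂ (liftFinset_subset D O) t.2} := by
    refine measurable_from_prod_countable_left fun w => ?_
    have h2 := Kernel.measurable_coe (partialPosterior A μ W V D j O)
      (measurableSet_singleton (Finset.restrict₂ (π := Z) (liftFinset_subset D O) w))
    have h3 : Measurable fun y : Y j => (y, Finset.restrict₂ (π := Z)
        (Finset.sdiff_subset (s := D) (t := liftFinset D O)) w) :=
      measurable_id.prodMk measurable_const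
    exact h2.comp h3
  exact measurableSet_setOfPred.1 (measurableSet_le measurable_const h1)

/-- With `y` and the coordinates outside `O` fixed, distinct vectors have distinct parts on `O`, and
each part has probability at least `(N O)⁻¹` under one and the same probability law. So there are at
most `N O` of them. -/
theorem tsum_posteriorTypical_le (D : Finset S) (j : J) (N : Finset D → ℝ≥0∞)
    (hN0 : ∀ O, N O ≠ 0) (hN : ∀ O, N O ≠ ∞) (y : Y j) (z : ∀ s : D, Z s) (O : Finset D)
    (hO : O.Nonempty) :
    ∑' w, {w | (y, w) ∈ posteriorTypical A μ W V D j N ∧ ∀ i ∉ O, w i = z i}.indicator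
      (fun _ => (1 : ℝ≥0∞)) w ≤ N O := by
  classical
  set κ := partialPosterior A μ W V D j O (y, Finset.restrict₂ Finset.sdiff_subset z) with hκ
  have h1 : ∀ w, {w | (y, w) ∈ posteriorTypical A μ W V D j N ∧ ∀ i ∉ O, w i = z i}.indicator
      (fun _ => (1 : ℝ≥0∞)) w ≤ N O * {w : ∀ s : D, Z s | ∀ i ∉ O, w i = z i}.indicator
        (fun w => κ {Finset.restrict₂ (liftFinset_subset D O) w}) w := by
    intro w
    refine Set.indicator_apply_le' (fun hw => ?_) fun _ => zero_le
    rw [Set.indicator_of_mem (show w ∈ {w : ∀ s : D, Z s | ∀ i ∉ O, w i = z i} from hw.2)]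
    have h2 := hw.1 O hO
    have h3 : Finset.restrict₂ (π := Z) (Finset.sdiff_subset (s := D) (t := liftFinset D O)) w =
        Finset.restrict₂ Finset.sdiff_subset z := by
      funext ⟨s, hs⟩
      exact hw.2 ⟨s, (Finset.mem_sdiff.1 hs).1⟩ fun h => (Finset.mem_sdiff.1 hs).2
        (coe_mem_liftFinset.2 h)
    rw [← ENNReal.mul_inv_cancel (hN0 O) (hN O)]
    refine mul_le_mul' le_rfl (h2.trans_eq ?_)
    simp only [hκ, ← h3]
  refine (ENNReal.tsum_le_tsum h1).trans ?_
  rw [ENNReal.tsum_mul_left]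
  refine mul_le_of_le_one_right zero_le ?_
  rw [← tsum_subtype]
  refine (ENNReal.tsum_comp_le_tsum_of_injective (f := fun w : {w : ∀ s : D, Z s | ∀ i ∉ O,
    w i = z i} => Finset.restrict₂ (π := Z) (liftFinset_subset D O) w.1) ?_
    fun u => κ {u}).trans_eq (tsum_measure_singleton κ)
  rintro ⟨w, hw⟩ ⟨w', hw'⟩ h
  refine Subtype.ext (funext fun i => ?_)
  by_cases hi : i ∈ O
  · exact congrFun h ⟨i, coe_mem_liftFinset.2 hi⟩
  · exact (hw i hi).trans (hw' i hi).symm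

theorem measure_posteriorTypical_compl_le (D : Finset S) (j : J) (N : Finset D → ℝ≥0∞) :
    jointLaw A μ W V {ω | decoderView D j ω ∉ posteriorTypical A μ W V D j N} ≤
      ∑ O ∈ Finset.univ.filter fun O : Finset D => O.Nonempty,
        jointLaw A μ W V {ω |
          condDistrib (fun ω : (∀ s, Z s) × (∀ i, X i) × (∀ j, Y j) =>
            (liftFinset D O).restrict ω.1)
            (fun ω => (ω.2.2 j, (D \ liftFinset D O).restrict ω.1)) (jointLaw A μ W V)
            (ω.2.2 j, (D \ liftFinset D O).restrict ω.1) {(liftFinset D O).restrict ω.1} <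
            (N O)⁻¹} := by
  classical
  refine le_trans (measure_mono fun ω hω => ?_) (measure_biUnion_finset_le _ _)
  simp only [posteriorTypical, Set.mem_ofPred_eq, not_forall, not_le] at hω
  obtain ⟨O, hO, hlt⟩ := hω
  exact Set.mem_biUnion (show O ∈ (Finset.univ.filter fun O : Finset D => O.Nonempty) by
    simpa using hO) hlt

end Typical

/-! ### Information densities and spectral entropy rates -/

section Spectral

theorem lt_of_lt_measureReal {n : ℕ} (hn : 0 < n) {θ p : ℝ}
    (h : (2 : ℝ) ^ (-(n * θ)) < p) : (1 / (n : ℝ)) * Real.logb 2 (1 / p) < θ := by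
  have hp : 0 < p := lt_trans (Real.rpow_pos_of_pos two_pos _) h
  have hn' : (0 : ℝ) < n := by exact_mod_cast hn
  rw [one_div, one_div, Real.logb_inv, inv_mul_lt_iff₀ hn']
  have := (Real.lt_logb_iff_rpow_lt one_lt_two hp).2 h
  linarith

theorem lt_of_measureReal_lt {n : ℕ} (hn : 0 < n) {θ p : ℝ} (hp : 0 < p)
    (h : p < (2 : ℝ) ^ (-(n * θ))) : θ < (1 / (n : ℝ)) * Real.logb 2 (1 / p) := by
  have hn' : (0 : ℝ) < n := by exact_mod_cast hn
  rw [one_div, one_div, Real.logb_inv, lt_inv_mul_iff₀ hn']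
  have := (Real.logb_lt_iff_lt_rpow one_lt_two hp).2 h
  linarith

variable {Ω α β : ℕ → Type*} [∀ n, MeasurableSpace (Ω n)]
  [∀ n, MeasurableSpace (α n)] [∀ n, Countable (α n)] [∀ n, MeasurableSingletonClass (α n)]
  [∀ n, Nonempty (α n)] [∀ n, MeasurableSpace (β n)]

/-- A real `θ` strictly between `x` and an admissible level leaves room in the exponent. The case of
conditional probability `0` does not arise, because here it exceeds `2 ^ (-(n * θ))`. -/
theorem exists_tendsto_of_lt_spectralInf (P : ∀ n, Measure (Ω n)) [∀ n, IsFiniteMeasure (P n)]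
    (U : ∀ n, Ω n → α n) (V : ∀ n, Ω n → β n) {x : ℝ} (hx : (x : EReal) < spectralInf P U V) :
    ∃ θ : ℝ, x < θ ∧ Tendsto (fun n : ℕ => P n {ω | ENNReal.ofReal ((2 : ℝ) ^ (-(n * θ))) <
      condDistrib (U n) (V n) (P n) (V n ω) {U n ω}}) atTop (𝓝 0) := by
  obtain ⟨θ', hθ', hlt⟩ := lt_sSup_iff.1 hx
  obtain ⟨θ, h1, h2⟩ := EReal.lt_iff_exists_real_btwn.1 hlt
  refine ⟨θ, by exact_mod_cast h1, ?_⟩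
  refine tendsto_of_tendsto_of_tendsto_of_le_of_le' tendsto_const_nhds hθ'
    (Eventually.of_forall fun _ => zero_le) ?_
  filter_upwards [eventually_gt_atTop 0] with n hn
  refine measure_mono fun ω hω => ?_
  have h3 : (2 : ℝ) ^ (-(n * θ)) < (condDistrib (U n) (V n) (P n) (V n ω)).real {U n ω} :=
    (ENNReal.ofReal_lt_iff_lt_toReal (by positivity) (measure_ne_top _ _)).1 hω
  have h4 : condInformation P U V n ω < θ := lt_of_lt_measureReal hn h3
  exact lt_trans (by exact_mod_cast h4) h2

theorem exists_tendsto_of_spectralSup_lt (P : ∀ n, Measure (Ω n)) [∀ n, IsFiniteMeasure (P n)]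
    (U : ∀ n, Ω n → α n) (V : ∀ n, Ω n → β n) (hU : ∀ n, Measurable (U n))
    (hV : ∀ n, Measurable (V n)) {x : ℝ} (hx : spectralSup P U V < (x : EReal)) :
    ∃ θ : ℝ, θ < x ∧ Tendsto (fun n : ℕ => P n {ω | condDistrib (U n) (V n) (P n) (V n ω) {U n ω} <
      (ENNReal.ofReal ((2 : ℝ) ^ (n * θ)))⁻¹}) atTop (𝓝 0) := by
  obtain ⟨θ', hθ', hlt⟩ := sInf_lt_iff.1 hx
  obtain ⟨θ, h1, h2⟩ := EReal.lt_iff_exists_real_btwn.1 hlt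
  refine ⟨θ, by exact_mod_cast h2, ?_⟩
  refine tendsto_of_tendsto_of_tendsto_of_le_of_le' tendsto_const_nhds hθ'
    (Eventually.of_forall fun _ => zero_le) ?_
  filter_upwards [eventually_gt_atTop 0] with n hn
  -- Points of conditional probability `0` satisfy the upper bound on the probability but not the
  -- lower bound on the formal information density; they form a null set that is added separately.
  have hle : P n ({ω | θ' < (condInformation P U V n ω : EReal)} ∪
      {ω | condDistrib (U n) (V n) (P n) (V n ω) {U n ω} = 0}) ≤
      P n {ω | θ' < (condInformation P U V n ω : EReal)} := by
    refine (measure_union_le _ _).trans_eq ?_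
    rw [measure_condDistrib_singleton_eq_zero (P n) (U n) (V n) (hU n) (hV n), add_zero]
  refine le_trans (measure_mono fun ω hω => ?_) hle
  by_cases h0 : condDistrib (U n) (V n) (P n) (V n ω) {U n ω} = 0
  · exact Or.inr h0
  left
  have h3 : (condDistrib (U n) (V n) (P n) (V n ω)).real {U n ω} < (2 : ℝ) ^ (-(n * θ)) := by
    rw [Set.mem_ofPred_eq, ← ENNReal.ofReal_inv_of_pos (by positivity),
      ← Real.rpow_neg two_pos.le] at hω
    exact (ENNReal.lt_ofReal_iff_toReal_lt (measure_ne_top _ _)).1 hω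
  have h4 : θ < condInformation P U V n ω := lt_of_measureReal_lt hn
    (ENNReal.toReal_pos h0 (measure_ne_top _ _)) h3
  exact lt_trans h1 (by exact_mod_cast h4)

end Spectral

/-! ### Rates -/

section Rates

theorem tendsto_ofReal_two_rpow_mul {x : ℕ → ℝ} {l : ℝ} (hx : Tendsto x atTop (𝓝 l)) (hl : l < 0) :
    Tendsto (fun n : ℕ => ENNReal.ofReal ((2 : ℝ) ^ ((n : ℝ) * x n))) atTop (𝓝 0) := by
  have h1 : Tendsto (fun n : ℕ => (n : ℝ) * x n) atTop atBot :=
    tendsto_natCast_atTop_atTop.atTop_mul_neg hl hx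
  have h2 : Tendsto (fun n : ℕ => (2 : ℝ) ^ ((n : ℝ) * x n)) atTop (𝓝 0) :=
    (tendsto_rpow_atBot_of_base_gt_one 2 one_lt_two).comp h1
  simpa using ENNReal.tendsto_ofReal h2

variable {ι : Type*} (O : Finset ι) (K : ℕ → ι → ℕ) (ρ : ι → ℝ)

theorem natCast_eq_ofReal_two_rpow {n k : ℕ} (hn : 0 < n) (hk : 0 < k) :
    (k : ℝ≥0∞) = ENNReal.ofReal ((2 : ℝ) ^ ((n : ℝ) * (Real.logb 2 k / n))) := by
  have hn' : (n : ℝ) ≠ 0 := by exact_mod_cast hn.ne'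
  have hk' : (0 : ℝ) < k := by exact_mod_cast hk
  rw [mul_div_cancel₀ _ hn', Real.rpow_logb two_pos (by norm_num) hk', ENNReal.ofReal_natCast]

theorem tendsto_prod_card_mul (hK : ∀ n, ∀ i ∈ O, 0 < K n i)
    (hρ : ∀ i ∈ O, Tendsto (fun n : ℕ => Real.logb 2 (K n i) / n) atTop (𝓝 (ρ i))) {θ : ℝ}
    (hθ : ∑ i ∈ O, ρ i < θ) :
    Tendsto (fun n : ℕ => (∏ i ∈ O, (K n i : ℝ≥0∞)) * ENNReal.ofReal ((2 : ℝ) ^ (-((n : ℝ) * θ))))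
      atTop (𝓝 0) := by
  have h1 : Tendsto (fun n : ℕ => ∑ i ∈ O, Real.logb 2 (K n i) / n - θ) atTop
      (𝓝 (∑ i ∈ O, ρ i - θ)) := (tendsto_finsetSum _ hρ).sub_const θ
  refine (tendsto_ofReal_two_rpow_mul h1 (by linarith)).congr' ?_
  filter_upwards [eventually_gt_atTop 0] with n hn
  rw [Finset.prod_congr rfl fun i hi => natCast_eq_ofReal_two_rpow hn (hK n i hi),
    ← ENNReal.ofReal_prod_of_nonneg fun i _ => by positivity,
    ← Real.rpow_sum_of_pos two_pos, ← ENNReal.ofReal_mul (by positivity),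
    ← Real.rpow_add two_pos, ← Finset.mul_sum]
  congr 2
  ring

theorem tendsto_mul_prod_inv_card (hK : ∀ n, ∀ i ∈ O, 0 < K n i)
    (hρ : ∀ i ∈ O, Tendsto (fun n : ℕ => Real.logb 2 (K n i) / n) atTop (𝓝 (ρ i))) {θ : ℝ}
    (hθ : θ < ∑ i ∈ O, ρ i) :
    Tendsto (fun n : ℕ => ENNReal.ofReal ((2 : ℝ) ^ ((n : ℝ) * θ)) * ∏ i ∈ O, (K n i : ℝ≥0∞)⁻¹)
      atTop (𝓝 0) := by
  have h1 : Tendsto (fun n : ℕ => θ - ∑ i ∈ O, Real.logb 2 (K n i) / n) atTop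
      (𝓝 (θ - ∑ i ∈ O, ρ i)) := (tendsto_finsetSum _ hρ).const_sub θ
  refine (tendsto_ofReal_two_rpow_mul h1 (by linarith)).congr' ?_
  filter_upwards [eventually_gt_atTop 0] with n hn
  have h2 : ∀ i ∈ O, (K n i : ℝ≥0∞)⁻¹ =
      ENNReal.ofReal ((2 : ℝ) ^ (-((n : ℝ) * (Real.logb 2 (K n i) / n)))) := fun i hi => by
    rw [natCast_eq_ofReal_two_rpow hn (hK n i hi), ← ENNReal.ofReal_inv_of_pos (by positivity),
      ← Real.rpow_neg two_pos.le]
  rw [Finset.prod_congr rfl h2, ← ENNReal.ofReal_prod_of_nonneg fun i _ => by positivity,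
    ← Real.rpow_sum_of_pos two_pos, ← ENNReal.ofReal_mul (by positivity),
    ← Real.rpow_add two_pos, Finset.sum_neg_distrib, ← Finset.mul_sum]
  congr 2
  ring

theorem tendsto_prod_coe {a : ℕ → ι → ℝ≥0} {l : ι → ℝ≥0}
    (ha : ∀ i ∈ O, Tendsto (fun n => a n i) atTop (𝓝 (l i))) :
    Tendsto (fun n => ∏ i ∈ O, (a n i : ℝ≥0∞)) atTop (𝓝 (∏ i ∈ O, (l i : ℝ≥0∞))) := by
  simp_rw [← ENNReal.ofNNReal_finsetProd]
  exact ENNReal.tendsto_coe.2 (tendsto_finsetProd _ ha)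

theorem tendsto_mul_zero_of_tendsto {x y : ℕ → ℝ≥0∞} {l : ℝ≥0∞} (hl : l ≠ ∞)
    (hx : Tendsto x atTop (𝓝 l)) (hy : Tendsto y atTop (𝓝 0)) :
    Tendsto (fun n => x n * y n) atTop (𝓝 0) := by
  simpa using ENNReal.Tendsto.mul hx (Or.inr ENNReal.zero_ne_top) hy (Or.inr hl)

/-- The prefactor cancels the cardinalities in the factors over `Oᶜ`, leaving those over `O` times
`2 ^ (-n θ O)`, which vanishes in the limit unless `O = ∅`. The term of the empty set tends to `1`.
-/
theorem tendsto_collisionSum {ι : Type*} [Fintype ι] [DecidableEq ι] {K K' : ℕ → ι → ℕ}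
    (hK : ∀ n i, 0 < K n i) (hK' : ∀ n i, 0 < K' n i) {ρ ρ' : ι → ℝ}
    (hρ : ∀ i, Tendsto (fun n : ℕ => Real.logb 2 (K n i) / n) atTop (𝓝 (ρ i)))
    (hρ' : ∀ i, Tendsto (fun n : ℕ => Real.logb 2 (K' n i) / n) atTop (𝓝 (ρ' i)))
    {a b a' b' : ℕ → ι → ℝ≥0} (ha : ∀ i, Tendsto (fun n => a n i) atTop (𝓝 1))
    (hb : ∀ i, Tendsto (fun n => b n i) atTop (𝓝 0))
    (ha' : ∀ i, Tendsto (fun n => a' n i) atTop (𝓝 1))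
    (hb' : ∀ i, Tendsto (fun n => b' n i) atTop (𝓝 0))
    {θ : Finset ι → ℝ} (hθ : ∀ O : Finset ι, O.Nonempty → ∑ i ∈ O, (ρ' i + ρ i) < θ O) :
    Tendsto (fun n : ℕ => ((∏ i, ((K n i : ℝ≥0∞) * (K' n i : ℝ≥0∞)))) * ∑ O : Finset ι,
      (∏ i ∈ Oᶜ, ((a n i : ℝ≥0∞) / (K n i : ℝ≥0∞) * (a' n i / (K' n i : ℝ≥0∞)))) *
        ((∏ i ∈ O, (1 + ((b n i : ℝ≥0∞) + b' n i))) *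
          (if O = ∅ then 1 else ENNReal.ofReal ((2 : ℝ) ^ (-((n : ℝ) * θ O)))))) atTop (𝓝 1) := by
  have hKne : ∀ n i, (K n i : ℝ≥0∞) ≠ 0 := fun n i => by exact_mod_cast (hK n i).ne'
  have hKne' : ∀ n i, (K' n i : ℝ≥0∞) ≠ 0 := fun n i => by exact_mod_cast (hK' n i).ne'
  have hA : ∀ O : Finset ι, Tendsto (fun n => ∏ i ∈ O, ((a n i * a' n i : ℝ≥0) : ℝ≥0∞)) atTop
      (𝓝 1) := fun O => by
    have := tendsto_prod_coe O (a := fun n i => a n i * a' n i) (l := fun _ => 1 * 1)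
      fun i _ => (ha i).mul (ha' i)
    simpa using this
  have hB : ∀ O : Finset ι, Tendsto (fun n => ∏ i ∈ O, ((1 + (b n i + b' n i) : ℝ≥0) : ℝ≥0∞)) atTop
      (𝓝 1) := fun O => by
    have := tendsto_prod_coe O (a := fun n i => 1 + (b n i + b' n i)) (l := fun _ => 1 + (0 + 0))
      fun i _ => ((hb i).add (hb' i)).const_add 1
    simpa using this
  have hterm : ∀ O : Finset ι, Tendsto (fun n : ℕ =>
      (∏ i ∈ Oᶜ, ((a n i * a' n i : ℝ≥0) : ℝ≥0∞)) *
        ((∏ i ∈ O, ((1 + (b n i + b' n i) : ℝ≥0) : ℝ≥0∞)) *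
          ((∏ i ∈ O, ((K n i * K' n i : ℕ) : ℝ≥0∞)) *
          (if O = ∅ then 1 else ENNReal.ofReal ((2 : ℝ) ^ (-((n : ℝ) * θ O)))))))
        atTop (𝓝 (if O = ∅ then 1 else 0)) := by
    intro O
    by_cases hO : O = ∅
    · subst hO
      simpa using hA Finset.univ
    · simp only [if_neg hO]
      refine tendsto_mul_zero_of_tendsto ENNReal.one_ne_top (hA _)
        (tendsto_mul_zero_of_tendsto ENNReal.one_ne_top (hB _) ?_)
      refine tendsto_prod_card_mul O (fun n i => K n i * K' n i) (fun i => ρ i + ρ' i)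
        (fun n i _ => Nat.mul_pos (hK n i) (hK' n i)) (fun i _ => ?_) ?_
      · refine ((hρ i).add (hρ' i)).congr fun n => ?_
        rw [Nat.cast_mul, Real.logb_mul (by exact_mod_cast (hK n i).ne')
          (by exact_mod_cast (hK' n i).ne'), add_div]
      · refine lt_of_eq_of_lt ?_ (hθ O (Finset.nonempty_iff_ne_empty.2 hO))
        exact Finset.sum_congr rfl fun i _ => add_comm _ _
  have hsum := tendsto_finsetSum Finset.univ fun O _ => hterm O
  rw [Finset.sum_ite_eq' Finset.univ ∅ (fun _ => (1 : ℝ≥0∞)), if_pos (Finset.mem_univ _)] at hsum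
  refine hsum.congr fun n => ?_
  rw [Finset.mul_sum]
  refine Finset.sum_congr rfl fun O _ => ?_
  rw [← Finset.prod_compl_mul_prod O fun i => (K n i : ℝ≥0∞) * (K' n i : ℝ≥0∞)]
  have h1 : ∏ i ∈ Oᶜ, ((a n i * a' n i : ℝ≥0) : ℝ≥0∞) =
      (∏ i ∈ Oᶜ, ((K n i : ℝ≥0∞) * (K' n i : ℝ≥0∞))) *
        ∏ i ∈ Oᶜ, ((a n i : ℝ≥0∞) / (K n i : ℝ≥0∞) * (a' n i / (K' n i : ℝ≥0∞))) := by
    rw [← Finset.prod_mul_distrib]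
    refine Finset.prod_congr rfl fun i _ => ?_
    rw [ENNReal.coe_mul]
    calc (a n i : ℝ≥0∞) * a' n i = (K n i * (a n i / (K n i : ℝ≥0∞))) *
          (K' n i * (a' n i / (K' n i : ℝ≥0∞))) := by
          rw [ENNReal.mul_div_cancel (hKne n i) (ENNReal.natCast_ne_top _),
            ENNReal.mul_div_cancel (hKne' n i) (ENNReal.natCast_ne_top _)]
      _ = _ := by ring
  rw [h1]
  push_cast
  ring

end Rates

/-! ### Random binning -/

section Binning

/-- The ensemble of all functions, with independent and uniform values. -/
def binningEnsemble (α γ : Type*) [Fintype γ] [Nonempty γ] [MeasurableSpace γ]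
    [MeasurableSingletonClass γ] : Ensemble α γ where
  funs := Set.univ
  law := Measure.infinitePi fun _ => (PMF.uniformOfFintype γ).toMeasure
  isProbabilityMeasure := inferInstance
  ae_mem := Eventually.of_forall fun _ => Set.mem_univ _

variable {α γ : Type*} [Fintype γ] [Nonempty γ] [MeasurableSpace γ] [MeasurableSingletonClass γ]

theorem binningEnsemble_im [Nonempty α] : (binningEnsemble α γ).im = Set.univ := by
  rw [Set.eq_univ_iff_forall]
  intro y
  exact Set.mem_biUnion (Set.mem_univ fun _ => y) ⟨Classical.arbitrary α, rfl⟩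

/-- Each of the `|γ|` possible common values has probability `|γ|⁻¹ * |γ|⁻¹`, since the values at
two distinct points are independent and uniform. -/
theorem binningEnsemble_collision {x x' : α} (hne : x' ≠ x) :
    (binningEnsemble α γ).law {f | f x = f x'} ≤ (Fintype.card γ : ℝ≥0∞)⁻¹ := by
  classical
  have hset : {f : α → γ | f x = f x'} =
      ⋃ y ∈ (Finset.univ : Finset γ), Set.pi (({x, x'} : Finset α) : Set α) fun _ => {y} := by
    ext f
    simp [eq_comm]
  have hy : ∀ y : γ, (binningEnsemble α γ).law (Set.pi (({x, x'} : Finset α) : Set α) fun _ => {y}) =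
      (Fintype.card γ : ℝ≥0∞)⁻¹ * (Fintype.card γ : ℝ≥0∞)⁻¹ := by
    intro y
    have h1 : (binningEnsemble α γ).law (Set.pi (({x, x'} : Finset α) : Set α) fun _ => {y}) =
        ∏ _i ∈ ({x, x'} : Finset α), (PMF.uniformOfFintype γ).toMeasure {y} :=
      Measure.infinitePi_pi (fun _ : α => (PMF.uniformOfFintype γ).toMeasure)
        fun _ _ => measurableSet_singleton y
    rw [h1, Finset.prod_pair hne.symm,
      PMF.toMeasure_apply_singleton _ _ (measurableSet_singleton y), PMF.uniformOfFintype_apply]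
  rw [hset]
  refine (measure_biUnion_finset_le _ _).trans_eq ?_
  simp_rw [hy]
  rw [Finset.sum_const, Finset.card_univ, nsmul_eq_mul, ← mul_assoc,
    ENNReal.mul_inv_cancel (by simp) (ENNReal.natCast_ne_top _), one_mul]

/-- No pair of distinct points exceeds the threshold `1 / |γ|`, so the sum in the hash property has
no nonzero terms. -/
theorem binningEnsemble_isHash [Nonempty α] : (binningEnsemble α γ).IsHash 1 0 := by
  classical
  intro x
  refine le_of_eq (ENNReal.tsum_eq_zero.2 fun x' => if_neg ?_)
  rintro ⟨hne, hlt⟩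
  rw [binningEnsemble_im, Set.ncard_univ, Nat.card_eq_fintype_card] at hlt
  refine absurd (binningEnsemble_collision (γ := γ) hne) (not_le.2 ?_)
  simpa using hlt

theorem binningEnsemble_hasHashProperty {α γ : ℕ → Type*} [∀ n, Nonempty (α n)]
    [∀ n, Fintype (γ n)] [∀ n, Nonempty (γ n)] [∀ n, MeasurableSpace (γ n)]
    [∀ n, MeasurableSingletonClass (γ n)] :
    HasHashProperty fun n => binningEnsemble (α n) (γ n) :=
  ⟨fun _ => 1, fun _ => 0, tendsto_const_nhds, tendsto_const_nhds, fun _ => binningEnsemble_isHash⟩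

end Binning

/-! ### The coding theorem -/

/-- Codes with functions from given ensembles with the hash property. -/
theorem eventually_exists_code
    {S I J : Type*} [Fintype S] [Fintype I] [Fintype J] [DecidableEq S] [DecidableEq I]
    (A : Finset (S × I)) (L : List (Finset I)) (hL : IsReverseLinearExtension A L)
    (D : J → Finset S)
    (Z : ℕ → S → Type*) [∀ n s, MeasurableSpace (Z n s)] [∀ n s, Countable (Z n s)]
    [∀ n s, MeasurableSingletonClass (Z n s)] [∀ n s, Nonempty (Z n s)]
    (X : I → Type*) [∀ i, Finite (X i)] [∀ i, MeasurableSpace (X i)]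
    [∀ i, MeasurableSingletonClass (X i)]
    (Y : ℕ → J → Type*) [∀ n j, MeasurableSpace (Y n j)]
    (μ : ∀ n, Measure (∀ s, Z n s)) [∀ n, IsProbabilityMeasure (μ n)]
    (hμ : ∀ n, IsConsistent A (μ n))
    (W : ∀ n i, Kernel (∀ s : messagesOf A i, Z n s) (Fin n → X i))
    [∀ n i, IsMarkovKernel (W n i)]
    (V : ∀ n, Kernel (∀ i, Fin n → X i) (∀ j, Y n j)) [∀ n, IsMarkovKernel (V n)]
    (r R : S → ℝ)
    (hEnc : ∀ I' ∈ accessFamily A, ∀ S' ⊆ privateMessages A I', S'.Nonempty →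
      ((∑ s ∈ S', (R s + r s) : ℝ) : EReal) <
        spectralInf (fun n => jointLaw A (μ n) (W n) (V n))
          (fun _ ω => S'.restrict ω.1) (fun _ ω => (publicMessages A I').restrict ω.1))
    (hDec : ∀ j, ∀ D' ⊆ D j, D'.Nonempty →
      spectralSup (fun n => jointLaw A (μ n) (W n) (V n))
          (fun _ ω => D'.restrict ω.1) (fun _ ω => (ω.2.2 j, (D j \ D').restrict ω.1)) <
        ((∑ s ∈ D', r s : ℝ) : EReal))
    (C M : ℕ → S → Type*) [∀ n s, Fintype (C n s)] [∀ n s, Nonempty (C n s)]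
    [∀ n s, MeasurableSpace (C n s)] [∀ n s, MeasurableSingletonClass (C n s)]
    [∀ n s, Fintype (M n s)] [∀ n s, Nonempty (M n s)]
    [∀ n s, MeasurableSpace (M n s)] [∀ n s, MeasurableSingletonClass (M n s)]
    (hC : ∀ s, Tendsto (fun n : ℕ => Real.logb 2 (Fintype.card (C n s)) / n) atTop (𝓝 (r s)))
    (hM : ∀ s, Tendsto (fun n : ℕ => Real.logb 2 (Fintype.card (M n s)) / n) atTop (𝓝 (R s)))
    (F : ∀ s n, Ensemble (Z n s) (C n s)) (G : ∀ s n, Ensemble (Z n s) (M n s))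
    (hFim : ∀ s n, (F s n).im = Set.univ) (hGim : ∀ s n, (G s n).im = Set.univ)
    (hF : ∀ s, HasHashProperty (F s)) (hG : ∀ s, HasHashProperty (G s)) (δ : ℝ) (hδ : 0 < δ) :
    ∀ᶠ n in atTop,
      ∃ (f : ∀ s, Z n s → C n s) (g : ∀ s, Z n s → M n s) (c : ∀ s, C n s),
        (∀ s, f s ∈ (F s n).funs) ∧ (∀ s, g s ∈ (G s n).funs) ∧
        errorProb A L D (μ n) (W n) (V n) f g c ≤ ENNReal.ofReal δ := by
  classical
  choose a b ha hb hFh using hF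
  choose a' b' ha' hb' hGh using hG
  -- The exponents are made total in `I'` and `O` so that they can be chosen as functions; the value
  -- `0` in the irrelevant cases carries no information.
  have hθ : ∀ (I' : Finset I) (O : Finset (privateMessages A I')), ∃ θ : ℝ,
      I' ∈ accessFamily A → O.Nonempty → ∑ i ∈ O, (R i + r i) < θ ∧
      Tendsto (fun n : ℕ => jointLaw A (μ n) (W n) (V n) {ω |
        ENNReal.ofReal ((2 : ℝ) ^ (-((n : ℝ) * θ))) <
          condDistrib (fun ω : (∀ s, Z n s) × (∀ i, Fin n → X i) × (∀ j, Y n j) =>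
            (liftFinset (privateMessages A I') O).restrict ω.1)
            (fun ω => (publicMessages A I').restrict ω.1) (jointLaw A (μ n) (W n) (V n))
            ((publicMessages A I').restrict ω.1)
            {(liftFinset (privateMessages A I') O).restrict ω.1}}) atTop (𝓝 0) := by
    intro I' O
    by_cases h : I' ∈ accessFamily A ∧ O.Nonempty
    · obtain ⟨θ, h1, h2⟩ := exists_tendsto_of_lt_spectralInf _ _ _
        (hEnc I' h.1 (liftFinset _ O) (liftFinset_subset _ O) (liftFinset_nonempty h.2))
      refine ⟨θ, fun _ _ => ⟨?_, h2⟩⟩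
      rw [liftFinset, Finset.sum_map] at h1
      exact h1
    · exact ⟨0, fun h1 h2 => absurd ⟨h1, h2⟩ h⟩
  choose θ hθ using hθ
  have hν : ∀ (j : J) (O : Finset (D j)), ∃ ν : ℝ,
      O.Nonempty → ν < ∑ i ∈ O, r i ∧
      Tendsto (fun n : ℕ => jointLaw A (μ n) (W n) (V n) {ω |
          condDistrib (fun ω : (∀ s, Z n s) × (∀ i, Fin n → X i) × (∀ j, Y n j) =>
            (liftFinset (D j) O).restrict ω.1)
            (fun ω => (ω.2.2 j, (D j \ liftFinset (D j) O).restrict ω.1))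
            (jointLaw A (μ n) (W n) (V n))
            (ω.2.2 j, (D j \ liftFinset (D j) O).restrict ω.1)
            {(liftFinset (D j) O).restrict ω.1} <
          (ENNReal.ofReal ((2 : ℝ) ^ ((n : ℝ) * ν)))⁻¹}) atTop (𝓝 0) := by
    intro j O
    by_cases h : O.Nonempty
    · obtain ⟨ν, h1, h2⟩ := exists_tendsto_of_spectralSup_lt _ _ _
        (fun n => (Finset.measurable_restrict _).comp measurable_fst)
        (fun n => ((measurable_pi_apply j).comp (measurable_snd.comp measurable_snd)).prodMk
          ((Finset.measurable_restrict _).comp measurable_fst))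
        (hDec j (liftFinset _ O) (liftFinset_subset _ O) (liftFinset_nonempty h))
      refine ⟨ν, fun _ => ⟨?_, h2⟩⟩
      rw [liftFinset, Finset.sum_map] at h1
      exact h1
    · exact ⟨0, fun h1 => absurd h1 h⟩
  choose ν hν using hν
  set m : ℕ := (accessFamily A).card with hm
  -- In the limit each of the `m` steps costs at most `η`. This choice makes `m * η < δ`, and the `+
  -- 1` covers `m = 0`.
  set η : ℝ≥0∞ := ENNReal.ofReal (δ / (2 * (m + 1))) with hη
  have hη0 : η ≠ 0 := (ENNReal.ofReal_pos.2 (by positivity)).ne'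
  have hηtop : η ≠ ∞ := ENNReal.ofReal_ne_top
  -- The value `1` at the empty set is the trivial bound on the total conditional weight, and it
  -- gives the limit `1` of the collision sum.
  let B : ∀ (_n : ℕ) (I' : Finset I), Finset (privateMessages A I') → ℝ≥0∞ := fun n I' O =>
    if O = ∅ then 1 else ENNReal.ofReal ((2 : ℝ) ^ (-((n : ℝ) * θ I' O)))
  let N : ∀ (_n : ℕ) (j : J), Finset (D j) → ℝ≥0∞ := fun n j O =>
    ENNReal.ofReal ((2 : ℝ) ^ ((n : ℝ) * ν j O))
  have hDecLim : ∀ j, Tendsto (fun n : ℕ =>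
      2 * jointLaw A (μ n) (W n) (V n) {ω | decoderView (D j) j ω ∉
        posteriorTypical A (μ n) (W n) (V n) (D j) j (N n j)} +
          (∑ s : D j, (b s n : ℝ≥0∞) +
          ∑ O ∈ Finset.univ.filter fun O : Finset (D j) => O.Nonempty,
            N n j O * ∏ s ∈ O, ((a s n : ℝ≥0∞) / (Fintype.card (C n s) : ℝ≥0∞)))) atTop (𝓝 0) := by
    intro j
    have h1 : Tendsto (fun n : ℕ => jointLaw A (μ n) (W n) (V n) {ω | decoderView (D j) j ω ∉
        posteriorTypical A (μ n) (W n) (V n) (D j) j (N n j)}) atTop (𝓝 0) := by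
      have h2 := tendsto_finsetSum (Finset.univ.filter fun O : Finset (D j) => O.Nonempty)
        fun O hO => (hν j O (Finset.mem_filter.1 hO).2).2
      rw [Finset.sum_const_zero] at h2
      exact tendsto_of_tendsto_of_tendsto_of_le_of_le tendsto_const_nhds h2 (fun _ => zero_le)
        fun n => measure_posteriorTypical_compl_le A (μ n) (W n) (V n) (D j) j (N n j)
    have h3 : Tendsto (fun n : ℕ => ∑ s : D j, (b s n : ℝ≥0∞)) atTop (𝓝 0) := by
      have := tendsto_finsetSum (Finset.univ : Finset (D j)) fun s _ =>
        ENNReal.tendsto_coe.2 (hb s)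
      simpa using this
    have h4 : Tendsto (fun n : ℕ => ∑ O ∈ Finset.univ.filter fun O : Finset (D j) => O.Nonempty,
        N n j O * ∏ s ∈ O, ((a s n : ℝ≥0∞) / (Fintype.card (C n s) : ℝ≥0∞))) atTop (𝓝 0) := by
      rw [← Finset.sum_const_zero (s := Finset.univ.filter fun O : Finset (D j) => O.Nonempty)]
      refine tendsto_finsetSum _ fun O hO => ?_
      have h5 := tendsto_mul_prod_inv_card O (fun n (s : D j) => Fintype.card (C n s))
        (fun s => r s) (fun n s _ => Fintype.card_pos) (fun s _ => hC s)
        (hν j O (Finset.mem_filter.1 hO).2).1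
      have h6 := tendsto_prod_coe O (a := fun n (s : D j) => a s n) (l := fun _ => 1)
        fun s _ => ha s
      refine (tendsto_mul_zero_of_tendsto (by simp) h6 h5).congr fun n => ?_
      simp only [div_eq_mul_inv, Finset.prod_mul_distrib, N]
      ring
    simpa using (ENNReal.Tendsto.const_mul h1 (Or.inr ENNReal.ofNat_ne_top)).add (h3.add h4)
  have hEncLim : ∀ I' ∈ accessFamily A, Tendsto (fun n : ℕ => 4 * η ^ 2 + 1 +
      (Fintype.card (∀ s : privateMessages A I', C n s × M n s) : ℝ≥0∞) *
        ∑ O : Finset (privateMessages A I'),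
          (∏ s ∈ Oᶜ, ((a s n : ℝ≥0∞) / (Fintype.card (C n s) : ℝ≥0∞) *
            (a' s n / (Fintype.card (M n s) : ℝ≥0∞)))) *
          ((∏ s ∈ O, (1 + ((b s n : ℝ≥0∞) + b' s n))) * B n I' O) +
      (2 + 4 * η) * μ n {z | (privateMessages A I').restrict z ∉
        condTypical (μ n) (privateMessages A I') (publicMessages A I') (B n I')
          ((publicMessages A I').restrict z)}) atTop (𝓝 (4 * η ^ 2 + 2)) := by
    intro I' hI'
    have h1 : Tendsto (fun n : ℕ => μ n {z | (privateMessages A I').restrict z ∉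
        condTypical (μ n) (privateMessages A I') (publicMessages A I') (B n I')
          ((publicMessages A I').restrict z)}) atTop (𝓝 0) := by
      have h2 := tendsto_finsetSum
        (Finset.univ.filter fun O : Finset (privateMessages A I') => O.Nonempty)
        fun O hO => (hθ I' O hI' (Finset.mem_filter.1 hO).2).2
      rw [Finset.sum_const_zero] at h2
      refine tendsto_of_tendsto_of_tendsto_of_le_of_le tendsto_const_nhds h2 (fun _ => zero_le)
        fun n => (measure_condTypical_compl_le A (μ n) (W n) (V n) (privateMessages A I')
          (publicMessages A I') (B n I') (by simp [B])).trans_eq ?_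
      refine Finset.sum_congr rfl fun O hO => ?_
      simp only [B, if_neg (Finset.nonempty_iff_ne_empty.1 (Finset.mem_filter.1 hO).2)]
    have h3 := tendsto_collisionSum (ι := privateMessages A I')
      (K := fun n s => Fintype.card (C n s)) (K' := fun n s => Fintype.card (M n s))
      (ρ := fun s => r s) (ρ' := fun s => R s) (a := fun n s => a s n) (b := fun n s => b s n)
      (a' := fun n s => a' s n) (b' := fun n s => b' s n) (θ := θ I')
      (fun n s => Fintype.card_pos) (fun n s => Fintype.card_pos) (fun s => hC s) (fun s => hM s)
      (fun s => ha s) (fun s => hb s) (fun s => ha' s) (fun s => hb' s)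
      fun O hO => (hθ I' O hI' hO).1
    have h4 : ∀ n, (Fintype.card (∀ s : privateMessages A I', C n s × M n s) : ℝ≥0∞) =
        ∏ s : privateMessages A I', ((Fintype.card (C n s) : ℝ≥0∞) *
          (Fintype.card (M n s) : ℝ≥0∞)) := fun n => by
      rw [Fintype.card_pi]
      push_cast [Fintype.card_prod]
      rfl
    have h5 := (h3.const_add (4 * η ^ 2 + 1)).add (ENNReal.Tendsto.const_mul h1
      (Or.inr (ENNReal.add_ne_top.2 ⟨ENNReal.ofNat_ne_top, ENNReal.mul_ne_top
        ENNReal.ofNat_ne_top hηtop⟩ : 2 + 4 * η ≠ ∞)))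
    rw [mul_zero, add_zero, add_assoc, one_add_one_eq_two] at h5
    refine h5.congr fun n => ?_
    rw [h4]
  have hlim : Tendsto (fun n : ℕ => 4 * η * ∑ j, (2 * jointLaw A (μ n) (W n) (V n)
      {ω | decoderView (D j) j ω ∉ posteriorTypical A (μ n) (W n) (V n) (D j) j (N n j)} +
          (∑ s : D j, (b s n : ℝ≥0∞) +
          ∑ O ∈ Finset.univ.filter fun O : Finset (D j) => O.Nonempty,
            N n j O * ∏ s ∈ O, ((a s n : ℝ≥0∞) / (Fintype.card (C n s) : ℝ≥0∞)))) +
        ∑ I' ∈ accessFamily A, (4 * η ^ 2 + 1 +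
          (Fintype.card (∀ s : privateMessages A I', C n s × M n s) : ℝ≥0∞) *
          ∑ O : Finset (privateMessages A I'),
            (∏ s ∈ Oᶜ, ((a s n : ℝ≥0∞) / (Fintype.card (C n s) : ℝ≥0∞) *
              (a' s n / (Fintype.card (M n s) : ℝ≥0∞)))) *
            ((∏ s ∈ O, (1 + ((b s n : ℝ≥0∞) + b' s n))) * B n I' O) +
          (2 + 4 * η) * μ n {z | (privateMessages A I').restrict z ∉
            condTypical (μ n) (privateMessages A I') (publicMessages A I') (B n I')
              ((publicMessages A I').restrict z)})) atTop
      (𝓝 (4 * η * ∑ _j : J, 0 + ∑ _I' ∈ accessFamily A, (4 * η ^ 2 + 2))) :=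
    (ENNReal.Tendsto.const_mul (tendsto_finsetSum _ fun j _ => hDecLim j)
      (Or.inr (ENNReal.mul_ne_top ENNReal.ofNat_ne_top hηtop))).add
      (tendsto_finsetSum _ hEncLim)
  have hηm : (m : ℝ≥0∞) * η < ENNReal.ofReal δ := by
    rw [hη, ← ENNReal.ofReal_natCast, ← ENNReal.ofReal_mul (by positivity)]
    refine (ENNReal.ofReal_lt_ofReal_iff hδ).2 ?_
    rw [mul_div_assoc', div_lt_iff₀ (by positivity)]
    nlinarith [(Nat.cast_nonneg m : (0 : ℝ) ≤ m)]
  have h2top : (∑ _I' ∈ accessFamily A, (2 : ℝ≥0∞)) ≠ ∞ :=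
    ENNReal.sum_ne_top.2 fun _ _ => ENNReal.ofNat_ne_top
  -- The constants `2` of the steps stand on both sides and cancel. What remains is `4 η (m η) < 4 η
  -- δ`, a strict inequality at the limit that therefore holds for all large `n`.
  have hlt : 4 * η * ∑ _j : J, 0 + ∑ _I' ∈ accessFamily A, (4 * η ^ 2 + 2) <
      4 * η * ENNReal.ofReal δ + ∑ _I' ∈ accessFamily A, 2 := by
    rw [Finset.sum_const_zero, mul_zero, zero_add, Finset.sum_add_distrib]
    refine ENNReal.add_lt_add_right h2top ?_
    rw [Finset.sum_const, nsmul_eq_mul, ← hm]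
    calc (m : ℝ≥0∞) * (4 * η ^ 2) = 4 * η * (m * η) := by ring
      _ < 4 * η * ENNReal.ofReal δ := (ENNReal.mul_lt_mul_iff_right
          (mul_ne_zero (by norm_num) hη0) (ENNReal.mul_ne_top ENNReal.ofNat_ne_top hηtop)).2 hηm
  filter_upwards [hlim.eventually_lt_const hlt] with n hn
  obtain ⟨f, g, c, hf, hg, hle⟩ := exists_code_le A D (μ n) (W n) (V n) (fun s => F s n)
    (fun s => a s n) L hL (hμ n) (fun s => G s n) (fun s => hFim s n) (fun s => hGim s n)
    (fun s => b s n) (fun s => a' s n) (fun s => b' s n) (fun s => hFh s n) (fun s => hGh s n)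
    η hηtop (B n) (fun j => posteriorTypical A (μ n) (W n) (V n) (D j) j (N n j))
    (fun j => measurableSet_posteriorTypical A (μ n) (W n) (V n) (D j) j (N n j)) (N n)
    fun j y z O hO => tsum_posteriorTypical_le A (μ n) (W n) (V n) (D j) j (N n j)
      (fun O => (ENNReal.ofReal_pos.2 (by positivity)).ne') (fun O => ENNReal.ofReal_ne_top) y z O hO
  refine ⟨f, g, c, hf, hg, ?_⟩
  have h1 := hle.trans hn.le
  rw [ENNReal.add_le_add_iff_right h2top] at h1
  exact (ENNReal.mul_le_mul_iff_right (mul_ne_zero (by norm_num) hη0)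
    (ENNReal.mul_ne_top ENNReal.ofNat_ne_top hηtop)).1 h1

end RelaylessNetwork

end

open RelaylessNetwork in
theorem theorem2
    {S I J : Type*} [Fintype S] [Fintype I] [Fintype J] [DecidableEq S] [DecidableEq I]
    -- the access structure, a linear extension, and the sets of messages wanted by the decoders
    (A : Finset (S × I)) (L : List (Finset I)) (hL : IsReverseLinearExtension A L)
    (D : J → Finset S)
    -- the alphabets of sources, channel inputs and channel outputs
    (Z : ℕ → S → Type*) [∀ n s, MeasurableSpace (Z n s)] [∀ n s, Countable (Z n s)]
    [∀ n s, MeasurableSingletonClass (Z n s)] [∀ n s, Nonempty (Z n s)]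
    (X : I → Type*) [∀ i, Finite (X i)] [∀ i, MeasurableSpace (X i)]
    [∀ i, MeasurableSingletonClass (X i)]
    (Y : ℕ → J → Type*) [∀ n j, MeasurableSpace (Y n j)]
    -- the laws of the sources and of the channel inputs, and the channel
    (μ : ∀ n, Measure (∀ s, Z n s)) [∀ n, IsProbabilityMeasure (μ n)]
    (hμ : ∀ n, IsConsistent A (μ n))
    (W : ∀ n i, Kernel (∀ s : messagesOf A i, Z n s) (Fin n → X i))
    [∀ n i, IsMarkovKernel (W n i)]
    (V : ∀ n, Kernel (∀ i, Fin n → X i) (∀ j, Y n j)) [∀ n, IsMarkovKernel (V n)]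
    -- the rates
    (r R : S → ℝ) (hR : ∀ s, 0 ≤ R s)
    (hEnc : ∀ I' ∈ accessFamily A, ∀ S' ⊆ privateMessages A I', S'.Nonempty →
      ((∑ s ∈ S', (R s + r s) : ℝ) : EReal) <
        spectralInf (fun n => jointLaw A (μ n) (W n) (V n))
          (fun _ ω => S'.restrict ω.1) (fun _ ω => (publicMessages A I').restrict ω.1))
    (hDec : ∀ j, ∀ D' ⊆ D j, D'.Nonempty →
      spectralSup (fun n => jointLaw A (μ n) (W n) (V n))
          (fun _ ω => D'.restrict ω.1) (fun _ ω => (ω.2.2 j, (D j \ D').restrict ω.1)) <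
        ((∑ s ∈ D', r s : ℝ) : EReal))
    -- the ranges of the functions `f_s` and the sets of messages, of rates `r_s` and `R_s`
    (C M : ℕ → S → Type*) [∀ n s, Fintype (C n s)] [∀ n s, Nonempty (C n s)]
    [∀ n s, MeasurableSpace (C n s)] [∀ n s, MeasurableSingletonClass (C n s)]
    [∀ n s, Fintype (M n s)] [∀ n s, Nonempty (M n s)]
    [∀ n s, MeasurableSpace (M n s)] [∀ n s, MeasurableSingletonClass (M n s)]
    (hC : ∀ s, Tendsto (fun n : ℕ => Real.logb 2 (Fintype.card (C n s)) / n) atTop (𝓝 (r s)))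
    (hM : ∀ s, Tendsto (fun n : ℕ => Real.logb 2 (Fintype.card (M n s)) / n) atTop (𝓝 (R s))) :
    (∀ δ : ℝ, 0 < δ → ∀ᶠ n in atTop,
      ∃ (f : ∀ s, Z n s → C n s) (g : ∀ s, Z n s → M n s) (c : ∀ s, C n s),
        errorProb A L D (μ n) (W n) (V n) f g c ≤ ENNReal.ofReal δ) ∧
    (∀ (F : ∀ s n, Ensemble (Z n s) (C n s)) (G : ∀ s n, Ensemble (Z n s) (M n s)),
      (∀ s n, (F s n).im = Set.univ) → (∀ s n, (G s n).im = Set.univ) →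
      (∀ s, HasHashProperty (F s)) → (∀ s, HasHashProperty (G s)) →
      ∀ δ : ℝ, 0 < δ → ∀ᶠ n in atTop,
        ∃ (f : ∀ s, Z n s → C n s) (g : ∀ s, Z n s → M n s) (c : ∀ s, C n s),
          (∀ s, f s ∈ (F s n).funs) ∧ (∀ s, g s ∈ (G s n).funs) ∧
          errorProb A L D (μ n) (W n) (V n) f g c ≤ ENNReal.ofReal δ) := by
  have hmain : ∀ (F : ∀ s n, Ensemble (Z n s) (C n s)) (G : ∀ s n, Ensemble (Z n s) (M n s)),
      (∀ s n, (F s n).im = Set.univ) → (∀ s n, (G s n).im = Set.univ) →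
      (∀ s, HasHashProperty (F s)) → (∀ s, HasHashProperty (G s)) →
      ∀ δ : ℝ, 0 < δ → ∀ᶠ n in atTop,
        ∃ (f : ∀ s, Z n s → C n s) (g : ∀ s, Z n s → M n s) (c : ∀ s, C n s),
          (∀ s, f s ∈ (F s n).funs) ∧ (∀ s, g s ∈ (G s n).funs) ∧
          errorProb A L D (μ n) (W n) (V n) f g c ≤ ENNReal.ofReal δ :=
    fun F G hFim hGim hF hG δ hδ => eventually_exists_code A L hL D Z X Y μ hμ W V r R hEnc hDec
      C M hC hM F G hFim hGim hF hG δ hδ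
  refine ⟨fun δ hδ => ?_, hmain⟩
  -- The ensembles of all functions with independent uniform values have the hash property, so the
  -- first claim is a case of the second.
  filter_upwards [hmain (fun s n => binningEnsemble (Z n s) (C n s))
    (fun s n => binningEnsemble (Z n s) (M n s)) (fun _ _ => binningEnsemble_im)
    (fun _ _ => binningEnsemble_im) (fun _ => binningEnsemble_hasHashProperty)
    (fun _ => binningEnsemble_hasHashProperty) δ hδ] with n hn
  obtain ⟨f, g, c, -, -, h⟩ := hn
  exact ⟨f, g, c, h⟩
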